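/- There are a single deterministic program $P$ and absolute constants $c,C,d\in\mathbb N$ such that the following holds. Let $G=(V,E,w)$ be a finite simple undirected graph with $n$ vertices, $m$ edges and positive real edge weights $w$, let $k\ge 1$ be an integer, and let $\varepsilon>0$ be real. Given $n$, $m$, $k$, $\varepsilon$ and an arbitrary list of the edges of $G$ with their weights, the program $P$ halts after at most $C(m+1)$ steps, and it outputs a subgraph $H=(V,E',w)$ of $G$ such that $$d_H(u,v)\ \le\ (2k-1)(1+\varepsilon)\, d_G(u,v)\qquad\text{for all } u,v\in V,$$ where $d_X$ is the (possibly infinite) shortest-path distance in $X$ with respect to $w$, and $$|E'|\ \le\ C\left(1+\tfrac1\varepsilon\right)^{d} n^{1+1/k}\,(1+\log k).$$ In short: a $(2k-1)(1+\varepsilon)$-spanner with $O_\varepsilon\!\left(n^{1+1/k}\log k\right)$ edges (for $k\ge2$) is constructed deterministically in time $O(m)$, where $O_\varepsilon$ hides a factor polynomial in $1/\varepsilon$ and the time bound hides an absolute constant only. The machine is a real RAM with unit cost for each operation. Its memory consists of integer cells and real cells with indirect addressing, and cells not used by the input are initially $0$. The operations are $+,-,\times$ and comparison on integers; $+,-,\times,\div,\exp,\log$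 and comparison on reals; conversion of an integer to a real and rounding down of a real to an integer; loads, stores and branches. All integers computed during the run are words of absolute value at most $S^{c}$, where $S=n+m+k+\lceil 1/\varepsilon\rceil+\max_{e\in E}\lceil|\log w(e)|\rceil+2$ (the maximum being $0$ if $E=\emptyset$). -/

import Mathlib

/-! ## Weighted graphs, distances and spanners -/

/-- A finite undirected weighted graph: a simple graph on the vertices `0, …, n - 1` with positive
real edge weights (the values of `weight` off the edge set are irrelevant). -/
structure WeightedGraph (n : ℕ) where
  graph : SimpleGraph (Fin n)
  weight : Sym2 (Fin n) → ℝ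
  weight_pos : ∀ e ∈ graph.edgeSet, 0 < weight e

/-- The total weight of a walk. -/
noncomputable def walkWeight {V : Type*} {G : SimpleGraph V} (w : Sym2 V → ℝ) {u v : V}
    (p : G.Walk u v) : ℝ :=
  (p.edges.map w).sum

/-- The shortest path distance in `G` under the edge weights `w` (`⊤` if there is no path). -/
noncomputable def pathDist {V : Type*} (G : SimpleGraph V) (w : Sym2 V → ℝ) (u v : V) : ENNReal :=
  ⨅ p : G.Walk u v, ENNReal.ofReal (walkWeight w p)

/-- `H` is a `t`-spanner of `G`: a subgraph on all the vertices (with the weights of `G`) in which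
every distance is at most `t` times the distance in `G`. -/
def IsSpanner {n : ℕ} (G : WeightedGraph n) (t : ℝ) (H : SimpleGraph (Fin n)) : Prop :=
  H ≤ G.graph ∧
    ∀ u v : Fin n, pathDist H G.weight u v ≤ ENNReal.ofReal t * pathDist G.graph G.weight u v

/-- A listing of the edges of `G`: each edge occurs exactly once, as an ordered pair
`(src i, tgt i)` in either orientation. In particular `m` is the number of edges. -/
structure EdgeList {n : ℕ} (G : WeightedGraph n) (m : ℕ) where
  src : Fin m → Fin n
  tgt : Fin m → Fin n
  bijOn : Set.BijOn (fun i => s(src i, tgt i)) Set.univ G.graph.edgeSet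

/-! ## The machine model: a real RAM with bounded integer words

A program is a finite text, with integer literals as its only constants. Memory consists of
integer cells and real cells, organised in banks with indirect addressing. Every arithmetic
operation, comparison, memory access and branch costs one unit. Integer cells are machine words:
an integer computed during a run must have absolute value at most the word bound `W`, otherwise
the run is stuck. Real cells hold exact real numbers. -/

namespace RealRAM

/-- A memory state: integer banks and real banks. The cell at address `i` of bank `b` holds
`int b i`, respectively `real b i`. -/
structure State where
  int : ℕ → ℤ → ℤ
  real : ℕ → ℤ → ℝ

mutual

/-- Integer expressions. `get b i` reads the cell at address `i` of integer bank `b`, and `floor`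
rounds a real number down to an integer. -/
inductive IExpr : Type
  | lit (z : ℤ)
  | get (b : ℕ) (i : IExpr)
  | add (x y : IExpr)
  | sub (x y : IExpr)
  | mul (x y : IExpr)
  | floor (x : RExpr)

/-- Real expressions. -/
inductive RExpr : Type
  | ofInt (x : IExpr)
  | get (b : ℕ) (i : IExpr)
  | add (x y : RExpr)
  | sub (x y : RExpr)
  | mul (x y : RExpr)
  | div (x y : RExpr)
  | exp (x : RExpr)
  | log (x : RExpr)

end

mutual

/-- The value of an integer expression. -/
noncomputable def IExpr.eval (s : State) : IExpr → ℤ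
  | .lit z => z
  | .get b i => s.int b (i.eval s)
  | .add x y => x.eval s + y.eval s
  | .sub x y => x.eval s - y.eval s
  | .mul x y => x.eval s * y.eval s
  | .floor x => ⌊x.eval s⌋

/-- The value of a real expression. -/
noncomputable def RExpr.eval (s : State) : RExpr → ℝ
  | .ofInt x => (x.eval s : ℝ)
  | .get b i => s.real b (i.eval s)
  | .add x y => x.eval s + y.eval s
  | .sub x y => x.eval s - y.eval s
  | .mul x y => x.eval s * y.eval s
  | .div x y => x.eval s / y.eval s
  | .exp x => Real.exp (x.eval s)
  | .log x => Real.log (x.eval s)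

end

mutual

/-- Evaluation of an integer expression is legal: every integer that is computed fits into a word
(values read from memory were checked when they were stored), and see `RExpr.Ok`. -/
def IExpr.Ok (W : ℕ) (s : State) : IExpr → Prop
  | .lit z => |z| ≤ W
  | .get _ i => i.Ok W s
  | .add x y => x.Ok W s ∧ y.Ok W s ∧ |x.eval s + y.eval s| ≤ W
  | .sub x y => x.Ok W s ∧ y.Ok W s ∧ |x.eval s - y.eval s| ≤ W
  | .mul x y => x.Ok W s ∧ y.Ok W s ∧ |x.eval s * y.eval s| ≤ W
  | .floor x => x.Ok W s ∧ |⌊x.eval s⌋| ≤ W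

/-- Evaluation of a real expression is legal: divisors are nonzero and arguments of the logarithm
are positive. -/
def RExpr.Ok (W : ℕ) (s : State) : RExpr → Prop
  | .ofInt x => x.Ok W s
  | .get _ i => i.Ok W s
  | .add x y => x.Ok W s ∧ y.Ok W s
  | .sub x y => x.Ok W s ∧ y.Ok W s
  | .mul x y => x.Ok W s ∧ y.Ok W s
  | .div x y => x.Ok W s ∧ y.Ok W s ∧ y.eval s ≠ 0
  | .exp x => x.Ok W s
  | .log x => x.Ok W s ∧ 0 < x.eval s

end

mutual

/-- The cost of an integer expression: the number of its operations. -/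
def IExpr.cost : IExpr → ℕ
  | .lit _ => 1
  | .get _ i => i.cost + 1
  | .add x y => x.cost + y.cost + 1
  | .sub x y => x.cost + y.cost + 1
  | .mul x y => x.cost + y.cost + 1
  | .floor x => x.cost + 1

/-- The cost of a real expression: the number of its operations. -/
def RExpr.cost : RExpr → ℕ
  | .ofInt x => x.cost + 1
  | .get _ i => i.cost + 1
  | .add x y => x.cost + y.cost + 1
  | .sub x y => x.cost + y.cost + 1
  | .mul x y => x.cost + y.cost + 1
  | .div x y => x.cost + y.cost + 1
  | .exp x => x.cost + 1
  | .log x => x.cost + 1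

end

/-- Tests. -/
inductive Test : Type
  | ile (x y : IExpr)
  | rle (x y : RExpr)
  | neg (b : Test)
  | conj (b c : Test)

/-- The test holds. -/
def Test.Holds (s : State) : Test → Prop
  | .ile x y => x.eval s ≤ y.eval s
  | .rle x y => x.eval s ≤ y.eval s
  | .neg b => ¬ b.Holds s
  | .conj b c => b.Holds s ∧ c.Holds s

/-- Evaluation of the test is legal (both parts of a conjunction are evaluated). -/
def Test.Ok (W : ℕ) (s : State) : Test → Prop
  | .ile x y => x.Ok W s ∧ y.Ok W s
  | .rle x y => x.Ok W s ∧ y.Ok W s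
  | .neg b => b.Ok W s
  | .conj b c => b.Ok W s ∧ c.Ok W s

/-- The cost of a test: the number of its operations. -/
def Test.cost : Test → ℕ
  | .ile x y => x.cost + y.cost + 1
  | .rle x y => x.cost + y.cost + 1
  | .neg b => b.cost + 1
  | .conj b c => b.cost + c.cost + 1

/-- Programs. `setInt b i x` stores `x` at address `i` of integer bank `b`, `branch` is
if-then-else, and `loop b p` repeats `p` as long as `b` holds. -/
inductive Prog : Type
  | skip
  | setInt (b : ℕ) (i : IExpr) (x : IExpr)
  | setReal (b : ℕ) (i : IExpr) (x : RExpr)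
  | seq (p q : Prog)
  | branch (b : Test) (p q : Prog)
  | loop (b : Test) (p : Prog)

/-- Storing a value in an integer cell. -/
def State.storeInt (s : State) (b : ℕ) (i x : ℤ) : State :=
  { s with int := Function.update s.int b (Function.update (s.int b) i x) }

/-- Storing a value in a real cell. -/
def State.storeReal (s : State) (b : ℕ) (i : ℤ) (x : ℝ) : State :=
  { s with real := Function.update s.real b (Function.update (s.real b) i x) }

/-- `Exec W p s r t`: started in the state `s`, the program `p` halts in the state `r` after exactly
`t` steps, all its operations being legal for the word bound `W`. -/
inductive Exec (W : ℕ) : Prog → State → State → ℕ → Prop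
  | skip (s : State) : Exec W .skip s s 1
  | setInt (b : ℕ) (i x : IExpr) (s : State) (hi : i.Ok W s) (hx : x.Ok W s) :
      Exec W (.setInt b i x) s (s.storeInt b (i.eval s) (x.eval s)) (i.cost + x.cost + 1)
  | setReal (b : ℕ) (i : IExpr) (x : RExpr) (s : State) (hi : i.Ok W s) (hx : x.Ok W s) :
      Exec W (.setReal b i x) s (s.storeReal b (i.eval s) (x.eval s)) (i.cost + x.cost + 1)
  | seq {p q : Prog} {s r v : State} {t₁ t₂ : ℕ} (hp : Exec W p s r t₁) (hq : Exec W q r v t₂) :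
      Exec W (.seq p q) s v (t₁ + t₂)
  | branch_true {b : Test} {p q : Prog} {s r : State} {t : ℕ} (hb : b.Ok W s) (h : b.Holds s)
      (hp : Exec W p s r t) : Exec W (.branch b p q) s r (b.cost + 1 + t)
  | branch_false {b : Test} {p q : Prog} {s r : State} {t : ℕ} (hb : b.Ok W s) (h : ¬ b.Holds s)
      (hq : Exec W q s r t) : Exec W (.branch b p q) s r (b.cost + 1 + t)
  | loop_true {b : Test} {p : Prog} {s r v : State} {t₁ t₂ : ℕ} (hb : b.Ok W s) (h : b.Holds s)
      (hp : Exec W p s r t₁) (hl : Exec W (.loop b p) r v t₂) :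
      Exec W (.loop b p) s v (b.cost + 1 + t₁ + t₂)
  | loop_false {b : Test} {p : Prog} {s : State} (hb : b.Ok W s) (h : ¬ b.Holds s) :
      Exec W (.loop b p) s s (b.cost + 1)

/-- The machine is deterministic: final state and running time are determined by program and
initial state. -/
theorem Exec.deterministic {W : ℕ} {p : Prog} {s r₁ r₂ : State} {t₁ t₂ : ℕ}
    (h₁ : Exec W p s r₁ t₁) (h₂ : Exec W p s r₂ t₂) : r₁ = r₂ ∧ t₁ = t₂ := by
  induction h₁ generalizing r₂ t₂ with
  | skip s => cases h₂; exact ⟨rfl, rfl⟩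
  | setInt b i x s hi hx => cases h₂; exact ⟨rfl, rfl⟩
  | setReal b i x s hi hx => cases h₂; exact ⟨rfl, rfl⟩
  | seq hp hq ihp ihq =>
    cases h₂ with
    | seq hp₂ hq₂ =>
      obtain ⟨rfl, rfl⟩ := ihp hp₂
      obtain ⟨rfl, rfl⟩ := ihq hq₂
      exact ⟨rfl, rfl⟩
  | branch_true hb h hp ih =>
    cases h₂ with
    | branch_true _ _ hp₂ => obtain ⟨rfl, rfl⟩ := ih hp₂; exact ⟨rfl, rfl⟩
    | branch_false _ hn _ => exact absurd h hn
  | branch_false hb h hp ih =>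
    cases h₂ with
    | branch_true _ hn _ => exact absurd hn h
    | branch_false _ _ hp₂ => obtain ⟨rfl, rfl⟩ := ih hp₂; exact ⟨rfl, rfl⟩
  | loop_true hb h hp hl ihp ihl =>
    cases h₂ with
    | loop_true _ _ hp₂ hl₂ =>
      obtain ⟨rfl, rfl⟩ := ihp hp₂
      obtain ⟨rfl, rfl⟩ := ihl hl₂
      exact ⟨rfl, rfl⟩
    | loop_false _ hn => exact absurd h hn
  | loop_false hb h =>
    cases h₂ with
    | loop_true _ hn _ _ => exact absurd hn h
    | loop_false _ _ => exact ⟨rfl, rfl⟩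

end RealRAM

/-! ## Input and output of a spanner algorithm -/

namespace EdgeList

variable {n m : ℕ} {G : WeightedGraph n}

/-- The initial memory: integer bank `0` holds `n`, `m`, `k` at the addresses `0`, `1`, `2`; integer
banks `1` and `2` hold the two endpoints of the `i`-th edge at address `i`; real bank `0` holds `ε`
at address `0`; real bank `1` holds the weight of the `i`-th edge at address `i`. All other cells
are zero. -/
noncomputable def initialState (L : EdgeList G m) (k : ℕ) (ε : ℝ) : RealRAM.State where
  int b a :=
    if b = 0 then (if a = 0 then (n : ℤ) else if a = 1 then (m : ℤ) else if a = 2 then (k : ℤ) else 0)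
    else if h : 0 ≤ a ∧ a.toNat < m then
      (if b = 1 then ((L.src ⟨a.toNat, h.2⟩ : ℕ) : ℤ)
        else if b = 2 then ((L.tgt ⟨a.toNat, h.2⟩ : ℕ) : ℤ) else 0)
    else 0
  real b a :=
    if b = 0 then (if a = 0 then ε else 0)
    else if h : 0 ≤ a ∧ a.toNat < m then
      (if b = 1 then G.weight s(L.src ⟨a.toNat, h.2⟩, L.tgt ⟨a.toNat, h.2⟩) else 0)
    else 0

/-- The output, read off the final memory: the graph of all edges `i` for which the cell at address
`i` of integer bank `3` is nonzero. -/
def outputGraph (L : EdgeList G m) (r : RealRAM.State) : SimpleGraph (Fin n) :=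
  SimpleGraph.fromEdgeSet {e | ∃ i : Fin m, r.int 3 (i : ℕ) ≠ 0 ∧ e = s(L.src i, L.tgt i)}

/-- The magnitude of an input. Integer words have `O(log (magnitude))` bits: they can hold numbers
that are polynomial in `n`, `m`, `k`, `1 / ε` and the logarithms of the weights. -/
noncomputable def magnitude (L : EdgeList G m) (k : ℕ) (ε : ℝ) : ℕ :=
  n + m + k + ⌈1 / ε⌉₊ +
    (Finset.univ.sup fun i : Fin m => ⌈|Real.log (G.weight s(L.src i, L.tgt i))|⌉₊) + 2

end EdgeList

/-!
The weights are rounded down to powers of `b = 1 + slack ε`, and the exponent of an edge is its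
scale. The scales are divided into `g = O(1 / ε ^ 2)` classes modulo `g`; within a class, the
weights of successive scales differ by a factor `b ^ g` of order `1 / ε`. Every class works on its
own copy of the vertex set, and maintains a clustering of it whose clusters, joined by edges of the
spanner, are so small that their diameter is negligible against the weights still to come
(`Inv.near_label`). The edges are processed scale by scale. The edges of one scale, the batch, form
a graph on the current clusters of their class, and two things are done with it.

* *Clusters are merged.* A maximal matching of this graph is found greedily, and a cluster that is
  not matched joins the group of a matched neighbour (`Inv.matchEdge`, `Inv.attach`). The groups are
  the clusters of later batches; as `b ^ g` is large, their diameters are again negligible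
  (`Inv.advance`). Each group has at least two members, so that no more than `2 * g * n` clusters
  occur in the whole run (`Inv.fresh_le`); in particular the number of scales is irrelevant.

* *The batch is spanned.* Since its edges have nearly equal weights, an unweighted `(2 * k - 1)`-
  spanner of the graph on the clusters is needed. Balls are grown from one cluster after the other.
  A ball grows by the next layer as long as that multiplies its size by more than `τ`; because
  `τ ^ k` exceeds the number of all clusters, its radius stays below `k` (`Inv.depth_lt`). Then the
  ball is discarded, after at most `τ` edges for each of its clusters have been kept
  (`Inv.absorb`), and each edge with an end in the ball is spanned by a path through its root
  (`Inv.scan`).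

Altogether at most `2 * g * n * (1 + τ)` edges are kept (`Inv.result`), where `τ` is about
`(2 * g * n) ^ (1 / k)`. So the factor `log k` that is allowed for the size is not even used.

Every half-edge is taken up a constant number of times. What makes the running time linear is that
the collections of half-edges that have to be sorted, joined or relabelled are kept in single real
cells: the set `S` is stored as the number `∑ q ∈ S, exp (-l * q)` with large `l`. The union of
disjoint sets is then an addition, the least element is found by a logarithm and by rounding
(`encode_lead`), and replacing a cluster by its group in all half-edges still to be collected, which
are the digits of one real number, is a single multiplication (`encode_replace`). Only digits and
positions are ever converted to integers, and these are polynomial in the magnitude of the input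
(`fits_magnitude`).

The algorithm is treated as an abstract transition system with the invariant `Inv`; `Rep` says that
a memory state represents a state of this system, and the weakest precondition calculus `Wp` shows
that the pieces of the program carry out the transitions (`wp_round`).
-/

namespace SpannerAlgorithm

open RealRAM

/-! ### Half-edges and short paths -/

/-- Edge `i` is split into the half-edges `2 * i` and `2 * i + 1`; `opp` exchanges the two halves
of an edge. -/
def opp (h : ℕ) : ℕ := 4 * (h / 2) + 1 - h

theorem opp_div_two (h : ℕ) : opp h / 2 = h / 2 := by unfold opp; omega

theorem opp_opp (h : ℕ) : opp (opp h) = h := by unfold opp; omega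

theorem opp_two_mul (i : ℕ) : opp (2 * i) = 2 * i + 1 := by unfold opp; omega

theorem opp_two_mul_add_one (i : ℕ) : opp (2 * i + 1) = 2 * i := by unfold opp; omega

theorem eq_of_div_two_eq {p i : ℕ} (h : p / 2 = i) : p = 2 * i ∨ p = 2 * i + 1 := by omega

/-- `Near ep w O u v r`: the vertices `u` and `v` are joined by a path of total weight at most `r`
that uses edges of `O` only. The half-edge `h` starts at the vertex `ep h`, and `w i` is the weight
of the edge `i`. -/
inductive Near (ep : ℕ → ℕ) (w : ℕ → ℝ) (O : Finset ℕ) : ℕ → ℕ → ℝ → Prop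
  | refl (u : ℕ) {r : ℝ} (hr : 0 ≤ r) : Near ep w O u u r
  | step (h : ℕ) {v : ℕ} {r r' : ℝ} (hO : h / 2 ∈ O) (hn : Near ep w O (ep (opp h)) v r)
      (hr : w (h / 2) + r ≤ r') : Near ep w O (ep h) v r'

namespace Near

variable {ep : ℕ → ℕ} {w : ℕ → ℝ} {O O' : Finset ℕ} {u v x : ℕ} {r r' : ℝ}

theorem mono (h : Near ep w O u v r) (hO : O ⊆ O') (hr : r ≤ r') : Near ep w O' u v r' := by
  induction h generalizing r' with
  | refl u h0 => exact .refl u (h0.trans hr)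
  | step h hm _ hs ih => exact .step h (hO hm) (ih le_rfl) (hs.trans hr)

theorem trans (h : Near ep w O u v r) (h' : Near ep w O v x r') :
    Near ep w O u x (r + r') := by
  induction h with
  | refl u h0 => exact h'.mono subset_rfl (by linarith)
  | step h hm _ hs ih => exact .step h hm (ih h') (by linarith)

theorem edge {h : ℕ} (hO : h / 2 ∈ O) : Near ep w O (ep h) (ep (opp h)) (w (h / 2)) :=
  .step h hO (.refl _ le_rfl) (by simp)

theorem symm (h : Near ep w O u v r) : Near ep w O v u r := by
  induction h with
  | refl u h0 => exact .refl u h0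
  | step h hm _ hs ih =>
    have := ih.trans (edge (ep := ep) (w := w) (O := O) (h := opp h) (by rwa [opp_div_two]))
    rw [opp_opp, opp_div_two] at this
    exact this.mono subset_rfl (by linarith)

end Near

/-! ### The clustering algorithm as an abstract transition system -/

/-- The data of a run that never change. `ep h` is the starting vertex of the half-edge `h`, and
`w i`, `sc i` are the weight and the scale of the edge `i`: the weight lies between
`b ^ sc i` and `b ^ (sc i + 1)`. Scales that are congruent modulo `g` are treated as one sequence
of weights increasing by factors of at least `b ^ g`. Clusters have diameter at most `δ * b ^ j`
when scale `j` is reached, balls grow by the factor `τ` per layer, and `(2 * k - 1) * σ` is the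
stretch. -/
structure Setup where
  (n m k g : ℕ)
  ep : ℕ → ℕ
  w : ℕ → ℝ
  sc : ℕ → ℤ
  (b δ τ σ : ℝ)
  one_le_k : 1 ≤ k
  one_le_b : 1 ≤ b
  δ_pos : 0 < δ
  δ_le_one : δ ≤ 1
  le_σ : b + 3 * δ ≤ σ
  le_w : ∀ i < m, b ^ sc i ≤ w i
  w_le : ∀ i < m, w i ≤ b * b ^ sc i
  separated : 4 * δ + 4 * b ≤ δ * b ^ g
  one_le_τ : 1 ≤ τ
  lt_τ_pow : (2 * g * n : ℝ) < τ ^ k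

/-- A state of the algorithm. A batch consists of the edges of one scale. -/
structure St where
  /-- edges not yet collected -/
  todo : Finset ℕ
  /-- half-edges of the collected edges that join two distinct clusters -/
  arcs : Finset ℕ
  /-- half-edges of the batch whose cluster has not yet been tried as the root of a ball -/
  roots : Finset ℕ
  /-- half-edges leaving the current ball that have not been scanned -/
  front : Finset ℕ
  /-- half-edges that have been scanned -/
  scanned : Finset ℕ
  /-- clusters that are settled: they lie in some ball, and have been merged into a group -/
  removed : Finset ℕ
  /-- clusters that have been assigned to a group -/
  grouped : Finset ℕ
  /-- clusters covered by the greedy matching -/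
  matched : Finset ℕ
  /-- the current ball -/
  ball : Finset ℕ
  /-- the clusters found so far in the layer around the current ball -/
  shell : Finset ℕ
  /-- the edges of the spanner -/
  out : Finset ℕ
  /-- the cluster, at the beginning of the batch, of the starting vertex of a half-edge -/
  label : ℕ → ℕ
  /-- the group of a cluster (`0` if there is none): it becomes a cluster of later batches -/
  group : ℕ → ℕ
  /-- a vertex from which all vertices of the group are near -/
  centre : ℕ → ℕ
  /-- the scale of the batch -/
  scale : ℤ
  /-- a number above all the clusters of the batch -/
  base : ℕ
  /-- the next unused number of a cluster -/
  fresh : ℕ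
  /-- the radius of the current ball -/
  depth : ℕ
  /-- a vertex of the cluster at the root of the current ball -/
  root : ℕ

variable {D : Setup} {s : St}

/-- The stretch of the edge `i` in the graph of the edges in `O` is as small as required. -/
def Spanned (D : Setup) (O : Finset ℕ) (i : ℕ) : Prop :=
  Near D.ep D.w O (D.ep (2 * i)) (D.ep (2 * i + 1)) ((2 * D.k - 1) * D.σ * D.w i)

/-- The half-edges that still matter: those of the batch and those of edges to come. -/
def Live (D : Setup) (s : St) (p : ℕ) : Prop :=
  p / 2 ∈ s.todo ∨ (p ∈ s.arcs ∧ D.sc (p / 2) = s.scale)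

/-- The invariant of the algorithm. -/
structure Inv (D : Setup) (s : St) : Prop where
  todo_lt : ∀ i ∈ s.todo, i < D.m
  arcs_lt : ∀ h ∈ s.arcs, h / 2 < D.m ∧ h / 2 ∉ s.todo
  arcs_opp : ∀ h ∈ s.arcs, opp h ∈ s.arcs ∧ s.label h ≠ s.label (opp h)
  out_lt : ∀ i ∈ s.out, i < D.m
  roots_sub : s.roots ⊆ s.arcs
  le_sc : ∀ i ∈ s.todo, s.scale ≤ D.sc i
  sc_le : ∀ h ∈ s.arcs, D.sc (h / 2) ≤ s.scale
  label_mem : ∀ p, (p / 2 ∈ s.todo ∨ p ∈ s.arcs) → 1 ≤ s.label p ∧ s.label p < s.base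
  base_le : s.base ≤ s.fresh
  grouped_mem : ∀ x ∈ s.grouped, 1 ≤ x ∧ x < s.base
  matched_sub : s.matched ⊆ s.grouped
  removed_sub : s.removed ⊆ s.grouped
  group_iff : ∀ x, s.group x ≠ 0 ↔ x ∈ s.grouped
  group_mem : ∀ p, Live D s p → s.label p ∈ s.grouped →
    s.base ≤ s.group (s.label p) ∧ s.group (s.label p) < s.fresh
  group_active : ∀ x ∈ s.grouped, x ∈ s.removed ∨
    ∃ h, Live D s h ∧ D.sc (h / 2) = s.scale ∧ s.label h = x ∧ s.label (opp h) ≠ x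
  card_matched : s.matched.card + 2 * (D.g * D.n + 1) = 2 * s.fresh
  maximal : ∀ h ∈ s.arcs, s.label h ∈ s.matched ∨ s.label (opp h) ∈ s.matched
  near_label : ∀ p q, Live D s p → Live D s q → s.label p = s.label q →
    D.sc (p / 2) ≡ D.sc (q / 2) [ZMOD D.g] ∧
      Near D.ep D.w s.out (D.ep p) (D.ep q) (D.δ * D.b ^ min (D.sc (p / 2)) (D.sc (q / 2)))
  near_centre : ∀ p, Live D s p → s.label p ∈ s.grouped →
    D.sc (p / 2) ≡ s.scale [ZMOD D.g] ∧
      Near D.ep D.w s.out (D.ep p) (s.centre (s.group (s.label p)))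
        ((if s.label p ∈ s.matched then D.δ + D.b else 2 * D.δ + 2 * D.b) * D.b ^ s.scale)
  pending : ∀ h ∈ s.arcs, s.label h ∉ s.removed →
    D.sc (h / 2) = s.scale ∧ (h ∈ s.roots ∨ s.label h ∈ s.ball)
  ball_pending : ∀ h ∈ s.arcs, s.label h ∈ s.ball → s.label h ∉ s.removed → h ∈ s.front
  ball_label : ∀ x ∈ s.ball ∪ s.shell, ∃ h ∈ s.arcs, s.label h = x
  front_mem : ∀ h ∈ s.front, h ∈ s.arcs ∧ s.label h ∈ s.ball ∧ D.sc (h / 2) = s.scale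
  shell_mem : ∀ x ∈ s.shell, x ∉ s.removed ∧ x ∉ s.ball
  ball_nonempty : s.shell.Nonempty → s.ball.Nonempty
  scanned_mem : ∀ h ∈ s.scanned,
    h ∈ s.arcs ∧ h ∉ s.front ∧ s.label h ∈ s.removed ∧ Spanned D s.out (h / 2)
  removed_scanned : ∀ h ∈ s.arcs, s.label h ∈ s.removed → h ∈ s.front ∨ h ∈ s.scanned
  collecting : ∀ i ∈ s.todo, D.sc i = s.scale → s.ball = ∅ ∧ s.shell = ∅ ∧
    ∀ p, Live D s p → s.label p ∉ s.removed ∧ (s.label p ∈ s.grouped → s.label p ∈ s.matched)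
  near_ball : ∀ p, Live D s p → s.label p ∈ s.ball →
    Near D.ep D.w s.out (D.ep p) s.root ((s.depth * D.b + (s.depth + 1) * D.δ) * D.b ^ s.scale)
  near_shell : ∀ p, Live D s p → s.label p ∈ s.shell →
    Near D.ep D.w s.out (D.ep p) s.root
      (((s.depth + 1) * D.b + (s.depth + 2) * D.δ) * D.b ^ s.scale)
  card_ball : s.ball.Nonempty → D.τ ^ s.depth ≤ s.ball.card
  cover : ∀ i < D.m, i ∉ s.todo → Spanned D s.out i ∨ 2 * i ∈ s.arcs
  card_out : (s.out.card : ℝ) ≤ s.grouped.card + D.τ * (s.removed \ s.ball).card + s.ball.card +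
    s.shell.card

namespace Inv

theorem b_pos (D : Setup) : 0 < D.b := zero_lt_one.trans_le D.one_le_b

theorem live_arcs (hI : Inv D s) {h : ℕ} (hh : h ∈ s.front) : Live D s h ∧ Live D s (opp h) := by
  obtain ⟨h1, _, h3⟩ := hI.front_mem h hh
  exact ⟨.inr ⟨h1, h3⟩, .inr ⟨(hI.arcs_opp h h1).1, by rwa [opp_div_two]⟩⟩

/-- While a ball is being grown, the whole batch has been collected. -/
theorem lt_sc_of_ball (hI : Inv D s) {x : ℕ} (hx : x ∈ s.ball ∪ s.shell) :
    ∀ i ∈ s.todo, s.scale < D.sc i := by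
  intro i hi
  refine lt_of_le_of_ne (hI.le_sc i hi) fun h => ?_
  obtain ⟨h1, h2, _⟩ := hI.collecting i hi h.symm
  simp [h1, h2] at hx

theorem fresh_le (hI : Inv D s) (hf : 1 ≤ s.fresh) : s.fresh ≤ 2 * D.g * D.n + 1 := by
  have h1 : s.matched ⊆ Finset.Ico 1 s.fresh := fun x hx => by
    have := hI.grouped_mem x (hI.matched_sub hx)
    have := hI.base_le
    simp; omega
  have h2 := Finset.card_le_card h1
  have h3 := hI.card_matched
  rw [Nat.card_Ico] at h2
  have : 2 * D.g * D.n = 2 * (D.g * D.n) := by ring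
  omega

/-- A discarded ball is paid for by the settled clusters in it. -/
theorem absorb (hI : Inv D s) (hf : s.front = ∅)
    (hc : (s.ball.card + s.shell.card : ℝ) ≤ D.τ * s.ball.card) :
    Inv D { s with ball := ∅, shell := ∅ } := by
  have hball : s.ball ⊆ s.removed := by
    intro x hx
    by_contra hr
    obtain ⟨h, hh, rfl⟩ := hI.ball_label x (Finset.mem_union_left _ hx)
    simpa [hf] using hI.ball_pending h hh hx hr
  refine { hI with
    pending := ?_, ball_pending := ?_, ball_label := ?_, front_mem := ?_, shell_mem := ?_
    ball_nonempty := ?_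
    collecting := ?_, near_ball := ?_, near_shell := ?_, card_ball := ?_, card_out := ?_ }
  · intro h hh hr
    obtain ⟨h1, h2 | h2⟩ := hI.pending h hh hr
    · exact ⟨h1, .inl h2⟩
    · exact absurd (hball h2) hr
  · simp
  · simp
  · simp [hf]
  · simp
  · simp
  · intro i hi hs
    exact ⟨rfl, rfl, (hI.collecting i hi hs).2.2⟩
  · simp
  · simp
  · simp
  · have h1 := hI.card_out
    have h2 : ((s.removed \ s.ball).card : ℝ) + s.ball.card = s.removed.card := by
      exact_mod_cast Finset.card_sdiff_add_card_eq_card hball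
    simp only [Finset.sdiff_empty, Finset.card_empty, Nat.cast_zero, add_zero]
    rw [← h2, mul_add]
    linarith

theorem popRoot (hI : Inv D s) {h : ℕ} (hr : s.label h ∈ s.removed) :
    Inv D { s with roots := s.roots.erase h } := by
  refine { hI with roots_sub := (Finset.erase_subset _ _).trans hI.roots_sub, pending := ?_ }
  intro p hp hpr
  obtain ⟨h1, h2 | h2⟩ := hI.pending p hp hpr
  · refine ⟨h1, .inl (Finset.mem_erase.2 ⟨?_, h2⟩)⟩
    rintro rfl
    exact hpr hr
  · exact ⟨h1, .inr h2⟩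

theorem start (hI : Inv D s) {h : ℕ} (hh : h ∈ s.roots) (hr : s.label h ∉ s.removed)
    (hb : s.ball = ∅) (hs : s.shell = ∅) (hsc : ∀ i ∈ s.todo, s.scale < D.sc i) :
    Inv D { s with
      roots := s.roots.erase h, ball := {s.label h}, depth := 0, root := D.ep h
      front := s.arcs.filter fun p => s.label p = s.label h } := by
  have hha := hI.roots_sub hh
  have hhs := (hI.pending h hha hr).1
  have hlive : Live D s h := .inr ⟨hha, hhs⟩
  refine { hI with
    roots_sub := (Finset.erase_subset _ _).trans hI.roots_sub
    pending := ?_, ball_pending := ?_, ball_label := ?_, front_mem := ?_, shell_mem := ?_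
    ball_nonempty := ?_
    scanned_mem := ?_, removed_scanned := ?_
    collecting := ?_, near_ball := ?_, near_shell := ?_, card_ball := ?_, card_out := ?_ }
  · intro p hp hpr
    obtain ⟨h1, h2 | h2⟩ := hI.pending p hp hpr
    · refine ⟨h1, ?_⟩
      by_cases hph : p = h
      · right; simp [hph]
      · left; exact Finset.mem_erase.2 ⟨hph, h2⟩
    · simp [hb] at h2
  · intro p hp hpb _
    simpa [hp] using hpb
  · intro x hx
    simp only [hs, Finset.union_empty, Finset.mem_singleton] at hx
    exact ⟨h, hha, hx.symm⟩
  · intro p hp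
    obtain ⟨h1, h2⟩ := Finset.mem_filter.1 hp
    exact ⟨h1, by simp [h2], (hI.pending p h1 (by rwa [h2])).1⟩
  · simp [hs]
  · simp [hs]
  · intro p hp
    obtain ⟨h1, h2, h3, h4⟩ := hI.scanned_mem p hp
    refine ⟨h1, fun h5 => ?_, h3, h4⟩
    exact hr ((Finset.mem_filter.1 h5).2 ▸ h3)
  · intro p hp hpr
    obtain h1 | h1 := hI.removed_scanned p hp hpr
    · have := (hI.front_mem p h1).2.1
      simp [hb] at this
    · exact .inr h1
  · intro i hi hs
    exact absurd hs (hsc i hi).ne'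
  · intro p hp hpl
    have := (hI.near_label p h hp hlive (by simpa using hpl)).2
    refine this.mono subset_rfl ?_
    have h1 : s.scale ≤ D.sc (p / 2) := by
      rcases hp with hp | hp
      · exact hI.le_sc _ hp
      · exact hp.2.ge
    rw [hhs, min_eq_right h1]
    simp
  · simp [hs]
  · simp
  · have h1 := hI.card_out
    simp only [hb, hs, Finset.sdiff_empty, Finset.card_empty, Nat.cast_zero, add_zero] at h1
    have : s.removed \ {s.label h} = s.removed := by simpa using hr
    simp only [hs, this, Finset.card_singleton, Finset.card_empty]
    push_cast
    linarith

/-- The ball grows by the layer around it, which is large compared to it. -/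
theorem expand (hI : Inv D s) (hf : s.front = ∅)
    (hc : D.τ * s.ball.card < s.ball.card + s.shell.card) :
    Inv D { s with
      ball := s.ball ∪ s.shell, shell := ∅, depth := s.depth + 1
      front := s.arcs.filter fun p => s.label p ∈ s.shell } := by
  have hdisj : Disjoint s.ball s.shell :=
    Finset.disjoint_right.2 fun x hx => (hI.shell_mem x hx).2
  have hcard : ((s.ball ∪ s.shell).card : ℝ) = s.ball.card + s.shell.card := by
    exact_mod_cast Finset.card_union_of_disjoint hdisj
  have hne : s.shell.Nonempty := by
    rw [Finset.nonempty_iff_ne_empty]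
    intro h0
    rw [h0] at hc
    have : (0 : ℝ) ≤ s.ball.card := by positivity
    simp only [Finset.card_empty, Nat.cast_zero, add_zero] at hc
    nlinarith [D.one_le_τ]
  obtain ⟨x, hx⟩ := hne
  have hsc := hI.lt_sc_of_ball (Finset.mem_union_right _ hx)
  have hbp := zpow_pos (b_pos D) s.scale
  refine { hI with
    pending := ?_, ball_pending := ?_, ball_label := ?_, front_mem := ?_, shell_mem := ?_
    ball_nonempty := ?_
    scanned_mem := ?_, removed_scanned := ?_
    collecting := ?_, near_ball := ?_, near_shell := ?_, card_ball := ?_, card_out := ?_ }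
  · intro p hp hpr
    obtain ⟨h1, h2 | h2⟩ := hI.pending p hp hpr
    · exact ⟨h1, .inl h2⟩
    · exact ⟨h1, .inr (Finset.mem_union_left _ h2)⟩
  · intro p hp hpb hpr
    rcases Finset.mem_union.1 hpb with h | h
    · simpa [hf] using hI.ball_pending p hp h hpr
    · exact Finset.mem_filter.2 ⟨hp, h⟩
  · simpa using hI.ball_label
  · intro p hp
    obtain ⟨h1, h2⟩ := Finset.mem_filter.1 hp
    exact ⟨h1, Finset.mem_union_right _ h2, (hI.pending p h1 (hI.shell_mem _ h2).1).1⟩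
  · simp
  · simp
  · intro p hp
    obtain ⟨h1, h2, h3, h4⟩ := hI.scanned_mem p hp
    exact ⟨h1, fun h5 => (hI.shell_mem _ (Finset.mem_filter.1 h5).2).1 h3, h3, h4⟩
  · intro p hp hpr
    obtain h1 | h1 := hI.removed_scanned p hp hpr
    · simp [hf] at h1
    · exact .inr h1
  · intro i hi hs
    exact absurd hs (hsc i hi).ne'
  · intro p hp hpl
    push_cast
    rcases Finset.mem_union.1 hpl with h | h
    · refine (hI.near_ball p hp h).mono subset_rfl ?_
      gcongr ?_ * _
      nlinarith [D.one_le_b, D.δ_pos]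
    · refine (hI.near_shell p hp h).mono subset_rfl (le_of_eq ?_)
      ring
  · simp
  · intro _
    simp only [hcard, pow_succ]
    have := hI.card_ball (hI.ball_nonempty ⟨x, hx⟩)
    nlinarith [D.one_le_τ]
  · have h1 := hI.card_out
    have : s.removed \ (s.ball ∪ s.shell) = s.removed \ s.ball := by
      ext y
      simp only [Finset.mem_sdiff, Finset.mem_union]
      have := hI.shell_mem y
      tauto
    simp only [this, hcard, Finset.card_empty, Nat.cast_zero, add_zero]
    linarith

/-- The cluster of the starting vertex of a half-edge after the settled clusters have been
replaced by their groups. -/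
def _root_.SpannerAlgorithm.St.relabel (s : St) (p : ℕ) : ℕ :=
  if s.label p ∈ s.removed then s.group (s.label p) else s.label p

/-- The state at the beginning of the batch of scale `j`. -/
def _root_.SpannerAlgorithm.St.advance (s : St) (j : ℤ) : St :=
  { s with
    label := fun p => if p / 2 ∈ s.todo then s.relabel p else s.label p
    scale := j
    base := s.fresh }

theorem advance (hI : Inv D s) (hf : s.front = ∅) (hr : s.roots = ∅) (hb : s.ball = ∅)
    (hs : s.shell = ∅) {j : ℤ} (hj : s.scale < j) (hle : ∀ i ∈ s.todo, j ≤ D.sc i) :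
    Inv D (s.advance j) := by
  have hbase := hI.base_le
  have hlab : ∀ h ∈ s.arcs, (s.advance j).label h = s.label h := fun h hh =>
    if_neg (hI.arcs_lt h hh).2
  have hlive : ∀ p, Live D (s.advance j) p → p / 2 ∈ s.todo := by
    rintro p (hp | ⟨hp, hp'⟩)
    · exact hp
    · have := hI.sc_le p hp
      simp only [St.advance] at hp'
      omega
  have hlab' : ∀ p, p / 2 ∈ s.todo → (s.advance j).label p = s.relabel p := fun p hp => if_pos hp
  have hrem : ∀ h ∈ s.arcs, s.label h ∈ s.removed := by
    intro h hh
    by_contra hn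
    obtain ⟨_, h2⟩ := hI.pending h hh hn
    simp [hr, hb] at h2
  have hgr : ∀ x ∈ s.grouped, x ∈ s.removed := by
    intro x hx
    rcases hI.group_active x hx with h | ⟨h, h1 | h1, h2, rfl, -⟩
    · exact h
    · have := hle _ h1
      omega
    · exact hrem h h1.1
  have hnew : ∀ p, p / 2 ∈ s.todo → s.relabel p ∉ s.grouped ∧ 1 ≤ s.relabel p ∧
      s.relabel p < s.fresh := by
    intro p hp
    have h1 := hI.label_mem p (.inl hp)
    unfold St.relabel
    split_ifs with h
    · have h2 := hI.group_mem p (.inl hp) (hI.removed_sub h)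
      refine ⟨fun h3 => ?_, by omega, by omega⟩
      have := hI.grouped_mem _ h3
      omega
    · exact ⟨fun h3 => h (hgr _ h3), by omega, by omega⟩
  refine { hI with
    arcs_opp := ?_, le_sc := hle, sc_le := ?_, label_mem := ?_, base_le := le_rfl
    grouped_mem := ?_, group_mem := ?_, group_active := ?_, maximal := ?_, near_label := ?_
    near_centre := ?_, pending := ?_, ball_pending := ?_, ball_label := ?_, front_mem := ?_
    scanned_mem := ?_, removed_scanned := ?_, collecting := ?_, near_ball := ?_, near_shell := ?_ }
  · intro h hh
    have := hI.arcs_opp h hh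
    refine ⟨this.1, ?_⟩
    rw [hlab h hh, hlab _ this.1]
    exact this.2
  · intro h hh
    exact (hI.sc_le h hh).trans hj.le
  · rintro p (hp | hp)
    · rw [hlab' p hp]
      exact (hnew p hp).2
    · rw [hlab p hp]
      exact ⟨(hI.label_mem p (.inr hp)).1, (hI.label_mem p (.inr hp)).2.trans_le hbase⟩
  · intro x hx
    have := hI.grouped_mem x hx
    exact ⟨this.1, this.2.trans_le hbase⟩
  · intro p hp hg
    have := hlive p hp
    rw [hlab' p this] at hg
    exact absurd hg (hnew p this).1
  · intro x hx
    exact .inl (hgr x hx)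
  · intro h hh
    rw [hlab h hh, hlab _ (hI.arcs_opp h hh).1]
    exact hI.maximal h hh
  · intro p q hp hq hpq
    replace hp := hlive p hp
    replace hq := hlive q hq
    rw [hlab' p hp, hlab' q hq] at hpq
    by_cases hpr : s.label p ∈ s.removed
    · have hpg := hI.group_mem p (.inl hp) (hI.removed_sub hpr)
      by_cases hqr : s.label q ∈ s.removed
      · simp only [St.relabel, hpr, hqr, if_true] at hpq
        obtain ⟨hp1, hp2⟩ := hI.near_centre p (.inl hp) (hI.removed_sub hpr)
        obtain ⟨hq1, hq2⟩ := hI.near_centre q (.inl hq) (hI.removed_sub hqr)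
        refine ⟨hp1.trans hq1.symm, ?_⟩
        rw [hpq] at hp2
        refine (hp2.trans hq2.symm).mono subset_rfl ?_
        have hpow : ∀ r, r / 2 ∈ s.todo → D.sc (r / 2) ≡ s.scale [ZMOD D.g] →
            s.scale + D.g ≤ D.sc (r / 2) := by
          intro r hr hc
          have h1 := hle _ hr
          have h2 : (D.g : ℤ) ∣ D.sc (r / 2) - s.scale := hc.symm.dvd
          have := Int.le_of_dvd (by omega) h2
          omega
        have h1 : D.b ^ (s.scale + D.g) ≤ D.b ^ min (D.sc (p / 2)) (D.sc (q / 2)) :=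
          zpow_le_zpow_right₀ D.one_le_b (le_min (hpow p hp hp1) (hpow q hq hq1))
        rw [zpow_add₀ (b_pos D).ne', zpow_natCast] at h1
        have h2 := zpow_pos (b_pos D) s.scale
        have h3 := D.separated
        have h4 := D.δ_pos
        have h5 := D.one_le_b
        have h6 : ∀ c : Prop, [Decidable c] →
            (if c then D.δ + D.b else 2 * D.δ + 2 * D.b) ≤ 2 * D.δ + 2 * D.b := by
          intro c _
          split_ifs <;> linarith
        calc _ ≤ (2 * D.δ + 2 * D.b) * D.b ^ s.scale + (2 * D.δ + 2 * D.b) * D.b ^ s.scale := by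
              gcongr <;> exact h6 _
          _ ≤ (D.δ * D.b ^ D.g) * D.b ^ s.scale := by
              rw [← add_mul]; gcongr; linarith
          _ = D.δ * (D.b ^ s.scale * D.b ^ D.g) := by ring
          _ ≤ _ := by gcongr
      · simp only [St.relabel, hpr, hqr, if_true, if_false] at hpq
        have := hI.label_mem q (.inl hq)
        omega
    · by_cases hqr : s.label q ∈ s.removed
      · have hqg := hI.group_mem q (.inl hq) (hI.removed_sub hqr)
        simp only [St.relabel, hpr, hqr, if_true, if_false] at hpq
        have := hI.label_mem p (.inl hp)
        omega
      · simp only [St.relabel, hpr, hqr, if_false] at hpq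
        exact hI.near_label p q (.inl hp) (.inl hq) hpq
  · intro p hp hg
    have := hlive p hp
    rw [hlab' p this] at hg
    exact absurd hg (hnew p this).1
  · intro h hh hn
    rw [hlab h hh] at hn
    exact absurd (hrem h hh) hn
  · intro h hh hn
    simp [St.advance, hb] at hn
  · intro x hx
    simp [St.advance, hb, hs] at hx
  · intro x hx
    simp [St.advance, hf] at hx
  · intro h hh
    obtain ⟨h1, h2, h3, h4⟩ := hI.scanned_mem h hh
    exact ⟨h1, h2, by rwa [hlab h h1], h4⟩
  · intro h hh hn
    rw [hlab h hh] at hn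
    exact hI.removed_scanned h hh hn
  · intro i hi _
    refine ⟨hb, hs, fun p hp => ?_⟩
    have := hlive p hp
    rw [hlab' p this]
    exact ⟨fun h => (hnew p this).1 (hI.removed_sub h), fun h => absurd h (hnew p this).1⟩
  · intro p _ hn
    simp [St.advance, hb] at hn
  · intro p _ hn
    simp [St.advance, hs] at hn

/-- An edge within a cluster needs no further edges. -/
theorem collectLoop (hI : Inv D s) {i : ℕ} (hi : i ∈ s.todo) (hsc : D.sc i = s.scale)
    (hl : s.label (2 * i) = s.label (2 * i + 1)) : Inv D { s with todo := s.todo.erase i } := by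
  have hlive : ∀ p, Live D { s with todo := s.todo.erase i } p → Live D s p := by
    rintro p (hp | hp)
    · exact .inl (Finset.mem_of_mem_erase hp)
    · exact .inr hp
  refine { hI with
    todo_lt := fun i hi => hI.todo_lt i (Finset.mem_of_mem_erase hi)
    arcs_lt := fun h hh => ⟨(hI.arcs_lt h hh).1,
      fun h' => (hI.arcs_lt h hh).2 (Finset.mem_of_mem_erase h')⟩
    le_sc := fun i hi => hI.le_sc i (Finset.mem_of_mem_erase hi)
    label_mem := fun p hp => hI.label_mem p (hp.imp_left Finset.mem_of_mem_erase)
    group_mem := fun p hp => hI.group_mem p (hlive p hp)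
    group_active := ?_
    near_label := fun p q hp hq => hI.near_label p q (hlive p hp) (hlive q hq)
    near_centre := fun p hp => hI.near_centre p (hlive p hp)
    near_ball := fun p hp => hI.near_ball p (hlive p hp)
    near_shell := fun p hp => hI.near_shell p (hlive p hp)
    collecting := ?_, cover := ?_ }
  · intro x hx
    rcases hI.group_active x hx with h | ⟨h, h1, h2, h3, h4⟩
    · exact .inl h
    · refine .inr ⟨h, ?_, h2, h3, h4⟩
      rcases h1 with h1 | h1
      · left
        refine Finset.mem_erase.2 ⟨?_, h1⟩
        intro h5
        rcases eq_of_div_two_eq h5 with rfl | rfl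
        · rw [opp_two_mul] at h4
          exact h4 (hl ▸ h3)
        · rw [opp_two_mul_add_one] at h4
          exact h4 (hl ▸ h3)
      · exact .inr h1
  · intro i' hi' hs
    obtain ⟨h1, h2, h3⟩ := hI.collecting i' (Finset.mem_of_mem_erase hi') hs
    exact ⟨h1, h2, fun p hp => h3 p (hlive p hp)⟩
  · intro i' hm hi'
    by_cases hii : i' = i
    · subst hii
      left
      have h0 : 2 * i' / 2 = i' := by omega
      have h1 : (2 * i' + 1) / 2 = i' := by omega
      have := (hI.near_label (2 * i') (2 * i' + 1) (.inl (by rwa [h0])) (.inl (by rwa [h1])) hl).2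
      rw [h0, h1, min_self] at this
      refine this.mono subset_rfl ?_
      have hk : (1 : ℝ) ≤ D.k := by exact_mod_cast D.one_le_k
      have hw := D.le_w i' hm
      have hp := zpow_pos (b_pos D) (D.sc i')
      have hσ : 1 ≤ D.σ := by linarith [D.le_σ, D.δ_pos, D.one_le_b]
      calc D.δ * D.b ^ D.sc i' ≤ 1 * D.b ^ D.sc i' := by gcongr; exact D.δ_le_one
        _ ≤ 1 * D.w i' := by linarith
        _ ≤ _ := by
          gcongr
          · linarith
          · nlinarith
    · exact hI.cover i' hm fun h => hi' (Finset.mem_erase.2 ⟨hii, h⟩)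

/-- Two clusters that are joined by an edge of the batch and are not yet grouped form a new
group. -/
theorem matchEdge (hI : Inv D s) {i : ℕ} (hi : i ∈ s.todo) (hsc : D.sc i = s.scale)
    (hl : s.label (2 * i) ≠ s.label (2 * i + 1)) (ha : s.label (2 * i) ∉ s.grouped)
    (hb : s.label (2 * i + 1) ∉ s.grouped) :
    Inv D { s with
      grouped := insert (s.label (2 * i)) (insert (s.label (2 * i + 1)) s.grouped)
      matched := insert (s.label (2 * i)) (insert (s.label (2 * i + 1)) s.matched)
      group := Function.update (Function.update s.group (s.label (2 * i)) s.fresh)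
        (s.label (2 * i + 1)) s.fresh
      centre := Function.update s.centre s.fresh (D.ep (2 * i))
      out := insert i s.out
      fresh := s.fresh + 1 } := by
  set a := s.label (2 * i) with ha'
  set b := s.label (2 * i + 1) with hb'
  have h0 : 2 * i / 2 = i := by omega
  have h1 : (2 * i + 1) / 2 = i := by omega
  have hla : Live D s (2 * i) := .inl (by rwa [h0])
  have hlb : Live D s (2 * i + 1) := .inl (by rwa [h1])
  have hma := hI.label_mem (2 * i) (.inl (by rwa [h0]))
  have hmb := hI.label_mem (2 * i + 1) (.inl (by rwa [h1]))
  have hbase := hI.base_le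
  have ham : a ∉ s.matched := fun h => ha (hI.matched_sub h)
  have hbm : b ∉ s.matched := fun h => hb (hI.matched_sub h)
  have hout : s.out ⊆ insert i s.out := Finset.subset_insert _ _
  obtain ⟨hball, hshell, hcoll⟩ := hI.collecting i hi hsc
  have hgrp : ∀ x, x ∉ ({a, b} : Finset ℕ) →
      (Function.update (Function.update s.group a s.fresh) b s.fresh) x = s.group x := by
    intro x hx
    simp only [Finset.mem_insert, Finset.mem_singleton, not_or] at hx
    rw [Function.update_of_ne hx.2, Function.update_of_ne hx.1]
  have hgrp' : ∀ x, x ∈ ({a, b} : Finset ℕ) →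
      (Function.update (Function.update s.group a s.fresh) b s.fresh) x = s.fresh := by
    intro x hx
    simp only [Finset.mem_insert, Finset.mem_singleton] at hx
    rcases hx with rfl | rfl
    · rw [Function.update_of_ne hl, Function.update_self]
    · rw [Function.update_self]
  have hmem : ∀ {x : ℕ} {S : Finset ℕ}, x ∈ insert a (insert b S) ↔
      x ∈ ({a, b} : Finset ℕ) ∨ x ∈ S := by
    intro x S; simp [or_assoc]
  refine { hI with
    out_lt := ?_, base_le := hbase.trans (Nat.le_succ _), grouped_mem := ?_, matched_sub := ?_
    removed_sub := ?_, group_iff := ?_, group_mem := ?_, group_active := ?_, card_matched := ?_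
    maximal := ?_, near_label := ?_, near_centre := ?_, scanned_mem := ?_, collecting := ?_
    near_ball := ?_, near_shell := ?_, cover := ?_, card_out := ?_ }
  · intro j hj
    rcases Finset.mem_insert.1 hj with rfl | hj
    · exact hI.todo_lt _ hi
    · exact hI.out_lt _ hj
  · intro x hx
    simp only [Finset.mem_insert] at hx
    rcases hx with rfl | rfl | hx
    exacts [hma, hmb, hI.grouped_mem x hx]
  · exact Finset.insert_subset_insert _ (Finset.insert_subset_insert _ hI.matched_sub)
  · exact hI.removed_sub.trans ((Finset.subset_insert _ _).trans (Finset.subset_insert _ _))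
  · intro x
    dsimp only
    rw [hmem]
    by_cases hx : x ∈ ({a, b} : Finset ℕ)
    · rw [hgrp' x hx]
      simp only [hx, true_or, iff_true]
      omega
    · rw [hgrp x hx, hI.group_iff]
      simp only [hx, false_or]
  · intro p hp hpg
    dsimp only at hpg ⊢
    by_cases hx : s.label p ∈ ({a, b} : Finset ℕ)
    · rw [hgrp' _ hx]
      omega
    · rw [hgrp _ hx]
      have := hI.group_mem p hp ((hmem.1 hpg).resolve_left hx)
      omega
  · intro x hx
    rcases hmem.1 hx with hx | hx
    · right
      simp only [Finset.mem_insert, Finset.mem_singleton] at hx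
      rcases hx with rfl | rfl
      · exact ⟨2 * i, hla, by rw [h0, hsc], rfl, by rw [opp_two_mul]; exact hl.symm⟩
      · exact ⟨2 * i + 1, hlb, by rw [h1, hsc], rfl, by rw [opp_two_mul_add_one]; exact hl⟩
    · exact hI.group_active x hx
  · have := hI.card_matched
    dsimp only
    rw [Finset.card_insert_of_notMem (by simp [hl, ham]), Finset.card_insert_of_notMem hbm]
    omega
  · intro h hh
    exact (hI.maximal h hh).imp (fun h => hmem.2 (.inr h)) (fun h => hmem.2 (.inr h))
  · intro p q hp hq hpq
    have := hI.near_label p q hp hq hpq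
    exact ⟨this.1, this.2.mono hout le_rfl⟩
  · intro p hp hpg
    have hps : s.scale ≤ D.sc (p / 2) := by
      rcases hp with hp | hp
      · exact hI.le_sc _ hp
      · exact hp.2.ge
    have hb1 := D.one_le_b
    dsimp only at hpg ⊢
    by_cases hx : s.label p ∈ ({a, b} : Finset ℕ)
    · rw [hgrp' _ hx, Function.update_self, if_pos (hmem.2 (.inl hx))]
      simp only [Finset.mem_insert, Finset.mem_singleton] at hx
      rcases hx with hx | hx
      · have := hI.near_label p (2 * i) hp hla hx
        rw [h0, hsc] at this
        refine ⟨this.1, this.2.mono hout ?_⟩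
        rw [min_eq_right hps]
        gcongr
        linarith
      · have := hI.near_label p (2 * i + 1) hp hlb hx
        rw [h1, hsc] at this
        refine ⟨this.1, ?_⟩
        have he := Near.edge (ep := D.ep) (w := D.w) (O := insert i s.out) (h := 2 * i + 1)
          (by simp [h1])
        rw [opp_two_mul_add_one, h1] at he
        refine ((this.2.mono hout le_rfl).trans he).mono subset_rfl ?_
        rw [min_eq_right hps, add_mul]
        have := D.w_le i (hI.todo_lt i hi)
        rw [hsc] at this
        gcongr
    · have hpg := (hmem.1 hpg).resolve_left hx
      have h3 := hI.group_mem p hp hpg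
      have h4 := hI.near_centre p hp hpg
      rw [hgrp _ hx, Function.update_of_ne (by omega)]
      refine ⟨h4.1, h4.2.mono hout (le_of_eq ?_)⟩
      simp only [hmem, hx, false_or]
  · intro h hh
    obtain ⟨h1, h2, h3, h4⟩ := hI.scanned_mem h hh
    exact ⟨h1, h2, h3, h4.mono hout le_rfl⟩
  · intro i' hi' hs
    refine ⟨hball, hshell, fun p hp => ⟨(hcoll p hp).1, fun hg => ?_⟩⟩
    rcases hmem.1 hg with h | h
    · exact hmem.2 (.inl h)
    · exact hmem.2 (.inr ((hcoll p hp).2 h))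
  · exact fun p hp hpb => (hI.near_ball p hp hpb).mono hout le_rfl
  · exact fun p hp hpb => (hI.near_shell p hp hpb).mono hout le_rfl
  · intro j hj hjt
    exact (hI.cover j hj hjt).imp_left fun h => h.mono hout le_rfl
  · have h3 := hI.card_out
    have h4 : ((insert i s.out).card : ℝ) ≤ s.out.card + 1 := by
      exact_mod_cast Finset.card_insert_le _ _
    have h5 : (insert a (insert b s.grouped)).card = s.grouped.card + 2 := by
      rw [Finset.card_insert_of_notMem (by simp [hl, ha]), Finset.card_insert_of_notMem hb]
    dsimp only
    rw [h5]
    push_cast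
    linarith

theorem collectEdge (hI : Inv D s) {i : ℕ} (hi : i ∈ s.todo) (hsc : D.sc i = s.scale)
    (hl : s.label (2 * i) ≠ s.label (2 * i + 1))
    (hm : s.label (2 * i) ∈ s.matched ∨ s.label (2 * i + 1) ∈ s.matched) :
    Inv D { s with
      todo := s.todo.erase i
      arcs := insert (2 * i) (insert (2 * i + 1) s.arcs)
      roots := insert (2 * i) (insert (2 * i + 1) s.roots) } := by
  have h0 : 2 * i / 2 = i := by omega
  have h1 : (2 * i + 1) / 2 = i := by omega
  obtain ⟨hball, hshell, hcoll⟩ := hI.collecting i hi hsc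
  have hmem : ∀ {x : ℕ} {S : Finset ℕ}, x ∈ insert (2 * i) (insert (2 * i + 1) S) ↔
      x / 2 = i ∨ x ∈ S := by
    intro x S
    simp only [Finset.mem_insert, ← or_assoc]
    refine or_congr_left ?_
    omega
  have hlive' : ∀ p, p / 2 = i → Live D s p := fun p hp => .inl (by rwa [hp])
  have hlive : ∀ p, Live D { s with
      todo := s.todo.erase i
      arcs := insert (2 * i) (insert (2 * i + 1) s.arcs)
      roots := insert (2 * i) (insert (2 * i + 1) s.roots) } p ↔ Live D s p := by
    intro p
    unfold Live
    dsimp only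
    rw [hmem, Finset.mem_erase]
    by_cases hp : p / 2 = i
    · simp [hp, hi, hsc]
    · simp [hp]
  have hlab : ∀ p, p / 2 = i → s.label p ≠ s.label (opp p) ∧
      (s.label p ∈ s.matched ∨ s.label (opp p) ∈ s.matched) := by
    intro p hp
    rcases eq_of_div_two_eq hp with rfl | rfl
    · rw [opp_two_mul]; exact ⟨hl, hm⟩
    · rw [opp_two_mul_add_one]; exact ⟨hl.symm, hm.symm⟩
  have hsub : s.arcs ⊆ insert (2 * i) (insert (2 * i + 1) s.arcs) :=
    (Finset.subset_insert _ _).trans (Finset.subset_insert _ _)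
  refine { hI with
    todo_lt := fun i hi => hI.todo_lt i (Finset.mem_of_mem_erase hi)
    arcs_lt := ?_, arcs_opp := ?_, roots_sub := ?_
    le_sc := fun i hi => hI.le_sc i (Finset.mem_of_mem_erase hi)
    sc_le := ?_, label_mem := ?_
    group_mem := fun p hp => hI.group_mem p ((hlive p).1 hp)
    group_active := ?_, maximal := ?_
    near_label := fun p q hp hq => hI.near_label p q ((hlive p).1 hp) ((hlive q).1 hq)
    near_centre := fun p hp => hI.near_centre p ((hlive p).1 hp)
    pending := ?_, ball_pending := ?_, ball_label := ?_, front_mem := ?_, scanned_mem := ?_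
    removed_scanned := ?_
    near_ball := fun p hp => hI.near_ball p ((hlive p).1 hp)
    near_shell := fun p hp => hI.near_shell p ((hlive p).1 hp)
    collecting := ?_, cover := ?_ }
  · intro h hh
    rcases hmem.1 hh with hh | hh
    · simp only [hh]
      exact ⟨hI.todo_lt i hi, by simp⟩
    · exact ⟨(hI.arcs_lt h hh).1, fun h' => (hI.arcs_lt h hh).2 (Finset.mem_of_mem_erase h')⟩
  · intro h hh
    rcases hmem.1 hh with hh | hh
    · exact ⟨hmem.2 (.inl (by rw [opp_div_two, hh])), (hlab h hh).1⟩
    · exact ⟨hmem.2 (.inr (hI.arcs_opp h hh).1), (hI.arcs_opp h hh).2⟩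
  · exact Finset.insert_subset_insert _ (Finset.insert_subset_insert _ hI.roots_sub)
  · intro h hh
    rcases hmem.1 hh with hh | hh
    · rw [hh, hsc]
    · exact hI.sc_le h hh
  · rintro p (hp | hp)
    · exact hI.label_mem p (.inl (Finset.mem_of_mem_erase hp))
    · rcases hmem.1 hp with hp | hp
      · exact hI.label_mem p (.inl (by rwa [hp]))
      · exact hI.label_mem p (.inr hp)
  · intro x hx
    rcases hI.group_active x hx with h | ⟨h, h1, h2⟩
    · exact .inl h
    · exact .inr ⟨h, (hlive h).2 h1, h2⟩
  · intro h hh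
    rcases hmem.1 hh with hh | hh
    · exact (hlab h hh).2
    · exact hI.maximal h hh
  · intro h hh hr
    rcases hmem.1 hh with hh | hh
    · exact ⟨by rw [hh, hsc], .inl (hmem.2 (.inl hh))⟩
    · obtain ⟨h3, h4⟩ := hI.pending h hh hr
      exact ⟨h3, h4.imp_left fun h5 => hmem.2 (.inr h5)⟩
  · intro h _ hh
    simp [hball] at hh
  · intro x hx
    simp [hball, hshell] at hx
  · intro h hh
    obtain ⟨h3, h4⟩ := hI.front_mem h hh
    exact ⟨hsub h3, h4⟩
  · intro h hh
    obtain ⟨h3, h4⟩ := hI.scanned_mem h hh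
    exact ⟨hsub h3, h4⟩
  · intro h hh hr
    rcases hmem.1 hh with hh | hh
    · exact absurd hr (hcoll h (hlive' h hh)).1
    · exact hI.removed_scanned h hh hr
  · intro i' hi' hs
    exact ⟨hball, hshell, fun p hp => hcoll p ((hlive p).1 hp)⟩
  · intro j hj hjt
    by_cases hji : j = i
    · subst hji
      exact .inr (hmem.2 (.inl h0))
    · exact (hI.cover j hj fun h => hjt (Finset.mem_erase.2 ⟨hji, h⟩)).imp_right fun h => hsub h

theorem pow_scale_le (hI : Inv D s) {p : ℕ} (hp : Live D s p) : s.scale ≤ D.sc (p / 2) := by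
  rcases hp with hp | hp
  · exact hI.le_sc _ hp
  · exact hp.2.ge

/-- The vertices of a cluster of the batch are close to each other. -/
theorem near_of_front (hI : Inv D s) {p q : ℕ} (hp : Live D s p) (hq : Live D s q)
    (hqs : D.sc (q / 2) = s.scale) (h : s.label p = s.label q) :
    D.sc (p / 2) ≡ s.scale [ZMOD D.g] ∧
      Near D.ep D.w s.out (D.ep p) (D.ep q) (D.δ * D.b ^ s.scale) := by
  have := hI.near_label p q hp hq h
  rwa [hqs, min_eq_right (hI.pow_scale_le hp)] at this

/-- A cluster that is not covered by the matching joins the group of a matched neighbour. -/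
theorem attach (hI : Inv D s) {h : ℕ} (hh : h ∈ s.front) (hx : s.label h ∉ s.grouped) :
    Inv D { s with
      grouped := insert (s.label h) s.grouped
      group := Function.update s.group (s.label h) (s.group (s.label (opp h)))
      out := insert (h / 2) s.out } := by
  obtain ⟨hha, hhb, hhs⟩ := hI.front_mem h hh
  obtain ⟨hl1, hl2⟩ := hI.live_arcs hh
  have hy : s.label (opp h) ∈ s.matched :=
    (hI.maximal h hha).resolve_left fun h => hx (hI.matched_sub h)
  have hyg := hI.matched_sub hy
  have hout : s.out ⊆ insert (h / 2) s.out := Finset.subset_insert _ _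
  have hsc := hI.lt_sc_of_ball (Finset.mem_union_left _ hhb)
  have hm := hI.label_mem h (.inr hha)
  refine { hI with
    out_lt := ?_, grouped_mem := ?_
    matched_sub := hI.matched_sub.trans (Finset.subset_insert _ _)
    removed_sub := hI.removed_sub.trans (Finset.subset_insert _ _)
    group_iff := ?_, group_mem := ?_, group_active := ?_
    near_label := ?_, near_centre := ?_, scanned_mem := ?_, collecting := ?_
    near_ball := ?_, near_shell := ?_, cover := ?_, card_out := ?_ }
  · intro j hj
    rcases Finset.mem_insert.1 hj with rfl | hj
    · exact (hI.arcs_lt h hha).1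
    · exact hI.out_lt _ hj
  · intro x hx
    rcases Finset.mem_insert.1 hx with rfl | hx
    exacts [hm, hI.grouped_mem x hx]
  · intro x
    dsimp only
    by_cases h3 : x = s.label h
    · subst h3
      simp only [Function.update_self, Finset.mem_insert, true_or, iff_true]
      exact (hI.group_iff _).2 hyg
    · rw [Function.update_of_ne h3, hI.group_iff]
      simp [h3]
  · intro p hp hpg
    dsimp only at hpg ⊢
    by_cases h3 : s.label p = s.label h
    · rw [h3, Function.update_self]
      exact hI.group_mem _ hl2 hyg
    · rw [Function.update_of_ne h3]
      exact hI.group_mem p hp ((Finset.mem_insert.1 hpg).resolve_left h3)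
  · intro x hx
    rcases Finset.mem_insert.1 hx with rfl | hx
    · exact .inr ⟨h, hl1, hhs, rfl, (hI.arcs_opp h hha).2.symm⟩
    · exact hI.group_active x hx
  · intro p q hp hq hpq
    have := hI.near_label p q hp hq hpq
    exact ⟨this.1, this.2.mono hout le_rfl⟩
  · intro p hp hpg
    dsimp only at hpg ⊢
    by_cases h3 : s.label p = s.label h
    · rw [h3, Function.update_self, if_neg fun h => hx (hI.matched_sub h)]
      have h4 := hI.near_of_front hp hl1 hhs h3
      have h5 := (hI.near_centre _ hl2 hyg).2
      rw [if_pos hy] at h5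
      refine ⟨h4.1, (((h4.2.mono hout le_rfl).trans (Near.edge
        (Finset.mem_insert_self _ _))).trans (h5.mono hout le_rfl)).mono subset_rfl ?_⟩
      have := D.w_le _ (hI.arcs_lt h hha).1
      rw [hhs] at this
      linarith
    · rw [Function.update_of_ne h3]
      have := hI.near_centre p hp ((Finset.mem_insert.1 hpg).resolve_left h3)
      exact ⟨this.1, this.2.mono hout le_rfl⟩
  · intro h hh
    obtain ⟨h1, h2, h3, h4⟩ := hI.scanned_mem h hh
    exact ⟨h1, h2, h3, h4.mono hout le_rfl⟩
  · intro i hi hs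
    exact absurd hs (hsc i hi).ne'
  · exact fun p hp hpb => (hI.near_ball p hp hpb).mono hout le_rfl
  · exact fun p hp hpb => (hI.near_shell p hp hpb).mono hout le_rfl
  · intro j hj hjt
    exact (hI.cover j hj hjt).imp_left fun h => h.mono hout le_rfl
  · have h3 := hI.card_out
    have h4 : ((insert (h / 2) s.out).card : ℝ) ≤ s.out.card + 1 := by
      exact_mod_cast Finset.card_insert_le _ _
    dsimp only
    rw [Finset.card_insert_of_notMem hx]
    push_cast
    linarith

/-- A cluster next to the ball is found, and the edge to it becomes an edge of the spanner. -/
theorem visit (hI : Inv D s) {h : ℕ} (hh : h ∈ s.front) (hy : s.label (opp h) ∉ s.removed)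
    (hyb : s.label (opp h) ∉ s.ball ∪ s.shell) :
    Inv D { s with
      shell := insert (s.label (opp h)) s.shell
      out := insert (h / 2) s.out } := by
  obtain ⟨hha, hhb, hhs⟩ := hI.front_mem h hh
  obtain ⟨hl1, hl2⟩ := hI.live_arcs hh
  have hos : D.sc (opp h / 2) = s.scale := by rwa [opp_div_two]
  have hout : s.out ⊆ insert (h / 2) s.out := Finset.subset_insert _ _
  have hsc := hI.lt_sc_of_ball (Finset.mem_union_left _ hhb)
  simp only [Finset.mem_union, not_or] at hyb
  refine { hI with
    out_lt := ?_, near_label := ?_, near_centre := ?_, ball_label := ?_, shell_mem := ?_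
    ball_nonempty := fun _ => ⟨_, hhb⟩
    scanned_mem := ?_, collecting := ?_
    near_ball := ?_, near_shell := ?_, cover := ?_, card_out := ?_ }
  · intro j hj
    rcases Finset.mem_insert.1 hj with rfl | hj
    · exact (hI.arcs_lt h hha).1
    · exact hI.out_lt _ hj
  · intro p q hp hq hpq
    have := hI.near_label p q hp hq hpq
    exact ⟨this.1, this.2.mono hout le_rfl⟩
  · intro p hp hpg
    have := hI.near_centre p hp hpg
    exact ⟨this.1, this.2.mono hout le_rfl⟩
  · intro x hx
    simp only [Finset.mem_union, Finset.mem_insert] at hx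
    rcases hx with hx | rfl | hx
    · exact hI.ball_label x (Finset.mem_union_left _ hx)
    · exact ⟨opp h, (hI.arcs_opp h hha).1, rfl⟩
    · exact hI.ball_label x (Finset.mem_union_right _ hx)
  · intro x hx
    rcases Finset.mem_insert.1 hx with rfl | hx
    · exact ⟨hy, hyb.1⟩
    · exact hI.shell_mem x hx
  · intro h hh
    obtain ⟨h1, h2, h3, h4⟩ := hI.scanned_mem h hh
    exact ⟨h1, h2, h3, h4.mono hout le_rfl⟩
  · intro i hi hs
    exact absurd hs (hsc i hi).ne'
  · exact fun p hp hpb => (hI.near_ball p hp hpb).mono hout le_rfl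
  · intro p hp hpb
    rcases Finset.mem_insert.1 hpb with hpy | hpb
    · have h4 := hI.near_of_front hp hl2 hos hpy
      have he := Near.edge (ep := D.ep) (w := D.w) (O := insert (h / 2) s.out) (h := opp h)
        (by simp [opp_div_two])
      rw [opp_opp, opp_div_two] at he
      have h5 := hI.near_ball h hl1 hhb
      refine (((h4.2.mono hout le_rfl).trans he).trans (h5.mono hout le_rfl)).mono subset_rfl ?_
      have := D.w_le _ (hI.arcs_lt h hha).1
      rw [hhs] at this
      dsimp only
      linarith
    · exact (hI.near_shell p hp hpb).mono hout le_rfl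
  · intro j hj hjt
    exact (hI.cover j hj hjt).imp_left fun h => h.mono hout le_rfl
  · have h3 := hI.card_out
    have h4 : ((insert (h / 2) s.out).card : ℝ) ≤ s.out.card + 1 := by
      exact_mod_cast Finset.card_insert_le _ _
    dsimp only
    rw [Finset.card_insert_of_notMem hyb.2]
    push_cast
    linarith

/-- The growth of the balls bounds their radius. -/
theorem depth_lt (hI : Inv D s) (hb : s.ball.Nonempty) : s.depth < D.k := by
  by_contra hk
  push Not at hk
  have h1 : s.ball ⊆ Finset.Ico 1 s.fresh := fun x hx => by
    obtain ⟨h, hh, rfl⟩ := hI.ball_label x (Finset.mem_union_left _ hx)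
    have := hI.label_mem h (.inr hh)
    have := hI.base_le
    simp; omega
  have h2 := Finset.card_le_card h1
  rw [Nat.card_Ico] at h2
  have h3 : 0 < s.ball.card := hb.card_pos
  have h4 := hI.fresh_le (by omega)
  have h5 : s.ball.card ≤ 2 * D.g * D.n := by omega
  have h6 := hI.card_ball hb
  have h7 : D.τ ^ D.k ≤ D.τ ^ s.depth := pow_le_pow_right₀ D.one_le_τ hk
  have h8 : (s.ball.card : ℝ) ≤ 2 * D.g * D.n := by exact_mod_cast h5
  linarith [D.lt_τ_pow]

/-- The half-edge `h` has been dealt with: its two clusters are near the root of a ball, or its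
edge was scanned from the other side. -/
theorem scan (hI : Inv D s) {h : ℕ} (hh : h ∈ s.front) (hx : s.label h ∈ s.grouped)
    (hy : s.label (opp h) ∈ s.removed ∨ s.label (opp h) ∈ s.ball ∪ s.shell) :
    Inv D { s with
      front := s.front.erase h
      removed := insert (s.label h) s.removed
      scanned := insert h s.scanned } := by
  obtain ⟨hha, hhb, hhs⟩ := hI.front_mem h hh
  obtain ⟨hl1, hl2⟩ := hI.live_arcs hh
  have hsc := hI.lt_sc_of_ball (Finset.mem_union_left _ hhb)
  have hspan : Spanned D s.out (h / 2) := by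
    have key : Near D.ep D.w s.out (D.ep h) (D.ep (opp h))
        ((2 * D.k - 1) * D.σ * D.w (h / 2)) → Spanned D s.out (h / 2) := by
      intro hn
      unfold Spanned
      rcases eq_of_div_two_eq (rfl : h / 2 = h / 2) with h1 | h1
      · have h2 : 2 * (h / 2) + 1 = opp h := by unfold opp; omega
        rwa [← h1, h1, h2, ← h1]
      · have h2 : 2 * (h / 2) = opp h := by unfold opp; omega
        rw [← h1, h2]
        exact hn.symm
    by_cases hyb : s.label (opp h) ∈ s.ball ∪ s.shell
    · refine key ?_
      have h1 := hI.near_ball h hl1 hhb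
      have hδ := D.δ_pos
      have hb1 := D.one_le_b
      have h2 : Near D.ep D.w s.out (D.ep (opp h)) s.root
          (((s.depth + 1) * D.b + (s.depth + 2) * D.δ) * D.b ^ s.scale) := by
        rcases Finset.mem_union.1 hyb with h3 | h3
        · refine (hI.near_ball _ hl2 h3).mono subset_rfl ?_
          gcongr ?_ * _
          nlinarith
        · exact hI.near_shell _ hl2 h3
      refine (h1.trans h2.symm).mono subset_rfl ?_
      have hw := D.le_w _ (hI.arcs_lt h hha).1
      rw [hhs] at hw
      have hd : (s.depth + 1 : ℝ) ≤ D.k := by exact_mod_cast hI.depth_lt ⟨_, hhb⟩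
      have h5 : (s.depth * D.b + (s.depth + 1) * D.δ) + ((s.depth + 1) * D.b + (s.depth + 2) * D.δ)
          ≤ (2 * D.k - 1) * D.σ := by
        have h6 : (2 * s.depth + 1) * D.b ≤ (2 * D.k - 1) * D.b := by gcongr; linarith
        have h7 : (2 * s.depth + 3) * D.δ ≤ (2 * D.k - 1) * (3 * D.δ) := by
          rw [← mul_assoc]; gcongr; linarith
        have h8 : (2 * D.k - 1) * (D.b + 3 * D.δ) ≤ (2 * D.k - 1) * D.σ := by
          gcongr
          · linarith
          · exact D.le_σ
        linarith
      rw [← add_mul]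
      have h9 : 0 ≤ (2 * D.k - 1) * D.σ := le_trans (by positivity) h5
      gcongr
    · have hyr := hy.resolve_right hyb
      rcases hI.removed_scanned _ (hI.arcs_opp h hha).1 hyr with h1 | h1
      · exact absurd (Finset.mem_union_left _ (hI.front_mem _ h1).2.1) hyb
      · have := (hI.scanned_mem _ h1).2.2.2
        rwa [opp_div_two] at this
  refine { hI with
    removed_sub := ?_, group_active := ?_, pending := ?_, ball_pending := ?_, front_mem := ?_
    shell_mem := ?_, scanned_mem := ?_, removed_scanned := ?_, collecting := ?_, card_out := ?_ }
  · exact Finset.insert_subset hx hI.removed_sub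
  · intro x hx
    exact (hI.group_active x hx).imp_left fun h => Finset.mem_insert_of_mem h
  · intro p hp hpr
    exact hI.pending p hp fun h => hpr (Finset.mem_insert_of_mem h)
  · intro p hp hpb hpr
    refine Finset.mem_erase.2 ⟨?_, hI.ball_pending p hp hpb fun h =>
      hpr (Finset.mem_insert_of_mem h)⟩
    rintro rfl
    exact hpr (Finset.mem_insert_self _ _)
  · intro p hp
    exact hI.front_mem p (Finset.mem_of_mem_erase hp)
  · intro x hx
    have := hI.shell_mem x hx
    refine ⟨fun h1 => ?_, this.2⟩
    rcases Finset.mem_insert.1 h1 with rfl | h1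
    exacts [this.2 hhb, this.1 h1]
  · intro p hp
    rcases Finset.mem_insert.1 hp with rfl | hp
    · exact ⟨hha, Finset.notMem_erase _ _, Finset.mem_insert_self _ _, hspan⟩
    · obtain ⟨h1, h2, h3, h4⟩ := hI.scanned_mem p hp
      exact ⟨h1, fun h5 => h2 (Finset.mem_of_mem_erase h5), Finset.mem_insert_of_mem h3, h4⟩
  · intro p hp hpr
    by_cases hph : p = h
    · exact .inr (hph ▸ Finset.mem_insert_self _ _)
    · have h1 : p ∈ s.front ∨ p ∈ s.scanned := by
        by_cases hr : s.label p ∈ s.removed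
        · exact hI.removed_scanned p hp hr
        · have h2 := (Finset.mem_insert.1 hpr).resolve_right hr
          exact .inl (hI.ball_pending p hp (h2 ▸ hhb) hr)
      exact h1.imp (fun h2 => Finset.mem_erase.2 ⟨hph, h2⟩) Finset.mem_insert_of_mem
  · intro i hi hs
    exact absurd hs (hsc i hi).ne'
  · have : insert (s.label h) s.removed \ s.ball = s.removed \ s.ball :=
      Finset.insert_sdiff_of_mem _ hhb
    dsimp only
    rw [this]
    exact hI.card_out

/-- The final state. -/
theorem result (hI : Inv D s) (ht : s.todo = ∅) (hf : s.front = ∅) (hr : s.roots = ∅)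
    (hb : s.ball = ∅) (hs : s.shell = ∅) :
    (∀ i < D.m, Spanned D s.out i) ∧
      (s.out.card : ℝ) ≤ (2 * D.g * D.n) * (1 + D.τ) := by
  constructor
  · intro i hi
    rcases hI.cover i hi (by simp [ht]) with h | h
    · exact h
    · have h1 : s.label (2 * i) ∈ s.removed := by
        by_contra hn
        have := (hI.pending _ h hn).2
        simp [hr, hb] at this
      have h2 := (hI.removed_scanned _ h h1).resolve_left (by simp [hf])
      have := (hI.scanned_mem _ h2).2.2.2
      rwa [Nat.mul_div_cancel_left _ two_pos] at this
  · have h1 := hI.card_out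
    have h2 : s.grouped ⊆ Finset.Ico 1 s.fresh := fun x hx => by
      have := hI.grouped_mem x hx
      have := hI.base_le
      simp; omega
    have h3 := Finset.card_le_card h2
    rw [Nat.card_Ico] at h3
    have h4 := Finset.card_le_card hI.removed_sub
    have h5 : s.grouped.card ≤ 2 * D.g * D.n := by
      by_cases hf : 1 ≤ s.fresh
      · have := hI.fresh_le hf
        omega
      · omega
    have h6 : (s.grouped.card : ℝ) ≤ 2 * D.g * D.n := by exact_mod_cast h5
    have h7 : (s.removed.card : ℝ) ≤ 2 * D.g * D.n := by exact_mod_cast h4.trans h5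
    simp only [hb, hs, Finset.sdiff_empty, Finset.card_empty, Nat.cast_zero, add_zero] at h1
    nlinarith [D.one_le_τ]

end Inv

/-- The initial state: every scale class has its own copy of every vertex, and these copies are the
clusters `1, …, g * n`. -/
def initial (D : Setup) (j : ℕ) (c : ℤ) : St where
  todo := Finset.range j
  arcs := ∅
  roots := ∅
  front := ∅
  scanned := ∅
  removed := ∅
  grouped := ∅
  matched := ∅
  ball := ∅
  shell := ∅
  out := ∅
  label p := 1 + (D.sc (p / 2) % D.g).toNat * D.n + D.ep p
  group _ := 0
  centre _ := 0
  scale := c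
  base := D.g * D.n + 1
  fresh := D.g * D.n + 1
  depth := 0
  root := 0

theorem inv_initial {c : ℤ} (hg : 0 < D.g) (hep : ∀ p, p / 2 < D.m → D.ep p < D.n)
    (hc : ∀ i < D.m, c ≤ D.sc i) : Inv D (initial D D.m c) := by
  have hmod : ∀ p : ℕ, (((D.sc (p / 2) % D.g).toNat : ℕ) : ℤ) = D.sc (p / 2) % D.g := fun p =>
    Int.toNat_of_nonneg (Int.emod_nonneg _ (by omega))
  have hlive : ∀ p, Live D (initial D D.m c) p → p / 2 < D.m := by
    rintro p (hp | ⟨hp, -⟩)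
    · simpa [initial] using hp
    · simp [initial] at hp
  constructor <;> try simp [initial]
  · exact hc
  · intro p hp
    have h1 := hep p hp
    have h2 : (D.sc (p / 2) % D.g).toNat < D.g := by
      have := Int.emod_lt_of_pos (D.sc (p / 2)) (b := D.g) (by omega)
      have := hmod p
      omega
    have h3 : ((D.sc (p / 2) % D.g).toNat + 1) * D.n ≤ D.g * D.n := Nat.mul_le_mul_right _ h2
    have h4 : ((D.sc (p / 2) % D.g).toNat + 1) * D.n = (D.sc (p / 2) % D.g).toNat * D.n + D.n := by
      ring
    omega
  · intro p q hp hq hpq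
    replace hp := hlive p hp
    replace hq := hlive q hq
    have h1 := hep p hp
    have h2 := hep q hq
    have hn : 0 < D.n := by omega
    replace hpq : (D.sc (p / 2) % D.g).toNat * D.n + D.ep p =
      (D.sc (q / 2) % D.g).toNat * D.n + D.ep q := by omega
    have h3 : D.ep p = D.ep q := by
      have := congrArg (· % D.n) hpq
      simpa [Nat.add_mod, Nat.mod_eq_of_lt, h1, h2] using this
    have h4 : (D.sc (p / 2) % D.g).toNat = (D.sc (q / 2) % D.g).toNat := by
      rw [h3] at hpq
      exact Nat.eq_of_mul_eq_mul_right hn (by omega)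
    constructor
    · unfold Int.ModEq
      rw [← hmod p, ← hmod q, h4]
    · rw [h3]
      refine .refl _ ?_
      have := D.δ_pos
      have := zpow_pos (Inv.b_pos D) (min (D.sc (p / 2)) (D.sc (q / 2)))
      positivity
  · intro i h1 h2
    omega


/-! ### Words of digits stored in one real number -/

/-- The value of a digit `1` at position `q` in the base `exp l`. -/
noncomputable def place (l : ℝ) (q : ℤ) : ℝ := Real.exp (-(l * q))

/-- The real number with the digit `f p` at the position `pos p`, for all `p ∈ S`. With all digits
equal to `1` it encodes the set of these positions. -/
noncomputable def encode (l : ℝ) (pos : ℕ → ℤ) (S : Finset ℕ) (f : ℕ → ℕ) : ℝ :=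
  ∑ p ∈ S, (f p : ℝ) * place l (pos p)

section

variable {l : ℝ} {pos : ℕ → ℤ} {S T : Finset ℕ} {f : ℕ → ℕ}

theorem place_pos (l : ℝ) (q : ℤ) : 0 < place l q := Real.exp_pos _

theorem place_sub_one (l : ℝ) (q : ℤ) : place l (q - 1) = Real.exp l * place l q := by
  unfold place
  rw [← Real.exp_add]
  push_cast
  ring_nf

theorem place_le_place (hl : 0 < l) {q r : ℤ} (h : q ≤ r) : place l r ≤ place l q := by
  unfold place
  have : (q : ℝ) ≤ r := by exact_mod_cast h
  gcongr

/-- A finite part of the geometric series. -/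
theorem sum_place_le (hl : 0 < l) {q : ℤ} (S : Finset ℤ) (hS : ∀ r ∈ S, q < r) :
    ∀ N, q ≤ N → (∀ r ∈ S, r ≤ N) →
      (Real.exp l - 1) * ∑ r ∈ S, place l r ≤ place l q - place l N := by
  induction S using Finset.induction_on_max with
  | empty =>
    intro N hN _
    simpa using place_le_place hl hN
  | insert a S ha ih =>
    intro N hN hr
    have hqa := hS a (Finset.mem_insert_self _ _)
    have h1 := ih (fun r hr => hS r (Finset.mem_insert_of_mem hr)) (a - 1) (by omega)
      (fun r hr => by have := ha r hr; omega)
    have h2 := place_le_place hl (hr a (Finset.mem_insert_self _ _))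
    rw [place_sub_one] at h1
    rw [Finset.sum_insert fun h => lt_irrefl _ (ha a h), mul_add]
    linarith

/-- The first digit of a word and its position are found by a logarithm and by rounding, because
all later digits together contribute less than one unit at the first position. -/
theorem encode_lead (hl : 0 < l) (hS : S.Nonempty) (hinj : Set.InjOn pos S) {d : ℕ}
    (hd : (d + 2 : ℝ) ≤ Real.exp l) (h1 : ∀ p ∈ S, 1 ≤ f p) (hfd : ∀ p ∈ S, f p ≤ d) :
    ∃ p₀ ∈ S, (∀ p ∈ S, pos p₀ ≤ pos p) ∧ 0 < encode l pos S f ∧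
      ⌊Real.log (encode l pos S f) / l⌋ = -pos p₀ ∧
      ⌊encode l pos S f * Real.exp (l * pos p₀)⌋ = f p₀ := by
  obtain ⟨p₀, hp₀, hmin⟩ := S.exists_min_image pos hS
  have hsplit : encode l pos S f = f p₀ * place l (pos p₀) + encode l pos (S.erase p₀) f :=
    (Finset.add_sum_erase S _ hp₀).symm
  have hx := place_pos l (pos p₀)
  have htail0 : 0 ≤ encode l pos (S.erase p₀) f :=
    Finset.sum_nonneg fun p _ => mul_nonneg (Nat.cast_nonneg _) (place_pos _ _).le
  have htail : encode l pos (S.erase p₀) f < place l (pos p₀) := by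
    have hlt : ∀ r ∈ (S.erase p₀).image pos, pos p₀ < r := by
      intro r hr
      obtain ⟨p, hp, rfl⟩ := Finset.mem_image.1 hr
      obtain ⟨hp1, hp2⟩ := Finset.mem_erase.1 hp
      exact lt_of_le_of_ne (hmin p hp2) fun h => hp1 (hinj hp2 hp₀ h.symm)
    obtain ⟨N, hN⟩ := ((S.erase p₀).image pos).bddAbove
    have h2 := sum_place_le hl _ hlt (max (pos p₀) N) (le_max_left _ _)
      fun r hr => le_max_of_le_right (hN hr)
    rw [Finset.sum_image fun a ha b hb => hinj (Finset.mem_of_mem_erase ha)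
      (Finset.mem_of_mem_erase hb)] at h2
    have h3 : encode l pos (S.erase p₀) f ≤ d * ∑ p ∈ S.erase p₀, place l (pos p) := by
      rw [Finset.mul_sum]
      refine Finset.sum_le_sum fun p hp => ?_
      have := hfd p (Finset.mem_of_mem_erase hp)
      have := (place_pos l (pos p)).le
      gcongr
    have h5 := place_pos l (max (pos p₀) N)
    nlinarith
  have hf1 : (1 : ℝ) ≤ f p₀ := by exact_mod_cast h1 p₀ hp₀
  have hfd' : (f p₀ : ℝ) ≤ d := by exact_mod_cast hfd p₀ hp₀
  have hpos : 0 < encode l pos S f := by rw [hsplit]; positivity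
  refine ⟨p₀, hp₀, hmin, hpos, ?_, ?_⟩
  · rw [Int.floor_eq_iff, le_div_iff₀ hl, div_lt_iff₀ hl]
    constructor
    · rw [Real.le_log_iff_exp_le hpos, hsplit]
      have : Real.exp (((-pos p₀ : ℤ) : ℝ) * l) = place l (pos p₀) := by
        unfold place; push_cast; ring_nf
      rw [this]
      nlinarith
    · rw [Real.log_lt_iff_lt_exp hpos, hsplit]
      have : Real.exp ((((-pos p₀ : ℤ) : ℝ) + 1) * l) = Real.exp l * place l (pos p₀) := by
        unfold place; rw [← Real.exp_add]; push_cast; ring_nf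
      rw [this]
      nlinarith
  · have hinv : place l (pos p₀) * Real.exp (l * pos p₀) = 1 := by
      unfold place; rw [← Real.exp_add]; simp
    rw [Int.floor_eq_iff, hsplit, add_mul, mul_assoc, hinv]
    have h2 : encode l pos (S.erase p₀) f * Real.exp (l * pos p₀) < 1 := by
      rw [← hinv]; gcongr
    have h3 : 0 ≤ encode l pos (S.erase p₀) f * Real.exp (l * pos p₀) := by positivity
    push_cast
    constructor <;> linarith

theorem encode_pos_iff (h1 : ∀ p ∈ S, 1 ≤ f p) : 0 < encode l pos S f ↔ S.Nonempty := by
  constructor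
  · intro h
    rw [Finset.nonempty_iff_ne_empty]
    rintro rfl
    simp [encode] at h
  · intro h
    refine Finset.sum_pos (fun p hp => mul_pos ?_ (place_pos _ _)) h
    exact_mod_cast h1 p hp

theorem encode_empty : encode l pos ∅ f = 0 := Finset.sum_empty

theorem encode_erase {p : ℕ} (hp : p ∈ S) :
    encode l pos (S.erase p) f = encode l pos S f - f p * place l (pos p) :=
  eq_sub_of_add_eq (Finset.sum_erase_add S _ hp)

theorem encode_insert {p : ℕ} (hp : p ∉ S) :
    encode l pos (insert p S) f = encode l pos S f + f p * place l (pos p) :=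
  (Finset.sum_insert hp).trans (add_comm _ _)

theorem encode_union (h : Disjoint S T) :
    encode l pos (S ∪ T) f = encode l pos S f + encode l pos T f :=
  Finset.sum_union h

theorem encode_congr {f' : ℕ → ℕ} (h : ∀ p ∈ S, f p = f' p) :
    encode l pos S f = encode l pos S f' :=
  Finset.sum_congr rfl fun p hp => by rw [h p hp]

/-- Replacing the digit `x` by `c` wherever it occurs takes a single multiplication. -/
theorem encode_replace {f' : ℕ → ℕ} {x c : ℕ} (h : ∀ p ∈ S, f' p = if f p = x then c else f p) :
    encode l pos S f' = encode l pos S f +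
      ((c : ℝ) - x) * encode l pos (S.filter fun p => f p = x) fun _ => 1 := by
  unfold encode
  rw [Finset.mul_sum, Finset.sum_filter, ← Finset.sum_add_distrib]
  refine Finset.sum_congr rfl fun p hp => ?_
  rw [h p hp]
  split_ifs with hx
  · rw [hx]; push_cast; ring
  · simp

end

/-! ### Reasoning about programs -/

@[simp] theorem storeInt_int (s : State) (b : ℕ) (i x : ℤ) (b' : ℕ) (i' : ℤ) :
    (s.storeInt b i x).int b' i' = if b' = b ∧ i' = i then x else s.int b' i' := by
  unfold State.storeInt
  by_cases hb : b' = b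
  · subst hb
    simp [Function.update_apply]
  · simp [hb]

@[simp] theorem storeInt_real (s : State) (b : ℕ) (i x : ℤ) : (s.storeInt b i x).real = s.real :=
  rfl

@[simp] theorem storeReal_real (s : State) (b : ℕ) (i : ℤ) (x : ℝ) (b' : ℕ) (i' : ℤ) :
    (s.storeReal b i x).real b' i' = if b' = b ∧ i' = i then x else s.real b' i' := by
  unfold State.storeReal
  by_cases hb : b' = b
  · subst hb
    simp [Function.update_apply]
  · simp [hb]

@[simp] theorem storeReal_int (s : State) (b : ℕ) (i : ℤ) (x : ℝ) : (s.storeReal b i x).int = s.int :=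
  rfl

/-- A bound on the running time of a program without loops. -/
def maxCost : Prog → ℕ
  | .skip => 1
  | .setInt _ i x => i.cost + x.cost + 1
  | .setReal _ i x => i.cost + x.cost + 1
  | .seq p q => maxCost p + maxCost q
  | .branch b p q => b.cost + 1 + max (maxCost p) (maxCost q)
  | .loop _ _ => 0

/-- The weakest precondition for a program without loops to halt legally in a state with the
property `Q`. -/
def Wp (W : ℕ) : Prog → State → (State → Prop) → Prop
  | .skip, s, Q => Q s
  | .setInt b i x, s, Q => i.Ok W s ∧ x.Ok W s ∧ Q (s.storeInt b (i.eval s) (x.eval s))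
  | .setReal b i x, s, Q => i.Ok W s ∧ x.Ok W s ∧ Q (s.storeReal b (i.eval s) (x.eval s))
  | .seq p q, s, Q => Wp W p s fun r => Wp W q r Q
  | .branch b p q, s, Q => b.Ok W s ∧ (b.Holds s → Wp W p s Q) ∧ (¬ b.Holds s → Wp W q s Q)
  | .loop _ _, _, _ => False

section

variable {W : ℕ} {p q : Prog} {s : State} {Q Q' : State → Prop}

theorem Wp.exec (h : Wp W p s Q) : ∃ r t, Exec W p s r t ∧ t ≤ maxCost p ∧ Q r := by
  induction p generalizing s Q with
  | skip => exact ⟨s, 1, .skip s, le_rfl, h⟩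
  | setInt b i x => exact ⟨_, _, .setInt b i x s h.1 h.2.1, le_rfl, h.2.2⟩
  | setReal b i x => exact ⟨_, _, .setReal b i x s h.1 h.2.1, le_rfl, h.2.2⟩
  | seq p q ihp ihq =>
    obtain ⟨r, t, hr, ht, h1⟩ := ihp h
    obtain ⟨r', t', hr', ht', h2⟩ := ihq h1
    exact ⟨r', t + t', .seq hr hr', Nat.add_le_add ht ht', h2⟩
  | branch b p q ihp ihq =>
    obtain ⟨hb, h1, h2⟩ := h
    by_cases hh : b.Holds s
    · obtain ⟨r, t, hr, ht, h3⟩ := ihp (h1 hh)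
      exact ⟨r, _, .branch_true hb hh hr, by simp only [maxCost]; omega, h3⟩
    · obtain ⟨r, t, hr, ht, h3⟩ := ihq (h2 hh)
      exact ⟨r, _, .branch_false hb hh hr, by simp only [maxCost]; omega, h3⟩
  | loop b p _ => exact h.elim

theorem Wp.mono (h : Wp W p s Q) (hQ : ∀ r, Q r → Q' r) : Wp W p s Q' := by
  induction p generalizing s Q Q' with
  | skip => exact hQ _ h
  | setInt b i x => exact ⟨h.1, h.2.1, hQ _ h.2.2⟩
  | setReal b i x => exact ⟨h.1, h.2.1, hQ _ h.2.2⟩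
  | seq p q ihp ihq => exact ihp h fun r hr => ihq hr hQ
  | branch b p q ihp ihq => exact ⟨h.1, fun hh => ihp (h.2.1 hh) hQ, fun hh => ihq (h.2.2 hh) hQ⟩
  | loop b p _ => exact h.elim

theorem Wp.seq (h : Wp W p s Q') (hq : ∀ r, Q' r → Wp W q r Q) : Wp W (.seq p q) s Q :=
  Wp.mono (p := p) (Q := Q') h hq

/-- The rule for loops, with an invariant that counts the remaining rounds. -/
theorem exec_loop {b : Test} (I : ℕ → State → Prop)
    (h : ∀ N s, I N s → b.Ok W s ∧ (b.Holds s → ∃ N' < N, Wp W p s (I N'))) {N : ℕ} (hs : I N s) :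
    ∃ r t, Exec W (.loop b p) s r t ∧ t ≤ (b.cost + 1 + maxCost p) * (N + 1) ∧ (∃ N', I N' r) ∧
      ¬ b.Holds r := by
  induction N using Nat.strong_induction_on generalizing s with
  | _ N ih =>
    obtain ⟨hb, h1⟩ := h N s hs
    by_cases hh : b.Holds s
    · obtain ⟨N', hN, h2⟩ := h1 hh
      obtain ⟨r, t, hr, ht, h3⟩ := h2.exec
      obtain ⟨v, t', hv, ht', h4⟩ := ih N' hN h3
      refine ⟨v, _, .loop_true hb hh hr hv, ?_, h4⟩
      have h5 : (b.cost + 1 + maxCost p) * (N' + 1 + 1) ≤ (b.cost + 1 + maxCost p) * (N + 1) := by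
        gcongr; omega
      rw [mul_add_one] at h5
      omega
    · refine ⟨s, _, .loop_false hb hh, ?_, ⟨N, hs⟩, hh⟩
      nlinarith [Nat.zero_le (maxCost p)]

end

/-! ### The program

Registers, in integer bank `0`: `0` `n`, `1` `m`, `2` `k`, `3` `g`, `4` the next unused cluster,
`5` the scale of the batch, `6` the time stamp, `7` the size of the ball, `8` the size of its shell,
`9` whether to go on, `10` a half-edge `h`, `11` its edge, `12` and `13` the clusters of `h` and of
its opposite, `14` a group, `15` the position of the next half-edge to be collected, `16` its scale.
In real bank `0`: `0` `ε`, `1` the logarithm of the base, `2` `τ`, `3` the clusters of all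
half-edges to be collected, `4` the front, `5` the half-edges leaving the shell, `6` the roots,
`7` half of `min ε 1`, `8` `log b`.

Arrays, in integer banks: `3` output, `4` clusters of the collected half-edges, `5` removed
clusters, `6` groups, `7` time stamps of the clusters visited. In real banks, for every cluster:
`2` the positions of its half-edges to be collected, `3` its half-edges in the batch. -/

/-- Integer register. -/
abbrev ireg (a : ℤ) : IExpr := .get 0 (.lit a)

/-- Real register. -/
abbrev rreg (a : ℤ) : RExpr := .get 0 (.lit a)

/-- The place value at a position. -/
def placeExpr (q : IExpr) : RExpr :=
  .exp (.sub (.ofInt (.lit 0)) (.mul (rreg 1) (.ofInt q)))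

/-- The position of the first digit of a word. -/
def leadExpr (x : RExpr) : IExpr := .sub (.lit 0) (.floor (.div (.log x) (rreg 1)))

/-- The digit at position `q`, if it is the first one of the word. -/
def digitExpr (x : RExpr) (q : IExpr) : IExpr :=
  .floor (.mul x (.exp (.mul (rreg 1) (.ofInt q))))

/-- Half of an integer, rounded down. -/
def halfExpr (x : IExpr) : IExpr := .floor (.div (.ofInt x) (.ofInt (.lit 2)))

/-- `0 < x`. -/
def posTest (x : RExpr) : Test := .neg (.rle x (.ofInt (.lit 0)))

/-- `x ≠ y`. -/
def neTest (x y : IExpr) : Test := .neg (.conj (.ile x y) (.ile y x))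

/-- Take a half-edge from the front. -/
def loadProg : Prog :=
  .seq (.setInt 0 (.lit 10) (leadExpr (rreg 4))) <|
  .seq (.setInt 0 (.lit 11) (halfExpr (ireg 10))) <|
  .seq (.setInt 0 (.lit 12) (.get 4 (ireg 10))) <|
  .setInt 0 (.lit 13)
    (.get 4 (.sub (.add (.mul (.lit 4) (ireg 11)) (.lit 1)) (ireg 10)))

/-- Visit the cluster at the other end. -/
def visitProg : Prog :=
  .branch (.conj (.ile (.get 5 (ireg 13)) (.lit 0)) (.neg (.ile (ireg 6) (.get 7 (ireg 13)))))
    (.seq (.setInt 7 (ireg 13) (ireg 6)) <|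
     .seq (.setInt 3 (ireg 11) (.lit 1)) <|
     .seq (.setInt 0 (.lit 8) (.add (ireg 8) (.lit 1))) <|
     .setReal 0 (.lit 5) (.add (rreg 5) (.get 3 (ireg 13))))
    .skip

/-- Join the group of a matched neighbour. -/
def attachProg : Prog :=
  .branch (.ile (.get 6 (ireg 12)) (.lit 0))
    (.seq (.setInt 6 (ireg 12) (.get 6 (ireg 13))) (.setInt 3 (ireg 11) (.lit 1)))
    .skip

/-- Replace a cluster by its group in all half-edges to be collected. -/
def mergeProg : Prog :=
  .seq (.setReal 0 (.lit 4) (.sub (rreg 4) (placeExpr (ireg 10)))) <|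
  .seq (.setInt 5 (ireg 12) (.lit 1)) <|
  .seq (.setInt 0 (.lit 14) (.get 6 (ireg 12))) <|
  .seq (.setReal 0 (.lit 3) (.add (rreg 3)
    (.mul (.ofInt (.sub (ireg 14) (ireg 12))) (.get 2 (ireg 12))))) <|
  .seq (.setReal 2 (ireg 14) (.add (.get 2 (ireg 14)) (.get 2 (ireg 12)))) <|
  .setReal 2 (ireg 12) (.ofInt (.lit 0))

/-- Scan a half-edge of the front. -/
def scanProg : Prog := .seq loadProg <| .seq visitProg <| .seq attachProg mergeProg

/-- Add the shell to the ball. -/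
def expandProg : Prog :=
  .seq (.setReal 0 (.lit 4) (rreg 5)) <|
  .seq (.setReal 0 (.lit 5) (.ofInt (.lit 0))) <|
  .seq (.setInt 0 (.lit 7) (.add (ireg 7) (ireg 8))) <|
  .setInt 0 (.lit 8) (.lit 0)

/-- Discard the ball. -/
def absorbProg : Prog :=
  .seq (.setInt 0 (.lit 6) (.add (ireg 6) (.lit 1))) <|
  .seq (.setReal 0 (.lit 5) (.ofInt (.lit 0))) <|
  .seq (.setInt 0 (.lit 7) (.lit 0)) <|
  .setInt 0 (.lit 8) (.lit 0)

/-- Find the position and the scale of the next half-edge to be collected. -/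
def peekProg : Prog :=
  .branch (posTest (rreg 3))
    (.seq (.setInt 0 (.lit 15) (leadExpr (rreg 3))) <|
     .setInt 0 (.lit 16) (.floor (.div (.ofInt (ireg 15)) (.ofInt (.mul (.lit 2) (ireg 1))))))
    (.setInt 0 (.lit 16) (.add (ireg 5) (.lit 1)))

/-- Take a half-edge from the roots, and start a ball at its cluster unless that is removed. -/
def startProg : Prog :=
  .seq (.setInt 0 (.lit 10) (leadExpr (rreg 6))) <|
  .seq (.setReal 0 (.lit 6) (.sub (rreg 6) (placeExpr (ireg 10)))) <|
  .seq (.setInt 0 (.lit 12) (.get 4 (ireg 10))) <|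
  .branch (.ile (.get 5 (ireg 12)) (.lit 0))
    (.seq (.setInt 7 (ireg 12) (ireg 6)) <|
     .seq (.setInt 0 (.lit 7) (.lit 1)) <|
     .setReal 0 (.lit 4) (.get 3 (ireg 12)))
    .skip

/-- Find the next edge to be collected and its two clusters. -/
def nextProg : Prog :=
  .seq (.setInt 0 (.lit 5) (ireg 16)) <|
  .seq (.setInt 0 (.lit 10) (.sub (ireg 15) (.mul (.mul (.lit 2) (ireg 1)) (ireg 16)))) <|
  .seq (.setInt 0 (.lit 11) (halfExpr (ireg 10))) <|
  .seq (.setInt 0 (.lit 12) (digitExpr (rreg 3) (ireg 15))) <|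
  .setInt 0 (.lit 13) (digitExpr
    (.sub (rreg 3) (.mul (.ofInt (ireg 12)) (placeExpr (ireg 15)))) (.add (ireg 15) (.lit 1)))

/-- Match two clusters. -/
def matchProg : Prog :=
  .branch (.conj (neTest (ireg 12) (ireg 13))
      (.conj (.ile (.get 6 (ireg 12)) (.lit 0)) (.ile (.get 6 (ireg 13)) (.lit 0))))
    (.seq (.setInt 6 (ireg 12) (ireg 4)) <|
     .seq (.setInt 6 (ireg 13) (ireg 4)) <|
     .seq (.setInt 0 (.lit 4) (.add (ireg 4) (.lit 1))) <|
     .setInt 3 (ireg 11) (.lit 1))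
    .skip

/-- Remove an edge from those to be collected. -/
def removeProg : Prog :=
  .seq (.setReal 0 (.lit 3) (.sub (.sub (rreg 3)
    (.mul (.ofInt (ireg 12)) (placeExpr (ireg 15))))
    (.mul (.ofInt (ireg 13)) (placeExpr (.add (ireg 15) (.lit 1)))))) <|
  .seq (.setReal 2 (ireg 12) (.sub (.get 2 (ireg 12)) (placeExpr (ireg 15)))) <|
  .seq (.setReal 2 (ireg 13)
    (.sub (.get 2 (ireg 13)) (placeExpr (.add (ireg 15) (.lit 1))))) <|
  .seq (.setInt 4 (ireg 10) (ireg 12)) <|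
  .setInt 4 (.add (ireg 10) (.lit 1)) (ireg 13)

/-- Add an edge to the batch. -/
def addProg : Prog :=
  .branch (neTest (ireg 12) (ireg 13))
    (.seq (.setReal 3 (ireg 12) (.add (.get 3 (ireg 12)) (placeExpr (ireg 10)))) <|
     .seq (.setReal 3 (ireg 13)
       (.add (.get 3 (ireg 13)) (placeExpr (.add (ireg 10) (.lit 1))))) <|
     .setReal 0 (.lit 6) (.add (.add (rreg 6) (placeExpr (ireg 10)))
       (placeExpr (.add (ireg 10) (.lit 1)))))
    .skip

/-- Collect the next edge. -/
def collectProg : Prog := .seq nextProg <| .seq matchProg <| .seq removeProg addProg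

/-- One round of the main loop. -/
def roundProg : Prog :=
  .branch (posTest (rreg 4)) scanProg <|
  .branch (.neg (.rle (.add (.ofInt (ireg 7)) (.ofInt (ireg 8))) (.mul (rreg 2) (.ofInt (ireg 7)))))
    expandProg <|
  .seq absorbProg <|
  .seq peekProg <|
  .branch (.conj (posTest (rreg 6)) (.neg (.ile (ireg 16) (ireg 5)))) startProg <|
  .branch (posTest (rreg 3)) collectProg <|
  .setInt 0 (.lit 9) (.lit 0)

attribute [simp] Wp Test.Ok Test.Holds IExpr.Ok RExpr.Ok IExpr.eval RExpr.eval posTest neTest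
  leadExpr digitExpr halfExpr placeExpr


/-! ### The program carries out the transitions -/

/-- The two half-edges of every edge of `T`. -/
def halves (T : Finset ℕ) : Finset ℕ := T.biUnion fun i => {2 * i, 2 * i + 1}

theorem mem_halves {T : Finset ℕ} {p : ℕ} : p ∈ halves T ↔ p / 2 ∈ T := by
  simp only [halves, Finset.mem_biUnion, Finset.mem_insert, Finset.mem_singleton]
  constructor
  · rintro ⟨i, hi, h⟩
    rwa [show p / 2 = i by omega]
  · exact fun h => ⟨_, h, by omega⟩

/-- The position of a half-edge in the order in which the half-edges are collected: by scale, and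
within a scale by number. -/
def key (D : Setup) (p : ℕ) : ℤ := 2 * D.m * D.sc (p / 2) + p

/-- The real number that encodes a set of positions. -/
noncomputable abbrev encodeSet (l : ℝ) (pos : ℕ → ℤ) (S : Finset ℕ) : ℝ :=
  encode l pos S fun _ => 1

/-- The memory state `s` represents the state `a` of the algorithm; `l` is the logarithm of the
base and `st` the time stamp. -/
structure Rep (D : Setup) (l : ℝ) (st : ℕ) (s : State) (a : St) : Prop where
  m : s.int 0 1 = D.m
  fresh : s.int 0 4 = a.fresh
  scale : s.int 0 5 = a.scale
  stamp : s.int 0 6 = st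
  size : s.int 0 7 = a.ball.card
  count : s.int 0 8 = a.shell.card
  going : s.int 0 9 = 1
  out : ∀ i : ℕ, s.int 3 i ≠ 0 ↔ i ∈ a.out
  label : ∀ h ∈ a.arcs, s.int 4 h = a.label h
  removed : ∀ x : ℕ, s.int 5 x = if x ∈ a.removed then 1 else 0
  group : ∀ x : ℕ, s.int 6 x = a.group x
  visited_le : ∀ x : ℕ, s.int 7 x ≤ st
  visited : ∀ x : ℕ, s.int 7 x = st ↔ x ∈ a.ball ∪ a.shell
  base : s.real 0 1 = l
  growth : s.real 0 2 = D.τ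
  rest : s.real 0 3 = encode l (key D) (halves a.todo) a.relabel
  front : s.real 0 4 = encodeSet l (↑) a.front
  shell : s.real 0 5 = encodeSet l (↑) (a.arcs.filter fun p => a.label p ∈ a.shell)
  roots : s.real 0 6 = encodeSet l (↑) a.roots
  ahead : ∀ x : ℕ, s.real 2 x =
    encodeSet l (key D) ((halves a.todo).filter fun p => a.relabel p = x)
  adj : ∀ x : ℕ, s.real 3 x = encodeSet l (↑) (a.arcs.filter fun p => a.label p = x)

/-- The numbers that occur in a run fit into the words; `B` bounds the scales. -/
def Fits (D : Setup) (B W : ℕ) : Prop := 2 * D.m * B + 4 * D.m + 2 * D.g * D.n + B + 20 ≤ W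

/-- The registers that describe the half-edge `h` being scanned. -/
structure Loaded (s : State) (a : St) (h : ℕ) : Prop where
  half : s.int 0 10 = h
  edge : s.int 0 11 = (h / 2 : ℕ)
  near : s.int 0 12 = a.label h
  far : s.int 0 13 = a.label (opp h)

section

variable {D : Setup} {l : ℝ} {st B W : ℕ} {s : State} {a : St}

theorem floor_half (h : ℕ) : ⌊((h : ℝ)) / 2⌋ = ((h / 2 : ℕ) : ℤ) := by
  rw [Int.floor_eq_iff]
  have h1 : 2 * (h / 2) ≤ h := by omega
  have h2 : h < 2 * (h / 2) + 2 := by omega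
  have h1' : (2 * (h / 2 : ℕ) : ℝ) ≤ h := by exact_mod_cast h1
  have h2' : (h : ℝ) < 2 * (h / 2 : ℕ) + 2 := by exact_mod_cast h2
  rw [Int.cast_natCast]
  constructor <;> linarith

theorem encodeSet_empty {pos : ℕ → ℤ} : encodeSet l pos ∅ = 0 := encode_empty

theorem encodeSet_erase {pos : ℕ → ℤ} {S : Finset ℕ} {p : ℕ} (hp : p ∈ S) :
    encodeSet l pos (S.erase p) = encodeSet l pos S - place l (pos p) := by
  rw [encodeSet, encode_erase hp]
  simp

theorem encodeSet_insert {pos : ℕ → ℤ} {S : Finset ℕ} {p : ℕ} (hp : p ∉ S) :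
    encodeSet l pos (insert p S) = encodeSet l pos S + place l (pos p) := by
  rw [encodeSet, encode_insert hp]
  simp

theorem encodeSet_union {pos : ℕ → ℤ} {S T : Finset ℕ} (h : Disjoint S T) :
    encodeSet l pos (S ∪ T) = encodeSet l pos S + encodeSet l pos T :=
  encode_union h

theorem encodeSet_filter_erase {pos : ℕ → ℤ} {S : Finset ℕ} {p : ℕ} (hp : p ∈ S) (f : ℕ → ℕ)
    (x : ℕ) : encodeSet l pos ((S.erase p).filter fun r => f r = x) =
      encodeSet l pos (S.filter fun r => f r = x) - if x = f p then place l (pos p) else 0 := by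
  rw [Finset.filter_erase]
  split_ifs with h
  · rw [encodeSet_erase (by simp [hp, h])]
  · rw [Finset.erase_eq_of_notMem (by simp [Ne.symm h]), sub_zero]

theorem encodeSet_filter_insert {pos : ℕ → ℤ} {S : Finset ℕ} {p : ℕ} (hp : p ∉ S) (f : ℕ → ℕ)
    (x : ℕ) : encodeSet l pos ((insert p S).filter fun r => f r = x) =
      encodeSet l pos (S.filter fun r => f r = x) + if x = f p then place l (pos p) else 0 := by
  rw [Finset.filter_insert]
  split_ifs with h h' h'
  · rw [encodeSet_insert (by simp [hp])]
  · exact absurd h.symm h'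
  · exact absurd h'.symm h
  · rw [add_zero]

theorem encodeSet_pos_iff {pos : ℕ → ℤ} {S : Finset ℕ} :
    0 < encodeSet l pos S ↔ S.Nonempty := encode_pos_iff fun _ _ => le_rfl

theorem encodeSet_lead (hl : 0 < l) (h3 : 3 ≤ Real.exp l) {S : Finset ℕ} (hS : S.Nonempty) :
    ∃ p ∈ S, 0 < encodeSet l (↑) S ∧ ⌊Real.log (encodeSet l (↑) S) / l⌋ = -p := by
  obtain ⟨p, hp, _, h1, h2, _⟩ := encode_lead (l := l) (pos := (↑)) (f := fun _ => 1) hl hS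
    (Nat.cast_injective.injOn) (d := 1) (by norm_num; linarith) (fun _ _ => le_rfl)
    (fun _ _ => le_rfl)
  exact ⟨p, hp, h1, h2⟩

theorem wp_load (hR : Rep D l st s a) (hI : Inv D a) (hW : Fits D B W) (hl : 0 < l)
    (h3 : 3 ≤ Real.exp l) (hf : a.front.Nonempty) :
    Wp W loadProg s fun r => ∃ h ∈ a.front, Rep D l st r a ∧ Loaded r a h := by
  obtain ⟨h, hh, hpos, hlead⟩ := encodeSet_lead hl h3 hf
  obtain ⟨hha, -, -⟩ := hI.front_mem h hh
  have hm := (hI.arcs_lt h hha).1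
  unfold Fits at hW
  have hlab := hR.label h hha
  have hlab' := hR.label _ (hI.arcs_opp h hha).1
  have hopp : 4 * ((h : ℤ) / 2) + 1 - h = opp h := by unfold opp; omega
  have habs : |(h : ℤ) / 2| = h / 2 := abs_of_nonneg (by omega)
  simp [loadProg, hR.front, hR.base, hlead, hpos, hl.ne', floor_half, abs_le, habs, hopp, hlab,
    hlab']
  refine ⟨by omega, by omega, by omega, by omega, by omega, by omega, by omega, by omega,
    h, hh, { hR with }, ⟨?_, ?_, ?_, ?_⟩⟩ <;> simp

theorem indicator_le_zero {c : Prop} [Decidable c] : (if c then (1 : ℤ) else 0) ≤ 0 ↔ ¬ c := by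
  split_ifs <;> simp [*]

theorem card_ball_add_card_shell_le (hI : Inv D a) :
    a.ball.card + a.shell.card ≤ 2 * D.g * D.n := by
  have hdisj : Disjoint a.ball a.shell :=
    Finset.disjoint_right.2 fun x hx => (hI.shell_mem x hx).2
  rw [← Finset.card_union_of_disjoint hdisj]
  rcases (a.ball ∪ a.shell).eq_empty_or_nonempty with h0 | ⟨x, hx⟩
  · simp [h0]
  · have h1 : a.ball ∪ a.shell ⊆ Finset.Ico 1 a.fresh := fun x hx => by
      obtain ⟨h, hh, rfl⟩ := hI.ball_label x hx
      have := hI.label_mem h (.inr hh)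
      have := hI.base_le
      simp; omega
    have h2 := Finset.card_le_card h1
    have h3 := Finset.mem_Ico.1 (h1 hx)
    have h4 := hI.fresh_le (by omega)
    rw [Nat.card_Ico] at h2
    omega

theorem wp_visit {h : ℕ} (hR : Rep D l st s a) (hL : Loaded s a h) (hI : Inv D a)
    (hW : Fits D B W) (hh : h ∈ a.front) :
    Wp W visitProg s fun r => ∃ a', Rep D l st r a' ∧ Loaded r a' h ∧ Inv D a' ∧
      (a' = a ∨ a' = { a with
        shell := insert (a.label (opp h)) a.shell
        out := insert (h / 2) a.out }) ∧
      (a'.label (opp h) ∈ a'.removed ∨ a'.label (opp h) ∈ a'.ball ∪ a'.shell) := by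
  unfold Fits at hW
  have hc := card_ball_add_card_shell_le hI
  have hv := hR.visited_le (a.label (opp h))
  have hv' := hR.visited (a.label (opp h))
  have hhalf := hL.half
  have hnear := hL.near
  simp [visitProg, hL.far, hL.edge, hR.removed, hR.stamp, hR.count, hR.shell, hR.adj, abs_le,
    indicator_le_zero]
  refine ⟨by omega, ?_, ?_⟩
  · intro hx hlt
    have hy : a.label (opp h) ∉ a.ball ∪ a.shell := fun h => hlt.ne (hv'.2 h)
    have hys : a.label (opp h) ∉ a.shell := fun h => hy (Finset.mem_union_right _ h)
    refine ⟨by omega, by omega, by omega, by omega, by omega, by omega, by omega, by omega, _, ?_,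
      ?_, hI.visit hh hx hy,
      Or.inr rfl, ?_⟩
    · refine { hR with
        count := ?_, out := ?_, visited_le := ?_, visited := ?_, shell := ?_ }
      · simp [Finset.card_insert_of_notMem hys]
      · intro i
        have := hR.out i
        by_cases hi : (i : ℤ) = (h : ℤ) / 2
        · have hi' : i = h / 2 := by omega
          simp [hi']
        · have hi' : i ≠ h / 2 := by omega
          simpa [hi, hi'] using this
      · intro x
        have := hR.visited_le x
        by_cases hx : x = a.label (opp h) <;> simp [hx, this]
      · intro x
        have := hR.visited x
        by_cases hx : x = a.label (opp h)
        · simp [hx]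
        · simpa [hx] using this
      · simp only [storeInt_real, storeReal_real, and_self, if_true]
        rw [← encodeSet_union]
        · congr 1
          ext p
          simp only [Finset.mem_union, Finset.mem_filter, Finset.mem_insert]
          tauto
        · rw [Finset.disjoint_filter]
          rintro p _ hp hp'
          exact hys (hp' ▸ hp)
    · exact ⟨by simpa using hhalf, by simpa using hL.edge, by simpa using hnear,
        by simpa using hL.far⟩
    · simp
  · intro hx
    refine ⟨a, hR, hL, hI, Or.inl rfl, ?_⟩
    by_cases h1 : a.label (opp h) ∈ a.removed
    · exact Or.inl h1
    · simpa using Or.inr (hv'.1 (le_antisymm hv (hx h1)))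

theorem relabel_congr {a a' : St} (h1 : a'.label = a.label) (h2 : a'.removed = a.removed)
    (h3 : ∀ x ∈ a.removed, a'.group x = a.group x) : a'.relabel = a.relabel := by
  funext p
  unfold St.relabel
  rw [h1, h2]
  split_ifs with h
  · exact h3 _ h
  · rfl

theorem wp_attach {h : ℕ} (hR : Rep D l st s a) (hL : Loaded s a h) (hI : Inv D a)
    (hW : Fits D B W) (hh : h ∈ a.front) :
    Wp W attachProg s fun r => ∃ a', Rep D l st r a' ∧ Loaded r a' h ∧ Inv D a' ∧
      (a' = a ∨ a' = { a with
        grouped := insert (a.label h) a.grouped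
        group := Function.update a.group (a.label h) (a.group (a.label (opp h)))
        out := insert (h / 2) a.out }) ∧
      a'.label h ∈ a'.grouped := by
  unfold Fits at hW
  have hg := hI.group_iff (a.label h)
  have hhalf := hL.half
  have hnear := hL.near
  simp [attachProg, hL.far, hL.near, hL.edge, hR.group]
  refine ⟨by omega, ?_, ?_⟩
  · intro hx
    have hxg : a.label h ∉ a.grouped := fun h => hg.2 h hx
    have hrel : ∀ x ∈ a.removed,
        Function.update a.group (a.label h) (a.group (a.label (opp h))) x = a.group x :=
      fun x hxr => Function.update_of_ne (fun he => hxg (hI.removed_sub (by rwa [he] at hxr))) _ _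
    refine ⟨by omega, by omega, by omega, by omega, _, ?_, ?_, hI.attach hh hxg,
      Or.inr rfl, ?_⟩
    · refine { hR with out := ?_, group := ?_, rest := ?_, ahead := ?_ }
      · intro i
        have := hR.out i
        by_cases hi : (i : ℤ) = (h : ℤ) / 2
        · have hi' : i = h / 2 := by omega
          simp [hi']
        · have hi' : i ≠ h / 2 := by omega
          simpa [hi, hi'] using this
      · intro x
        have := hR.group x
        by_cases hx : x = a.label h
        · simp [hx]
        · simpa [hx] using this
      · rw [relabel_congr (a := a) (by rfl) (by rfl) (by exact hrel)]
        exact hR.rest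
      · rw [relabel_congr (a := a) (by rfl) (by rfl) (by exact hrel)]
        exact hR.ahead
    · exact ⟨by simpa using hhalf, by simpa using hL.edge, by simpa using hnear,
        by simpa using hL.far⟩
    · simp
  · intro hx
    exact ⟨a, hR, hL, hI, Or.inl rfl, hg.1 hx⟩

theorem wp_merge {h : ℕ} (hR : Rep D l st s a) (hL : Loaded s a h) (hI : Inv D a)
    (hW : Fits D B W) (hh : h ∈ a.front) (hx : a.label h ∈ a.grouped) :
    Wp W mergeProg s fun r => Rep D l st r { a with
      front := a.front.erase h
      removed := insert (a.label h) a.removed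
      scanned := insert h a.scanned } := by
  unfold Fits at hW
  obtain ⟨hl1, hl2⟩ := hI.live_arcs hh
  obtain ⟨hha, hhb, hhs⟩ := hI.front_mem h hh
  have hc := hI.group_mem h hl1 hx
  have hxb := hI.label_mem h (.inr hha)
  have hgr := hR.group (a.label h)
  have hhalf := hL.half
  have hnear := hL.near
  generalize hxdef : a.label h = x at *
  generalize hcdef : a.group x = c at *
  have hcx : c ≠ x := by omega
  have hfr := hI.fresh_le (by omega)
  have hrel : ∀ p ∈ halves a.todo, St.relabel { a with
      front := a.front.erase h
      removed := insert x a.removed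
      scanned := insert h a.scanned } p = if a.relabel p = x then c else a.relabel p := by
    intro p hp
    replace hp := mem_halves.1 hp
    unfold St.relabel
    dsimp only
    by_cases h1 : a.label p = x
    · by_cases h2 : x ∈ a.removed
      · simp [h1, h2, hcdef]
      · simp [h1, h2, hcdef]
    · by_cases h2 : a.label p ∈ a.removed
      · have h3 := (hI.group_mem p (.inl hp) (hI.removed_sub h2)).1
        have h4 : a.group (a.label p) ≠ x := by omega
        simp [h2, h4]
      · simp [h1, h2]
  have habs : |(c : ℤ) - x| ≤ W := abs_le.2 ⟨by omega, by omega⟩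
  simp [mergeProg, hhalf, hnear, hgr, hR.front, hR.base, hR.rest, hR.ahead]
  (repeat' apply And.intro) <;> try first | omega | exact habs
  refine { hR with removed := ?_, rest := ?_, front := ?_, ahead := ?_ }
  · intro y
    have := hR.removed y
    by_cases hyx : y = x
    · simp [hyx]
    · simpa [hyx] using this
  · rw [encode_replace hrel]
    simp
  · dsimp only
    rw [encodeSet_erase hh]
    simp [place]
  · intro y
    have hay := hR.ahead y
    have hfilter : (halves a.todo).filter (fun p => St.relabel { a with
        front := a.front.erase h
        removed := insert x a.removed
        scanned := insert h a.scanned } p = y) = (halves a.todo).filter fun p =>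
          (if a.relabel p = x then c else a.relabel p) = y :=
      Finset.filter_congr fun p hp => by rw [hrel p hp]
    dsimp only at hfilter ⊢
    rw [hfilter]
    by_cases hyx : y = x
    · have : (halves a.todo).filter (fun p =>
          (if a.relabel p = x then c else a.relabel p) = y) = ∅ := by
        refine Finset.filter_false_of_mem fun p _ => ?_
        split_ifs <;> omega
      rw [this, encodeSet_empty]
      simp [hyx]
    · by_cases hyc : y = c
      · have : (halves a.todo).filter (fun p =>
            (if a.relabel p = x then c else a.relabel p) = y) =
            (halves a.todo).filter (fun p => a.relabel p = c) ∪
              (halves a.todo).filter (fun p => a.relabel p = x) := by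
          ext p
          simp only [Finset.mem_filter, Finset.mem_union, ← and_or_left]
          refine and_congr_right fun _ => ?_
          split_ifs <;> omega
        rw [this, encodeSet_union]
        · simp [hyc, hcx]
        · rw [Finset.disjoint_filter]
          intro p _ h1
          omega
      · have : (halves a.todo).filter (fun p =>
            (if a.relabel p = x then c else a.relabel p) = y) =
            (halves a.todo).filter (fun p => a.relabel p = y) := by
          refine Finset.filter_congr fun p _ => ?_
          split_ifs <;> omega
        rw [this]
        simpa [hyx, hyc] using hay

theorem wp_expand (hR : Rep D l st s a) (hI : Inv D a) (hW : Fits D B W) :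
    Wp W expandProg s fun r => Rep D l st r { a with
      ball := a.ball ∪ a.shell, shell := ∅, depth := a.depth + 1
      front := a.arcs.filter fun p => a.label p ∈ a.shell } := by
  unfold Fits at hW
  have hc := card_ball_add_card_shell_le hI
  have hdisj : Disjoint a.ball a.shell :=
    Finset.disjoint_right.2 fun x hx => (hI.shell_mem x hx).2
  have habs : |(a.ball.card : ℤ) + a.shell.card| ≤ W := abs_le.2 ⟨by omega, by omega⟩
  simp [expandProg, hR.shell, hR.size, hR.count]
  (repeat' apply And.intro) <;> try first | omega | exact habs
  refine { hR with size := ?_, count := ?_, visited := ?_, front := ?_, shell := ?_ }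
  · simp [Finset.card_union_of_disjoint hdisj]
  · simp
  · simpa using hR.visited
  · simp
  · simp [encodeSet_empty]

theorem wp_absorb (hR : Rep D l st s a) (hW : Fits D B W) (hst : st ≤ 4 * D.m + 10) :
    Wp W absorbProg s fun r => Rep D l (st + 1) r { a with ball := ∅, shell := ∅ } := by
  unfold Fits at hW
  have habs : |(st : ℤ) + 1| ≤ W := abs_le.2 ⟨by omega, by omega⟩
  simp [absorbProg, hR.stamp]
  (repeat' apply And.intro) <;> try first | omega | exact habs
  refine { hR with
    stamp := ?_, size := ?_, count := ?_, visited_le := ?_, visited := ?_, shell := ?_ }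
  · simp
  · simp
  · simp
  · intro x
    have := hR.visited_le x
    simp
    omega
  · intro x
    have := hR.visited_le x
    simp
    omega
  · simp [encodeSet_empty]

theorem key_ediv {p : ℕ} (hp : p / 2 < D.m) : key D p / (2 * D.m) = D.sc (p / 2) := by
  unfold key
  have h1 : (0 : ℤ) < 2 * D.m := by omega
  rw [add_comm, Int.add_mul_ediv_left _ _ h1.ne', Int.ediv_eq_zero_of_lt (by omega) (by omega),
    zero_add]

theorem key_injOn (D : Setup) {p q : ℕ} (hp : p / 2 < D.m) (hq : q / 2 < D.m)
    (h : key D p = key D q) : p = q := by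
  have h1 := key_ediv hp
  have h2 := key_ediv hq
  rw [h, h2] at h1
  unfold key at h
  rw [h1] at h
  omega

theorem floor_div_intCast {q : ℤ} {d : ℕ} (hd : 0 < d) :
    ⌊(q : ℝ) / (2 * (d : ℝ))⌋ = q / (2 * d) := by
  have h1 : (0 : ℝ) < 2 * d := by positivity
  have h2 : (0 : ℤ) < 2 * d := by omega
  rw [Int.floor_eq_iff, le_div_iff₀ h1, div_lt_iff₀ h1]
  constructor
  · exact_mod_cast Int.ediv_mul_le q h2.ne'
  · exact_mod_cast Int.lt_ediv_add_one_mul_self q h2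

theorem mem_halves_lt (hI : Inv D a) {p : ℕ} (hp : p ∈ halves a.todo) : p / 2 < D.m :=
  hI.todo_lt _ (mem_halves.1 hp)

theorem relabel_mem (hI : Inv D a) {p : ℕ} (hp : p ∈ halves a.todo) :
    1 ≤ a.relabel p ∧ a.relabel p ≤ 2 * D.g * D.n := by
  have h1 := hI.label_mem p (.inl (mem_halves.1 hp))
  have h2 := hI.base_le
  have h3 := hI.fresh_le (by omega)
  unfold St.relabel
  split_ifs with h
  · have := hI.group_mem p (.inl (mem_halves.1 hp)) (hI.removed_sub h)
    omega
  · omega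

theorem wp_peek (hR : Rep D l st s a) (hI : Inv D a) (hW : Fits D B W) (hl : 0 < l)
    (hexp : ((2 * D.g * D.n : ℕ) : ℝ) + 3 ≤ Real.exp l) (hB : ∀ i < D.m, |D.sc i| ≤ B)
    (hsc : |a.scale| ≤ B) :
    Wp W peekProg s fun r => Rep D l st r a ∧ ((a.todo = ∅ ∧ a.scale < r.int 0 16) ∨
      ∃ i ∈ a.todo, (∀ p ∈ halves a.todo, key D (2 * i) ≤ key D p) ∧
        r.int 0 15 = key D (2 * i) ∧ r.int 0 16 = D.sc i) := by
  unfold Fits at hW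
  rcases (halves a.todo).eq_empty_or_nonempty with h0 | h0
  · have ht : a.todo = ∅ := by
      refine Finset.eq_empty_of_forall_notMem fun i hi => ?_
      have : 2 * i ∈ halves a.todo := mem_halves.2 (by simpa using hi)
      simp [h0] at this
    have habs : |a.scale + 1| ≤ W := by
      rw [abs_le] at hsc ⊢
      omega
    have h1 : s.real 0 3 = 0 := by rw [hR.rest, h0, encode_empty]
    simp [peekProg, h1, hR.scale, ht]
    (repeat' apply And.intro) <;> try first | omega | exact habs
    exact { hR with }
  · obtain ⟨p, hp, hmin, hpos, hlead, -⟩ := encode_lead (pos := key D) (f := a.relabel) hl h0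
      (fun p hp q hq h => key_injOn D (mem_halves_lt hI hp) (mem_halves_lt hI hq) h)
      (d := 2 * D.g * D.n) (by linarith) (fun p hp => (relabel_mem hI hp).1)
      (fun p hp => (relabel_mem hI hp).2)
    have hpm := mem_halves_lt hI hp
    obtain ⟨i, rfl | rfl⟩ : ∃ i, p = 2 * i ∨ p = 2 * i + 1 := ⟨p / 2, by omega⟩
    swap
    · have hi : (2 * i + 1) / 2 = i := by omega
      have hi' : (2 * i) / 2 = i := by omega
      have h1 : 2 * i ∈ halves a.todo := by
        rw [mem_halves] at hp ⊢
        rwa [hi', ← hi]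
      have h2 := hmin _ h1
      unfold key at h2
      rw [hi, hi'] at h2
      push_cast at h2
      omega
    have hi : (2 * i) / 2 = i := by omega
    have hdiv := key_ediv hpm
    have hm : D.m ≠ 0 := by omega
    have hfl : ⌊(key D (2 * i) : ℝ) / (2 * (D.m : ℝ))⌋ = D.sc i := by
      rw [floor_div_intCast (by omega), hdiv, hi]
    rw [hi] at hpm
    have hscB := hB i hpm
    have hmB : |(D.m : ℤ) * D.sc i| ≤ D.m * B := by
      rw [abs_mul, Nat.abs_cast]
      gcongr
    have hkey : |key D (2 * i)| ≤ W := by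
      unfold key
      rw [hi, abs_le]
      rw [abs_le] at hmB
      push_cast
      constructor <;> nlinarith
    have hscW : |D.sc i| ≤ W := by
      rw [abs_le] at hscB ⊢
      omega
    have hti := mem_halves.1 hp
    rw [hi] at hti
    have hl' := hl.ne'
    simp only [peekProg, Wp, posTest, Test.Ok, Test.Holds, IExpr.Ok, RExpr.Ok, IExpr.eval,
      RExpr.eval, leadExpr, storeInt_int, hR.rest, hR.base, hlead, hR.m]
    simp [hpos, hl', hm, hfl, hkey, hscW]
    (repeat' apply And.intro) <;> try omega
    · exact { hR with }
    · exact Or.inr ⟨i, hti, hmin, rfl, rfl⟩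

end


section

variable {D : Setup} {l : ℝ} {st B W : ℕ} {s : State} {a : St}

theorem wp_start (hR : Rep D l st s a) (hI : Inv D a) (hW : Fits D B W) (hl : 0 < l)
    (h3 : 3 ≤ Real.exp l) (hr : a.roots.Nonempty) (hb : a.ball = ∅)
    (hs : a.shell = ∅) :
    Wp W startProg s fun r => ∃ h ∈ a.roots,
      (a.label h ∈ a.removed ∧ Rep D l st r { a with roots := a.roots.erase h }) ∨
      (a.label h ∉ a.removed ∧ Rep D l st r { a with
        roots := a.roots.erase h, ball := {a.label h}, depth := 0, root := D.ep h
        front := a.arcs.filter fun p => a.label p = a.label h }) := by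
  obtain ⟨h, hh, hpos, hlead⟩ := encodeSet_lead hl h3 hr
  have hha := hI.roots_sub hh
  have hm := (hI.arcs_lt h hha).1
  unfold Fits at hW
  have hlab := hR.label h hha
  have hrem := hR.removed (a.label h)
  have herase : encodeSet l (↑) a.roots - Real.exp (-(l * h)) =
      encodeSet l (↑) (a.roots.erase h) := by
    rw [encodeSet_erase hh]
    simp [place]
  have hl' := hl.ne'
  have hhW : h ≤ W := by omega
  simp [startProg, hR.roots, hR.base, hlead, hpos, hl', hlab, hrem, indicator_le_zero, hhW, herase]
  refine ⟨by omega, by omega, by omega, by omega, by omega, by omega, by omega, ?_, ?_⟩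
  · intro hx
    refine ⟨by omega, by omega, by omega, by omega, by omega, by omega, h, hh, Or.inr ⟨hx, ?_⟩⟩
    refine { hR with
      size := ?_, visited_le := ?_, visited := ?_, front := ?_, shell := ?_, roots := ?_ }
    · simp
    · intro y
      have := hR.visited_le y
      by_cases hyx : y = a.label h <;> simp [hyx, hR.stamp, hR.visited_le]
    · intro y
      have := lt_of_le_of_ne (hR.visited_le y) fun h => by simpa [hb, hs] using (hR.visited y).1 h
      by_cases hyx : y = a.label h
      · simp [hyx, hR.stamp]
      · simp [hyx, hs]
        omega
    · simp [hR.adj]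
    · simp [hR.shell]
    · simp
  · intro hx
    refine ⟨h, hh, Or.inl ⟨hx, ?_⟩⟩
    refine { hR with roots := ?_ }
    simp

/-- The registers that describe the edge `i` being collected. -/
structure Next (D : Setup) (s : State) (a : St) (i : ℕ) : Prop where
  half : s.int 0 10 = (2 * i : ℕ)
  edge : s.int 0 11 = i
  near : s.int 0 12 = a.label (2 * i)
  far : s.int 0 13 = a.label (2 * i + 1)
  key : s.int 0 15 = key D (2 * i)

theorem key_succ (D : Setup) (i : ℕ) : key D (2 * i + 1) = key D (2 * i) + 1 := by
  unfold key
  rw [show (2 * i + 1) / 2 = i by omega, show 2 * i / 2 = i by omega]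
  push_cast
  ring

theorem two_mul_mem_halves {T : Finset ℕ} {i : ℕ} : 2 * i ∈ halves T ↔ i ∈ T := by
  rw [mem_halves, show 2 * i / 2 = i by omega]

theorem two_mul_add_one_mem_halves {T : Finset ℕ} {i : ℕ} : 2 * i + 1 ∈ halves T ↔ i ∈ T := by
  rw [mem_halves, show (2 * i + 1) / 2 = i by omega]

theorem halves_erase {T : Finset ℕ} {i : ℕ} :
    halves (T.erase i) = ((halves T).erase (2 * i)).erase (2 * i + 1) := by
  ext p
  simp only [mem_halves, Finset.mem_erase]
  rw [← and_assoc]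
  refine and_congr_left fun _ => ?_
  omega

theorem relabel_of_collecting (hI : Inv D a) {i : ℕ} (hi : i ∈ a.todo) (hsc : D.sc i = a.scale)
    {p : ℕ} (hp : p ∈ halves a.todo) : a.relabel p = a.label p :=
  if_neg ((hI.collecting i hi hsc).2.2 p (.inl (mem_halves.1 hp))).1

/-- Both halves of the next edge are read off the word of all clusters. -/
theorem wp_next {j : ℤ} (hR : Rep D l st s { a with scale := j }) (hI : Inv D a)
    (hW : Fits D B W) (hl : 0 < l)
    (hexp : ((2 * D.g * D.n : ℕ) : ℝ) + 3 ≤ Real.exp l) (hB : ∀ i < D.m, |D.sc i| ≤ B)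
    {i : ℕ} (hi : i ∈ a.todo) (hsc : D.sc i = a.scale)
    (hmin : ∀ p ∈ halves a.todo, key D (2 * i) ≤ key D p)
    (h15 : s.int 0 15 = key D (2 * i)) (h16 : s.int 0 16 = D.sc i) :
    Wp W nextProg s fun r => Rep D l st r a ∧ Next D r a i := by
  have hinj : Set.InjOn (key D) (halves a.todo) := fun p hp q hq h =>
    key_injOn D (mem_halves_lt hI hp) (mem_halves_lt hI hq) h
  have hmem := two_mul_mem_halves.2 hi
  have hmem' : 2 * i + 1 ∈ (halves a.todo).erase (2 * i) :=
    Finset.mem_erase.2 ⟨by omega, two_mul_add_one_mem_halves.2 hi⟩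
  have hd : (((2 * D.g * D.n : ℕ) : ℝ) + 2 ≤ Real.exp l) := by linarith
  obtain ⟨p, hp, hpmin, -, -, hdig⟩ := encode_lead (f := a.relabel) hl ⟨_, hmem⟩ hinj hd
    (fun p hp => (relabel_mem hI hp).1) (fun p hp => (relabel_mem hI hp).2)
  obtain rfl : p = 2 * i := hinj hp hmem (le_antisymm (hpmin _ hmem) (hmin _ hp))
  obtain ⟨q, hq, hqmin, -, -, hdig'⟩ := encode_lead (S := (halves a.todo).erase (2 * i))
    (f := a.relabel) hl ⟨_, hmem'⟩ (hinj.mono fun _ => Finset.mem_of_mem_erase) hd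
    (fun p hp => (relabel_mem hI (Finset.mem_of_mem_erase hp)).1)
    (fun p hp => (relabel_mem hI (Finset.mem_of_mem_erase hp)).2)
  obtain ⟨hq1, hq2⟩ := Finset.mem_erase.1 hq
  obtain rfl : q = 2 * i + 1 := by
    refine hinj hq2 (Finset.mem_of_mem_erase hmem') (le_antisymm (hqmin _ hmem') ?_)
    rw [key_succ]
    exact lt_of_le_of_ne (hmin _ hq2) fun h => hq1 (hinj hq2 hmem h.symm)
  rw [encode_erase hmem] at hdig'
  rw [key_succ] at hdig'
  have hlt1 := relabel_mem hI hmem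
  have hlt2 := relabel_mem hI (Finset.mem_of_mem_erase hmem')
  rw [relabel_of_collecting hI hi hsc hmem] at hdig hdig' hlt1
  rw [relabel_of_collecting hI hi hsc (Finset.mem_of_mem_erase hmem')] at hdig' hlt2
  have him := hI.todo_lt i hi
  unfold Fits at hW
  have hscB := hB i him
  have hmB : |(D.m : ℤ) * D.sc i| ≤ D.m * B := by
    rw [abs_mul, Nat.abs_cast]
    gcongr
  have hkeq : key D (2 * i) - 2 * D.m * D.sc i = 2 * i := by
    unfold key
    rw [show 2 * i / 2 = i by omega]
    push_cast
    ring
  rw [abs_le] at hmB hscB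
  have hkey : |key D (2 * i) + 1| ≤ W := by
    rw [show key D (2 * i) + 1 = 2 * ((D.m : ℤ) * D.sc i) + 2 * i + 1 by linarith, abs_le]
    constructor <;> nlinarith
  have hprod : |2 * (D.m : ℤ) * D.sc i| ≤ W := by
    rw [mul_assoc, abs_le]
    constructor <;> nlinarith
  have hprod : 2 * (D.m : ℤ) * |D.sc i| ≤ W := by
    rwa [abs_mul, abs_of_nonneg (by omega : (0 : ℤ) ≤ 2 * D.m)] at hprod
  unfold place at hdig'
  push_cast at hdig'
  simp only [nextProg, Wp, IExpr.Ok, RExpr.Ok, IExpr.eval, RExpr.eval, halfExpr, digitExpr,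
    placeExpr, storeInt_int, storeInt_real]
  have hrest : s.real 0 3 = encode l (key D) (halves a.todo) a.relabel := hR.rest
  simp [h15, h16, hR.m, hrest, hR.base, hdig, hdig', hkeq, hprod, hkey]
  (repeat' apply And.intro) <;> try omega
  · refine { hR with scale := ?_ }
    simp [hsc]
  · constructor <;> simp [h15]

theorem wp_match (hR : Rep D l st s a) (hI : Inv D a) {i : ℕ} (hN : Next D s a i)
    (hW : Fits D B W) (hi : i ∈ a.todo) (hsc : D.sc i = a.scale) :
    Wp W matchProg s fun r => ∃ a', Rep D l st r a' ∧ Inv D a' ∧ Next D r a' i ∧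
      (a'.label (2 * i) ≠ a'.label (2 * i + 1) →
        a'.label (2 * i) ∈ a'.matched ∨ a'.label (2 * i + 1) ∈ a'.matched) ∧
      a'.todo = a.todo ∧ a'.roots = a.roots ∧ a'.scanned = a.scanned ∧ a'.shell = a.shell ∧
      a'.scale = a.scale := by
  unfold Fits at hW
  have hmem := two_mul_mem_halves.2 hi
  have hmem' := two_mul_add_one_mem_halves.2 hi
  have hlt1 := relabel_mem hI hmem
  have hlt2 := relabel_mem hI hmem'
  rw [relabel_of_collecting hI hi hsc hmem] at hlt1
  rw [relabel_of_collecting hI hi hsc hmem'] at hlt2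
  obtain ⟨hball, hshell, hcoll⟩ := hI.collecting i hi hsc
  have hca := hcoll (2 * i) (.inl (mem_halves.1 hmem))
  have hcb := hcoll (2 * i + 1) (.inl (mem_halves.1 hmem'))
  have hga := hI.group_iff (a.label (2 * i))
  have hgb := hI.group_iff (a.label (2 * i + 1))
  have hlm := hI.label_mem (2 * i) (.inl (mem_halves.1 hmem))
  have hbf := hI.base_le
  have hfr := hI.fresh_le (by omega)
  have hfW : |(a.fresh : ℤ) + 1| ≤ W := abs_le.2 ⟨by omega, by omega⟩
  have hhalf := hN.half
  have hkey := hN.key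
  have hnear := hN.near
  have hfar := hN.far
  simp [matchProg, hN.near, hN.far, hN.edge, hR.group, hR.fresh]
  refine ⟨by omega, ?_, ?_⟩
  · intro hle hxa hxb
    have hne : a.label (2 * i) ≠ a.label (2 * i + 1) := fun h => (hle h.le).ne h
    have hxa' : a.label (2 * i) ∉ a.grouped := fun h => hga.2 h hxa
    have hxb' : a.label (2 * i + 1) ∉ a.grouped := fun h => hgb.2 h hxb
    (repeat' apply And.intro) <;> try first | omega | exact hfW
    refine ⟨_, ?_, hI.matchEdge hi hsc hne hxa' hxb', ?_, fun _ => Or.inl ?_, rfl, rfl, rfl, rfl,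
      rfl⟩
    · have hrel : ∀ x ∈ a.removed, Function.update (Function.update a.group (a.label (2 * i))
          a.fresh) (a.label (2 * i + 1)) a.fresh x = a.group x := by
        intro x hx
        have hxg := hI.removed_sub hx
        rw [Function.update_of_ne, Function.update_of_ne]
        · rintro rfl; exact hxa' hxg
        · rintro rfl; exact hxb' hxg
      refine { hR with fresh := ?_, out := ?_, group := ?_, rest := ?_, ahead := ?_ }
      · simp
      · intro j
        have := hR.out j
        by_cases hji : j = i
        · simp [hji]
        · simpa [hji] using this
      · intro x
        have := hR.group x
        by_cases hx : x = a.label (2 * i + 1)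
        · simp [hx]
        · by_cases hx' : x = a.label (2 * i)
          · simp [hx', Function.update_of_ne hne]
          · simpa [hx, hx', Function.update_of_ne] using this
      · rw [relabel_congr (a := a) (by rfl) (by rfl) (by exact hrel)]
        exact hR.rest
      · rw [relabel_congr (a := a) (by rfl) (by rfl) (by exact hrel)]
        exact hR.ahead
    · exact ⟨by simpa using hhalf, by simpa using hN.edge, by simpa using hnear,
        by simpa using hfar, by simpa using hkey⟩
    · simp
  · intro hle
    refine ⟨a, hR, hI, hN, ?_, rfl, rfl, rfl, rfl, rfl⟩
    intro hne
    by_contra hno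
    push Not at hno
    refine hle ?_ ?_ ?_
    · omega
    · by_contra h0
      exact hno.1 (hca.2 (hga.1 h0))
    · by_contra h0
      exact hno.2 (hcb.2 (hgb.1 h0))

theorem wp_remove (hR : Rep D l st s a) (hI : Inv D a) {i : ℕ} (hN : Next D s a i)
    (hW : Fits D B W) (hi : i ∈ a.todo) (hsc : D.sc i = a.scale)
    (hB : |key D (2 * i) + 1| ≤ W) :
    Wp W removeProg s fun r => Rep D l st r { a with todo := a.todo.erase i } ∧
      Next D r a i ∧ r.int 4 (2 * i : ℕ) = a.label (2 * i) ∧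
      r.int 4 (2 * i + 1 : ℕ) = a.label (2 * i + 1) := by
  unfold Fits at hW
  have him := hI.todo_lt i hi
  have hmem := two_mul_mem_halves.2 hi
  have hmem' := two_mul_add_one_mem_halves.2 hi
  have hmem'' : 2 * i + 1 ∈ (halves a.todo).erase (2 * i) := Finset.mem_erase.2 ⟨by omega, hmem'⟩
  have hrel1 := relabel_of_collecting hI hi hsc hmem
  have hrel2 := relabel_of_collecting hI hi hsc hmem'
  have h2i : |2 * (i : ℤ) + 1| ≤ W := abs_le.2 ⟨by omega, by omega⟩
  have hhalf := hN.half
  simp only [removeProg, Wp, IExpr.Ok, RExpr.Ok, IExpr.eval, RExpr.eval, placeExpr, storeInt_int,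
    storeReal_int, storeReal_real]
  simp [hN.near, hN.far, hN.half, hN.key, hR.rest, hR.base, hR.ahead, hB, h2i]
  (repeat' apply And.intro) <;> try omega
  · refine { hR with label := ?_, rest := ?_, ahead := ?_ }
    · intro h hh
      have h1 := (hI.arcs_lt h hh).2
      have h2 : h ≠ 2 * i := by rintro rfl; exact h1 (by rwa [Nat.mul_div_cancel_left _ two_pos])
      have h3 : h ≠ 2 * i + 1 := by
        rintro rfl; exact h1 (by rwa [show (2 * i + 1) / 2 = i by omega])
      have h2' : (h : ℤ) ≠ 2 * i := by omega
      have h3' : (h : ℤ) ≠ 2 * i + 1 := by omega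
      simpa [h2', h3'] using hR.label h hh
    · have : halves (a.todo.erase i) = _ := halves_erase
      dsimp only
      rw [this, encode_erase hmem'', encode_erase hmem, key_succ]
      change _ = _ - ((a.relabel (2 * i) : ℕ) : ℝ) * _ - ((a.relabel (2 * i + 1) : ℕ) : ℝ) * _
      rw [hrel1, hrel2]
      simp [place]
      rfl
    · intro x
      have : halves (a.todo.erase i) = _ := halves_erase
      dsimp only
      rw [this, encodeSet_filter_erase hmem'', encodeSet_filter_erase hmem, key_succ]
      change _ = encodeSet l (key D) ((halves a.todo).filter fun r => a.relabel r = x) -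
        (if x = a.relabel (2 * i) then _ else _) - (if x = a.relabel (2 * i + 1) then _ else _)
      rw [hrel1, hrel2]
      have hx := hR.ahead x
      simp only [storeInt_real, storeReal_real, Nat.cast_inj, true_and, place, Int.cast_add,
        Int.cast_one]
      split_ifs <;> simp_all
  · exact ⟨by simpa using hhalf, by simpa using hN.edge, by simpa using hN.near,
        by simpa using hN.far, by simpa using hN.key⟩

theorem wp_add (hR : Rep D l st s a) {i : ℕ} (hN : Next D s a i) (hW : Fits D B W) (him : i < D.m)
    (hi : 2 * i ∉ a.arcs) (hi' : 2 * i + 1 ∉ a.arcs) (hroots : a.roots ⊆ a.arcs)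
    (hs : a.shell = ∅)
    (h1 : s.int 4 (2 * i : ℕ) = a.label (2 * i))
    (h2 : s.int 4 (2 * i + 1 : ℕ) = a.label (2 * i + 1)) :
    Wp W addProg s fun r =>
      (a.label (2 * i) = a.label (2 * i + 1) ∧ Rep D l st r a) ∨
      (a.label (2 * i) ≠ a.label (2 * i + 1) ∧ Rep D l st r { a with
        arcs := insert (2 * i) (insert (2 * i + 1) a.arcs)
        roots := insert (2 * i) (insert (2 * i + 1) a.roots) }) := by
  unfold Fits at hW
  have h2i : |2 * (i : ℤ) + 1| ≤ W := abs_le.2 ⟨by omega, by omega⟩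
  have hins : ∀ S : Finset ℕ, 2 * i ∉ S → 2 * i ∉ insert (2 * i + 1) S := by
    intro S hS
    simp [hS]
  simp only [addProg, Wp, IExpr.Ok, RExpr.Ok, IExpr.eval, RExpr.eval, placeExpr,
    storeReal_int, storeReal_real, neTest, Test.Ok, Test.Holds]
  simp [hN.near, hN.far, hN.half, hR.roots, hR.base, hR.adj, h2i]
  refine ⟨by omega, ?_, ?_⟩
  · intro hle
    have hne : a.label (2 * i) ≠ a.label (2 * i + 1) := fun h => (hle h.le).ne h
    (repeat' apply And.intro) <;> try omega
    refine Or.inr ⟨hne, ?_⟩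
    refine { hR with label := ?_, shell := ?_, roots := ?_, adj := ?_ }
    · intro h hh
      simp only [Finset.mem_insert] at hh
      rcases hh with rfl | rfl | hh
      · exact h1
      · exact h2
      · exact hR.label h hh
    · simp [hs, hR.shell]
    · dsimp only
      rw [encodeSet_insert (hins _ fun h => hi (hroots h)),
        encodeSet_insert fun h => hi' (hroots h)]
      simp [place]
      ring
    · intro x
      dsimp only
      rw [encodeSet_filter_insert (hins _ hi), encodeSet_filter_insert hi']
      have hx := hR.adj x
      simp only [storeReal_real, Nat.cast_inj, true_and, place]
      split_ifs <;> simp_all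
  · intro h1 h2
    have := le_antisymm h1 h2
    exact Or.inl ⟨this, hR⟩

end

section

variable {D : Setup} {l : ℝ} {st B W : ℕ} {s : State} {a : St}

theorem wp_scan (hR : Rep D l st s a) (hI : Inv D a) (hW : Fits D B W) (hl : 0 < l)
    (h3 : 3 ≤ Real.exp l) (hf : a.front.Nonempty) :
    Wp W scanProg s fun r => ∃ a', Rep D l st r a' ∧ Inv D a' ∧
      a'.scanned.card = a.scanned.card + 1 ∧ a'.roots = a.roots ∧ a'.todo = a.todo ∧
      a'.scale = a.scale := by
  refine Wp.seq (wp_load hR hI hW hl h3 hf) ?_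
  rintro r₁ ⟨h, hh, hR₁, hL₁⟩
  have hnot : h ∉ a.scanned := fun hs => (hI.scanned_mem h hs).2.1 hh
  refine Wp.seq (wp_visit hR₁ hL₁ hI hW hh) ?_
  rintro r₂ ⟨a₂, hR₂, hL₂, hI₂, ha₂, hy₂⟩
  have hh₂ : h ∈ a₂.front := by rcases ha₂ with rfl | rfl <;> exact hh
  refine Wp.seq (wp_attach hR₂ hL₂ hI₂ hW hh₂) ?_
  rintro r₃ ⟨a₃, hR₃, hL₃, hI₃, ha₃, hx₃⟩
  have hh₃ : h ∈ a₃.front := by rcases ha₃ with rfl | rfl <;> exact hh₂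
  have hy₃ : a₃.label (opp h) ∈ a₃.removed ∨ a₃.label (opp h) ∈ a₃.ball ∪ a₃.shell := by
    rcases ha₃ with rfl | rfl <;> exact hy₂
  refine (wp_merge hR₃ hL₃ hI₃ hW hh₃ hx₃).mono ?_
  intro r₄ hR₄
  refine ⟨_, hR₄, hI₃.scan hh₃ hx₃ hy₃, ?_, ?_, ?_, ?_⟩
  · have : a₃.scanned = a.scanned := by
      rcases ha₃ with rfl | rfl <;> rcases ha₂ with rfl | rfl <;> rfl
    simp [this, hnot]
  all_goals rcases ha₃ with rfl | rfl <;> rcases ha₂ with rfl | rfl <;> rfl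

theorem rep_advance (hR : Rep D l st s a) (hI : Inv D a) {i : ℕ} (hi : i ∈ a.todo)
    (hI' : Inv D (a.advance (D.sc i))) : Rep D l st s (a.advance a.scale) := by
  have hlab : ∀ h ∈ a.arcs, (a.advance a.scale).label h = a.label h := fun h hh =>
    if_neg (hI.arcs_lt h hh).2
  have hrel : ∀ p ∈ halves a.todo, (a.advance a.scale).relabel p = a.relabel p := fun p hp =>
    (relabel_of_collecting hI' (show i ∈ (a.advance (D.sc i)).todo from hi) rfl hp).trans
      (if_pos (mem_halves.1 hp))
  refine { hR with label := ?_, rest := ?_, shell := ?_, ahead := ?_, adj := ?_ }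
  · intro h hh
    rw [hlab h hh]
    exact hR.label h hh
  · rw [hR.rest]
    exact encode_congr fun p hp => (hrel p hp).symm
  · rw [hR.shell]
    exact congrArg (encodeSet l _) (Finset.filter_congr fun p hp => by rw [hlab p hp]; rfl)
  · intro x
    rw [hR.ahead]
    exact congrArg (encodeSet l _) (Finset.filter_congr fun p hp => by rw [hrel p hp])
  · intro x
    rw [hR.adj]
    exact congrArg (encodeSet l _) (Finset.filter_congr fun p hp => by rw [hlab p hp])

theorem sc_le_of_key_le {i j : ℕ} (hi : i < D.m) (hj : j < D.m)
    (h : key D (2 * i) ≤ key D (2 * j)) : D.sc i ≤ D.sc j := by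
  have h1 := key_ediv (D := D) (p := 2 * i) (by omega)
  have h2 := key_ediv (D := D) (p := 2 * j) (by omega)
  rw [Nat.mul_div_cancel_left _ two_pos] at h1 h2
  rw [← h1, ← h2]
  exact Int.ediv_le_ediv (by omega) h

theorem wp_collect (hR : Rep D l st s a) (hI : Inv D a) (hW : Fits D B W) (hl : 0 < l)
    (hexp : ((2 * D.g * D.n : ℕ) : ℝ) + 3 ≤ Real.exp l) (hB : ∀ i < D.m, |D.sc i| ≤ B)
    {i : ℕ} (hi : i ∈ a.todo) (hmin : ∀ p ∈ halves a.todo, key D (2 * i) ≤ key D p)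
    (h15 : s.int 0 15 = key D (2 * i)) (h16 : s.int 0 16 = D.sc i)
    (hf : a.front = ∅) (hb : a.ball = ∅) (hs : a.shell = ∅)
    (hr : a.roots = ∅ ∨ D.sc i ≤ a.scale) :
    Wp W collectProg s fun r => ∃ a', Rep D l st r a' ∧ Inv D a' ∧
      a'.scanned = a.scanned ∧ a'.shell = ∅ ∧ a'.roots.card ≤ a.roots.card + 2 ∧
      a'.todo = a.todo.erase i ∧ a'.scale = D.sc i := by
  have hm := hI.todo_lt i hi
  have hle := hI.le_sc i hi
  -- If a new batch begins, the settled clusters are replaced by their groups.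
  obtain ⟨b, hRb, hIb, hbsc, hbt, hbr, hbs, hbsh⟩ : ∃ b : St,
      Rep D l st s { b with scale := a.scale } ∧ Inv D b ∧ D.sc i = b.scale ∧ b.todo = a.todo ∧
      b.roots = a.roots ∧ b.scanned = a.scanned ∧ b.shell = ∅ := by
    by_cases hlt : a.scale < D.sc i
    · have hr' := hr.resolve_right (by omega)
      have hI' := hI.advance hf hr' hb hs hlt fun j hj =>
        sc_le_of_key_le hm (hI.todo_lt j hj) (hmin _ (two_mul_mem_halves.2 hj))
      exact ⟨_, rep_advance hR hI hi hI', hI', rfl, rfl, rfl, rfl, hs⟩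
    · exact ⟨a, hR, hI, by omega, rfl, rfl, rfl, hs⟩
  rw [← hbt] at hi hmin
  refine Wp.seq (wp_next (a := b) (j := a.scale) hRb hIb hW hl hexp hB hi hbsc hmin h15 h16) ?_
  rintro r₁ ⟨hR₁, hN₁⟩
  refine Wp.seq (wp_match hR₁ hIb hN₁ hW hi hbsc) ?_
  rintro r₂ ⟨c, hR₂, hI₂, hN₂, hmat, hct, hcr, hcs, hcsh, hcsc⟩
  rw [← hct] at hi
  rw [← hcsc] at hbsc
  have hkey : |key D (2 * i) + 1| ≤ W := by
    unfold Fits at hW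
    have hscB := hB i hm
    have hmB : |(D.m : ℤ) * D.sc i| ≤ D.m * B := by
      rw [abs_mul, Nat.abs_cast]
      gcongr
    have h0 : (0 : ℤ) ≤ D.g * D.n := by positivity
    have hk : key D (2 * i) = 2 * ((D.m : ℤ) * D.sc i) + 2 * i := by
      unfold key
      rw [Nat.mul_div_cancel_left _ two_pos]
      push_cast
      ring
    rw [abs_le] at hmB
    rw [hk, abs_le]
    constructor <;> linarith
  refine Wp.seq (wp_remove hR₂ hI₂ hN₂ hW hi hbsc hkey) ?_
  rintro r₃ ⟨hR₃, hN₃, h1, h2⟩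
  have hni : ∀ p, p / 2 = i → p ∉ c.arcs := fun p hp hpa => (hI₂.arcs_lt p hpa).2 (hp ▸ hi)
  refine (wp_add hR₃ ⟨hN₃.half, hN₃.edge, hN₃.near, hN₃.far, hN₃.key⟩ hW hm (hni _ (by omega))
    (hni _ (by omega)) hI₂.roots_sub (hcsh.trans hbsh) h1 h2).mono ?_
  rintro r₄ (⟨he, hR₄⟩ | ⟨hne, hR₄⟩)
  · refine ⟨_, hR₄, hI₂.collectLoop hi hbsc.symm.symm he, hcs.trans hbs, hcsh.trans hbsh, ?_, ?_,
      hbsc.symm⟩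
    · simp [hcr, hbr]
    · simp [hct, hbt]
  · refine ⟨_, hR₄, hI₂.collectEdge hi hbsc hne (hmat hne), hcs.trans hbs, hcsh.trans hbsh, ?_, ?_,
      hbsc.symm⟩
    · have h5 := Finset.card_insert_le (2 * i) (insert (2 * i + 1) c.roots)
      have h6 := Finset.card_insert_le (2 * i + 1) c.roots
      rw [← hbr, ← hcr]
      dsimp only
      omega
    · simp [hct, hbt]

/-- A bound on the number of rounds from a state on. -/
def rounds (D : Setup) (a : St) : ℕ :=
  2 * (2 * D.m - a.scanned.card) + (if a.shell = ∅ then 0 else 1) + a.roots.card +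
    3 * a.todo.card

/-- The memory of a running computation with at most `N` rounds to go. -/
def Running (D : Setup) (l : ℝ) (B N : ℕ) (s : State) : Prop :=
  ∃ st a, Rep D l st s a ∧ Inv D a ∧ |a.scale| ≤ B ∧
    st + a.roots.card + 3 * a.todo.card ≤ 3 * D.m + 1 ∧ rounds D a < N

/-- The memory at the end of the computation. -/
def Finished (D : Setup) (s : State) : Prop :=
  ∃ O : Finset ℕ, (∀ i : ℕ, s.int 3 i ≠ 0 ↔ i ∈ O) ∧ (∀ i ∈ O, i < D.m) ∧
    (∀ i < D.m, Spanned D O i) ∧ (O.card : ℝ) ≤ (2 * D.g * D.n) * (1 + D.τ)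

theorem card_scanned_le (hI : Inv D a) : a.scanned.card ≤ 2 * D.m := by
  have : a.scanned ⊆ Finset.range (2 * D.m) := fun h hh => by
    have := (hI.arcs_lt h (hI.scanned_mem h hh).1).1
    simp
    omega
  simpa using Finset.card_le_card this

theorem wp_round {N : ℕ} (hrun : Running D l B (N + 1) s) (hW : Fits D B W) (hl : 0 < l)
    (hexp : ((2 * D.g * D.n : ℕ) : ℝ) + 3 ≤ Real.exp l) (hB : ∀ i < D.m, |D.sc i| ≤ B) :
    Wp W roundProg s fun r =>
      (r.int 0 9 = 1 ∧ Running D l B N r) ∨ (r.int 0 9 = 0 ∧ Finished D r) := by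
  obtain ⟨st, a, hR, hI, hsc, hst, hN⟩ := hrun
  have h3 : 3 ≤ Real.exp l := by
    have : (0 : ℝ) ≤ ((2 * D.g * D.n : ℕ) : ℝ) := Nat.cast_nonneg _
    linarith
  have hW' := hW
  unfold Fits at hW'
  unfold rounds at hN
  refine ⟨by simp; omega, fun hf => ?_, fun hf => ?_⟩
  · replace hf : a.front.Nonempty := by
      rw [← encodeSet_pos_iff (l := l) (pos := (↑)), ← hR.front]
      simpa using hf
    refine (wp_scan hR hI hW hl h3 hf).mono ?_
    rintro r ⟨a', hR', hI', h1, h2, h4, h5⟩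
    refine Or.inl ⟨hR'.going, st, a', hR', hI', by rwa [h5], by rwa [h2, h4], ?_⟩
    unfold rounds
    rw [h1, h2, h4]
    have := card_scanned_le hI'
    split_ifs at hN ⊢ <;> omega
  replace hf : a.front = ∅ := by
    rw [← Finset.not_nonempty_iff_eq_empty, ← encodeSet_pos_iff (l := l) (pos := (↑)), ← hR.front]
    simpa using hf
  refine ⟨by simp; omega, fun hg => ?_, fun hg => ?_⟩
  · replace hg : D.τ * a.ball.card < a.ball.card + a.shell.card := by
      simpa [hR.size, hR.count, hR.growth] using hg
    have hne : a.shell ≠ ∅ := by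
      intro h0
      simp only [h0, Finset.card_empty, Nat.cast_zero, add_zero] at hg
      nlinarith [D.one_le_τ, (Nat.cast_nonneg _ : (0 : ℝ) ≤ a.ball.card)]
    refine (wp_expand hR hI hW).mono ?_
    intro r hR'
    refine Or.inl ⟨hR'.going, st, _, hR', hI.expand hf hg, hsc, hst, ?_⟩
    unfold rounds
    simp only [hne, if_false, if_true] at hN ⊢
    omega
  replace hg : (a.ball.card + a.shell.card : ℝ) ≤ D.τ * a.ball.card := by
    simpa [hR.size, hR.count, hR.growth] using hg
  replace hI := hI.absorb hf hg
  refine Wp.seq (wp_absorb hR hW (by omega)) ?_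
  intro r₁ hR₁
  refine Wp.seq (wp_peek hR₁ hI hW hl hexp hB hsc) ?_
  rintro r₂ ⟨hR₂, hnext⟩
  refine ⟨by simp; omega, fun hr => ?_, fun hr => ?_⟩
  · obtain ⟨hr1, hr2⟩ : 0 < r₂.real 0 6 ∧ r₂.int 0 5 < r₂.int 0 16 := by simpa using hr
    rw [hR₂.roots, encodeSet_pos_iff] at hr1
    rw [hR₂.scale] at hr2
    have hlt : ∀ i ∈ a.todo, a.scale < D.sc i := by
      intro j hj
      rcases hnext with ⟨h0, -⟩ | ⟨i, hi, hmin, -, h16⟩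
      · exact absurd (h0 ▸ hj) (Finset.notMem_empty j)
      · rw [h16] at hr2
        exact hr2.trans_le (sc_le_of_key_le (hI.todo_lt i hi) (hI.todo_lt j hj)
          (hmin _ (two_mul_mem_halves.2 hj)))
    refine (wp_start hR₂ hI hW hl h3 hr1 rfl rfl).mono ?_
    rintro r ⟨h, hh, ⟨hx, hR'⟩ | ⟨hx, hR'⟩⟩
    · have hc := Finset.card_erase_of_mem hh
      have hp := Finset.card_pos.2 hr1
      refine Or.inl ⟨hR'.going, _, _, hR', hI.popRoot hx, hsc, ?_, ?_⟩
      · dsimp only at hc hp ⊢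
        omega
      · unfold rounds
        dsimp only at hc hp ⊢
        rw [if_pos rfl]
        omega
    · have hc := Finset.card_erase_of_mem hh
      have hp := Finset.card_pos.2 hr1
      refine Or.inl ⟨hR'.going, _, _, hR', hI.start hh hx rfl rfl hlt, hsc, ?_, ?_⟩
      · dsimp only at hc hp ⊢
        omega
      · unfold rounds
        dsimp only at hc hp ⊢
        rw [if_pos rfl]
        omega
  replace hr : a.roots = ∅ ∨ r₂.int 0 16 ≤ a.scale := by
    have h1 : 0 < r₂.real 0 6 → r₂.int 0 16 ≤ r₂.int 0 5 := by simpa using hr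
    rw [hR₂.roots, encodeSet_pos_iff, hR₂.scale] at h1
    rcases a.roots.eq_empty_or_nonempty with h0 | h0
    · exact Or.inl h0
    · exact Or.inr (h1 h0)
  refine ⟨by simp; omega, fun hx => ?_, fun hx => ?_⟩
  · rcases hnext with ⟨h0, -⟩ | ⟨i, hi, hmin, h15, h16⟩
    · dsimp only at h0
      exfalso
      have : 0 < r₂.real 0 3 := by simpa using hx
      rw [hR₂.rest, h0, show halves ∅ = ∅ from rfl, encode_empty] at this
      exact this.false
    · rw [h16] at hr
      refine (wp_collect hR₂ hI hW hl hexp hB hi hmin h15 h16 hf rfl rfl hr).mono ?_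
      rintro r ⟨a', hR', hI', h1, h2, h4, h5, h6⟩
      have hc := Finset.card_erase_of_mem hi
      have hp := Finset.card_pos.2 ⟨i, hi⟩
      dsimp only at hc hp h1 h4 h5
      refine Or.inl ⟨hR'.going, _, a', hR', hI', h6 ▸ hB i (hI.todo_lt i hi), ?_, ?_⟩
      · rw [h5]
        omega
      · unfold rounds
        rw [h1, h5, h2, if_pos rfl]
        omega
  · rcases hnext with ⟨h0, h16⟩ | ⟨i, hi, -⟩
    · dsimp only at h0 h16
      have hr' := hr.resolve_right (by omega)
      obtain ⟨h1, h2⟩ := hI.result h0 hf hr' rfl rfl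
      refine ⟨by simp; omega, by simp, Or.inr ⟨by simp, a.out, ?_, hI.out_lt, h1, h2⟩⟩
      intro i
      simpa using hR₂.out i
    · exfalso
      have h1 : r₂.real 0 3 ≤ 0 := by simpa using hx
      rw [hR₂.rest] at h1
      exact h1.not_gt ((encode_pos_iff fun p hp => (relabel_mem hI hp).1).2
        ⟨_, two_mul_mem_halves.2 hi⟩)

end


/-! ### Reading the input -/

/-- Compute the parameters. -/
def paramProg : Prog :=
  .seq (.branch (.rle (rreg 0) (.ofInt (.lit 1)))
    (.setReal 0 (.lit 7) (.div (rreg 0) (.ofInt (.lit 2))))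
    (.setReal 0 (.lit 7) (.div (.ofInt (.lit 1)) (.ofInt (.lit 2))))) <|
  .seq (.setInt 0 (.lit 3) (.add (.floor (.div (.ofInt (.lit 21)) (.mul (rreg 7) (rreg 7))))
    (.lit 1))) <|
  .seq (.setReal 0 (.lit 1) (.log (.ofInt (.add (.mul (.mul (.lit 2) (ireg 3)) (ireg 0))
    (.lit 3))))) <|
  .seq (.setReal 0 (.lit 2) (.exp (.div (.log (.ofInt (.add (.mul (.mul (.lit 2) (ireg 3)) (ireg 0))
    (.lit 1)))) (.ofInt (ireg 2))))) <|
  .seq (.setReal 0 (.lit 8) (.log (.add (.ofInt (.lit 1)) (rreg 7)))) <|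
  .seq (.setInt 0 (.lit 4) (.add (.mul (ireg 3) (ireg 0)) (.lit 1))) <|
  .seq (.setInt 0 (.lit 6) (.lit 1)) <|
  .setInt 0 (.lit 9) (.lit 1)

/-- Add edge number `11` of the input to the edges to be collected. -/
def insertProg : Prog :=
  .seq (.setInt 0 (.lit 16) (.floor (.div (.log (.get 1 (ireg 11))) (rreg 8)))) <|
  .seq (.setInt 0 (.lit 15) (.add (.mul (.mul (.lit 2) (ireg 1)) (ireg 16))
    (.mul (.lit 2) (ireg 11)))) <|
  .seq (.setInt 0 (.lit 14) (.add (.lit 1) (.mul (.sub (ireg 16)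
    (.mul (ireg 3) (.floor (.div (.ofInt (ireg 16)) (.ofInt (ireg 3)))))) (ireg 0)))) <|
  .seq (.setInt 0 (.lit 12) (.add (ireg 14) (.get 1 (ireg 11)))) <|
  .seq (.setInt 0 (.lit 13) (.add (ireg 14) (.get 2 (ireg 11)))) <|
  .seq (.setReal 0 (.lit 3) (.add (.add (rreg 3)
    (.mul (.ofInt (ireg 12)) (placeExpr (ireg 15))))
    (.mul (.ofInt (ireg 13)) (placeExpr (.add (ireg 15) (.lit 1)))))) <|
  .seq (.setReal 2 (ireg 12) (.add (.get 2 (ireg 12)) (placeExpr (ireg 15)))) <|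
  .setReal 2 (ireg 13) (.add (.get 2 (ireg 13)) (placeExpr (.add (ireg 15) (.lit 1))))

/-- Read the next edge of the input; register `5` keeps a lower bound for the scales. -/
def readProg : Prog :=
  .seq insertProg <|
  .seq (.branch (.ile (ireg 16) (ireg 5)) (.setInt 0 (.lit 5) (ireg 16)) .skip) <|
  .setInt 0 (.lit 11) (.add (ireg 11) (.lit 1))

/-- The memory holds the graph and the parameters described by `D`. -/
structure Input (D : Setup) (s : State) : Prop where
  n : s.int 0 0 = D.n
  g : s.int 0 3 = D.g
  src : ∀ i < D.m, s.int 1 (i : ℕ) = D.ep (2 * i)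
  tgt : ∀ i < D.m, s.int 2 (i : ℕ) = D.ep (2 * i + 1)
  weight : ∀ i < D.m, s.real 1 (i : ℕ) = D.w i
  log_b : s.real 0 8 = Real.log D.b

section

variable {D : Setup} {l : ℝ} {st B W : ℕ} {s : State} {a : St}

theorem halves_range_succ (i : ℕ) :
    halves (Finset.range (i + 1)) =
      insert (2 * i) (insert (2 * i + 1) (halves (Finset.range i))) := by
  ext p
  simp only [mem_halves, Finset.mem_range, Finset.mem_insert]
  omega

theorem relabel_initial (j : ℕ) (c : ℤ) (p : ℕ) :
    (initial D j c).relabel p = (initial D j c).label p := by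
  unfold St.relabel
  simp [initial]

theorem wp_insert {i : ℕ} {c : ℤ} (hR : Rep D l st s (initial D i c)) (hIn : Input D s)
    (hW : Fits D B W) (hi : i < D.m) (h11 : s.int 0 11 = i) (hg : 0 < D.g)
    (hep : ∀ p, p / 2 < D.m → D.ep p < D.n) (hw : ∀ i < D.m, 0 < D.w i) (hb : 1 < D.b)
    (hB : ∀ i < D.m, |D.sc i| ≤ B)
    (hsc : ∀ i < D.m, D.sc i = ⌊Real.log (D.w i) / Real.log D.b⌋) :
    Wp W insertProg s fun r => Rep D l st r (initial D (i + 1) c) ∧ Input D r ∧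
      r.int 0 11 = i ∧ r.int 0 16 = D.sc i := by
  have hlog : Real.log D.b ≠ 0 := (Real.log_pos hb).ne'
  have hsci := (hsc i hi).symm
  have hBi := hB i hi
  have hwi := hw i hi
  have h1 := hep (2 * i) (by omega)
  have h2 := hep (2 * i + 1) (by omega)
  have hmod : (((D.sc i % D.g).toNat : ℕ) : ℤ) = D.sc i % D.g :=
    Int.toNat_of_nonneg (Int.emod_nonneg _ (by omega))
  have hmodlt := Int.emod_lt_of_pos (D.sc i) (b := D.g) (by omega)
  have hdiv : ⌊(D.sc i : ℝ) / (D.g : ℝ)⌋ = D.sc i / D.g := by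
    rw [Int.floor_div_natCast, Int.floor_intCast]
  have hg' : (D.g : ℝ) ≠ 0 := by positivity
  have hsub : D.sc i - D.g * (D.sc i / D.g) = (D.sc i % D.g).toNat := by
    rw [hmod, Int.emod_def]
  generalize hu : (D.sc i % D.g).toNat = u at *
  have hun : (u + 1) * D.n ≤ D.g * D.n := by
    gcongr
    omega
  obtain ⟨X, hX⟩ : ∃ X, X = (initial D i c).label (2 * i) := ⟨_, rfl⟩
  obtain ⟨Y, hY⟩ : ∃ Y, Y = (initial D i c).label (2 * i + 1) := ⟨_, rfl⟩
  have hx : 1 + (u : ℤ) * D.n + D.ep (2 * i) = X := by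
    simp [hX, initial, hu]
  have hy : 1 + (u : ℤ) * D.n + D.ep (2 * i + 1) = Y := by
    simp [hY, initial, show (2 * i + 1) / 2 = i by omega, hu]
  have hkey : 2 * (D.m : ℤ) * D.sc i + 2 * i = key D (2 * i) := by
    unfold key
    rw [Nat.mul_div_cancel_left _ two_pos]
    push_cast
    rfl
  unfold Fits at hW
  have hmB : |(D.m : ℤ) * D.sc i| ≤ D.m * B := by
    rw [abs_mul, Nat.abs_cast]
    gcongr
  have hWz : 2 * ((D.m : ℤ) * B) + 4 * D.m + 2 * (D.g * D.n) + B + 20 ≤ W := by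
    rw [← mul_assoc, ← mul_assoc]; exact_mod_cast hW
  have hgn : (D.g : ℤ) ≤ D.g * D.n := by
    have : D.g * 1 ≤ D.g * D.n := Nat.mul_le_mul_left _ (by omega)
    rw [mul_one] at this
    exact_mod_cast this
  have hunz : (u : ℤ) * D.n + D.n ≤ D.g * D.n := by
    rw [← add_one_mul]
    exact_mod_cast hun
  have hun0 : (0 : ℤ) ≤ u * D.n := by positivity
  rw [abs_le] at hmB hBi
  have k1 : |D.sc i| ≤ W := abs_le.2 ⟨by omega, by omega⟩
  have k3 : |2 * (D.m : ℤ) * D.sc i| ≤ W := by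
    rw [mul_assoc]; exact abs_le.2 ⟨by omega, by omega⟩
  have k4 : |key D (2 * i)| ≤ W := by
    rw [← hkey, mul_assoc]; exact abs_le.2 ⟨by omega, by omega⟩
  have k5 : |key D (2 * i) + 1| ≤ W := by
    rw [← hkey, mul_assoc]; exact abs_le.2 ⟨by omega, by omega⟩
  have k6 : |D.sc i / D.g| ≤ W := (Int.abs_ediv_le_abs _ _).trans k1
  have k7 : |D.g * (D.sc i / D.g)| ≤ W := abs_le.2 ⟨by omega, by omega⟩
  have k8 : |(u : ℤ) * D.n| ≤ W := abs_le.2 ⟨by omega, by omega⟩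
  have k9 : |1 + (u : ℤ) * D.n| ≤ W := abs_le.2 ⟨by omega, by omega⟩
  have k12 : (u : ℤ) ≤ W := by omega
  have hx' : (initial D (i + 1) c).relabel (2 * i) = X := by
    rw [relabel_initial, hX]
    rfl
  have hy' : (initial D (i + 1) c).relabel (2 * i + 1) = Y := by
    rw [relabel_initial, hY]
    rfl
  have hrest := hR.rest
  have hahead := hR.ahead
  have hm1 : 2 * i ∉ insert (2 * i + 1) (halves (Finset.range i)) := by
    simp only [Finset.mem_insert, mem_halves, Finset.mem_range]
    omega
  have hm2 : 2 * i + 1 ∉ halves (Finset.range i) := by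
    simp only [mem_halves, Finset.mem_range]
    omega
  simp only [insertProg, Wp, IExpr.Ok, RExpr.Ok, IExpr.eval, RExpr.eval, placeExpr, storeInt_int,
    storeInt_real, storeReal_int, storeReal_real, h11, hIn.n, hIn.g, hIn.weight i hi, hIn.log_b,
    hR.m]
  simp [hIn.src i hi, hIn.tgt i hi, hsci, hdiv, hsub, hx, hy, hkey, hlog, hwi, hg', k1, k4, k5, k6,
    k9, k12, hR.base]
  have k7' : D.g * |D.sc i / D.g| ≤ W := by rwa [abs_mul, Nat.abs_cast] at k7
  have k3' : 2 * (D.m : ℤ) * |D.sc i| ≤ W := by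
    rwa [abs_mul, abs_of_nonneg (by omega : (0 : ℤ) ≤ 2 * D.m)] at k3
  have k8' : (u : ℤ) * D.n ≤ W := (le_abs_self _).trans k8
  (repeat' apply And.intro) <;> try first | omega | exact k3' | exact k7' | exact k8'
  · refine { hR with rest := ?_, ahead := ?_ }
    · change _ = encode l (key D) (halves (Finset.range (i + 1))) (initial D (i + 1) c).relabel
      rw [halves_range_succ, encode_insert hm1, encode_insert hm2, hx', hy', key_succ]
      simp [hrest, place]
      rw [add_right_comm]
      rfl
    · intro x
      change _ = encodeSet l (key D) ((halves (Finset.range (i + 1))).filter fun p =>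
        (initial D (i + 1) c).relabel p = x)
      rw [halves_range_succ, encodeSet_filter_insert hm1, encodeSet_filter_insert hm2, hx', hy',
        key_succ]
      have := hahead x
      change _ = encodeSet l (key D) ((halves (Finset.range i)).filter fun p =>
        (initial D (i + 1) c).relabel p = x) at this
      simp only [storeInt_real, storeReal_real, place, Nat.cast_inj, true_and]
      push_cast
      split_ifs <;> (simp_all; try ring)
  · exact { hIn with }

theorem wp_read {i : ℕ} {c : ℤ} (hR : Rep D l st s (initial D i c)) (hIn : Input D s)
    (hW : Fits D B W) (hi : i < D.m) (h11 : s.int 0 11 = i) (hg : 0 < D.g)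
    (hep : ∀ p, p / 2 < D.m → D.ep p < D.n) (hw : ∀ i < D.m, 0 < D.w i) (hb : 1 < D.b)
    (hB : ∀ i < D.m, |D.sc i| ≤ B)
    (hsc : ∀ i < D.m, D.sc i = ⌊Real.log (D.w i) / Real.log D.b⌋)
    (hc : |c| ≤ B) (hle : ∀ j < i, c ≤ D.sc j) :
    Wp W readProg s fun r => ∃ c', Rep D l st r (initial D (i + 1) c') ∧ Input D r ∧
      r.int 0 11 = (i + 1 : ℕ) ∧ |c'| ≤ B ∧ ∀ j < i + 1, c' ≤ D.sc j := by
  refine Wp.seq (wp_insert hR hIn hW hi h11 hg hep hw hb hB hsc) ?_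
  rintro r ⟨hR', hIn', h11', h16'⟩
  unfold Fits at hW
  have hscale : r.int 0 5 = c := hR'.scale
  have k11 : |(i : ℤ) + 1| ≤ W := abs_le.2 ⟨by omega, by omega⟩
  simp [h11', h16', hscale]
  (repeat' apply And.intro) <;> try omega
  · intro h
    (repeat' apply And.intro) <;> try first | omega | exact k11
    refine ⟨D.sc i, { hR' with scale := ?_ }, { hIn' with }, hB i hi, fun j hj => ?_⟩
    · rfl
    · rcases lt_or_eq_of_le hj with hj | rfl
      · exact h.trans (hle j hj)
      · exact le_rfl
  · intro h
    (repeat' apply And.intro) <;> try first | omega | exact k11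
    refine ⟨c, { hR' with }, { hIn' with }, hc, fun j hj => ?_⟩
    rcases lt_or_eq_of_le hj with hj | rfl
    · exact hle j hj
    · exact h.le

/-- The two loops of the program. -/
def mainProg : Prog :=
  .seq (.loop (.ile (.add (ireg 11) (.lit 1)) (ireg 1)) readProg)
    (.loop (.ile (.lit 1) (ireg 9)) roundProg)

theorem exec_main (hR : Rep D l 1 s (initial D 0 0)) (hIn : Input D s) (h11 : s.int 0 11 = 0)
    (hW : Fits D B W) (hl : 0 < l) (hexp : ((2 * D.g * D.n : ℕ) : ℝ) + 3 ≤ Real.exp l)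
    (hg : 0 < D.g) (hep : ∀ p, p / 2 < D.m → D.ep p < D.n) (hw : ∀ i < D.m, 0 < D.w i)
    (hb : 1 < D.b) (hB : ∀ i < D.m, |D.sc i| ≤ B)
    (hsc : ∀ i < D.m, D.sc i = ⌊Real.log (D.w i) / Real.log D.b⌋) :
    ∃ r t, Exec W mainProg s r t ∧
      t ≤ (8 + maxCost readProg + 7 * (5 + maxCost roundProg)) * (D.m + 1) ∧ Finished D r := by
  have hW' := hW
  unfold Fits at hW'
  obtain ⟨r₁, t₁, hx₁, ht₁, ⟨N₁, i, c, hN, him, hR₁, hIn₁, hi₁, hc, hle⟩, hend⟩ :=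
    exec_loop (W := W) (p := readProg) (b := .ile (.add (ireg 11) (.lit 1)) (ireg 1)) (N := D.m)
      (s := s) (fun N s => ∃ i c, N + i = D.m ∧ i ≤ D.m ∧ Rep D l 1 s (initial D i c) ∧ Input D s ∧
        s.int 0 11 = i ∧ |c| ≤ B ∧ ∀ j < i, c ≤ D.sc j)
      (by
        rintro N s ⟨i, c, hN, him, hR, hIn, hi, hc, hle⟩
        refine ⟨?_, fun h => ?_⟩
        · simp [hi]
          have : |(i : ℤ) + 1| ≤ W := abs_le.2 ⟨by omega, by omega⟩
          (repeat' apply And.intro) <;> omega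
        · replace h : i < D.m := by simpa [hi, hR.m] using h
          refine ⟨N - 1, by omega, (wp_read hR hIn hW h hi hg hep hw hb hB hsc hc hle).mono ?_⟩
          rintro r ⟨c', h1, h2, h3, h4, h5⟩
          exact ⟨i + 1, c', by omega, h, h1, h2, h3, h4, h5⟩)
      ⟨0, 0, by omega, by omega, hR, hIn, h11, by simp, by simp⟩
  obtain rfl : i = D.m := by
    have : ¬ (i : ℤ) + 1 ≤ D.m := by simpa [hi₁, hR₁.m] using hend
    omega
  obtain ⟨r₂, t₂, hx₂, ht₂, ⟨N₂, hN₂⟩, hend₂⟩ :=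
    exec_loop (W := W) (p := roundProg) (b := .ile (.lit 1) (ireg 9)) (N := 7 * D.m + 1)
      (s := r₁) (fun N s => (s.int 0 9 = 1 ∧ Running D l B N s) ∨ (s.int 0 9 = 0 ∧ Finished D s))
      (by
        intro N s hN
        refine ⟨by simp; omega, fun h => ?_⟩
        rcases hN with ⟨-, hN⟩ | ⟨h0, -⟩
        · obtain _ | N := N
          · obtain ⟨_, _, -, -, -, -, h0⟩ := hN
            omega
          · exact ⟨N, by omega, wp_round hN hW hl hexp hB⟩
        · simp [h0] at h)
      (.inl ⟨hR₁.going, 1, _, hR₁, inv_initial hg hep hle, hc,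
        by simp [initial]; omega, by simp [rounds, initial]; omega⟩)
  refine ⟨r₂, t₁ + t₂, .seq hx₁ hx₂, ?_, ?_⟩
  · simp only [Test.cost, IExpr.cost] at ht₁ ht₂
    have h : (5 + maxCost roundProg) * (7 * D.m + 1 + 1) ≤
        (5 + maxCost roundProg) * (7 * (D.m + 1)) := by
      gcongr
      omega
    calc t₁ + t₂ ≤ (8 + maxCost readProg) * (D.m + 1) +
          (5 + maxCost roundProg) * (7 * (D.m + 1)) := by
          refine Nat.add_le_add (ht₁.trans_eq ?_) (ht₂.trans (h.trans' (le_of_eq ?_))) <;> ring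
      _ = _ := by ring
  · rcases hN₂ with ⟨h1, -⟩ | ⟨-, h1⟩
    · simp [h1] at hend₂
    · exact h1

end


/-! ### The parameters -/

/-- Every positive number lies between two successive powers of `b`. -/
theorem zpow_floor_log {b w : ℝ} (hb : 1 < b) (hw : 0 < w) :
    b ^ ⌊Real.log w / Real.log b⌋ ≤ w ∧ w ≤ b * b ^ ⌊Real.log w / Real.log b⌋ := by
  have hb0 : 0 < b := zero_lt_one.trans hb
  have hlog := Real.log_pos hb
  constructor
  · rw [← Real.log_le_log_iff (zpow_pos hb0 _) hw, Real.log_zpow, ← le_div_iff₀ hlog]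
    exact Int.floor_le _
  · rw [mul_comm, ← zpow_add_one₀ hb0.ne', ← Real.log_le_log_iff hw (zpow_pos hb0 _), Real.log_zpow,
      ← div_le_iff₀ hlog]
    push_cast
    exact (Int.lt_floor_add_one _).le

/-- Half of `min ε 1`. Weights are rounded to powers of `1 + slack ε`, and the rounding together
with the diameters of the clusters costs a factor of at most `1 + 2 * slack ε` in the stretch. -/
noncomputable def slack (ε : ℝ) : ℝ := min ε 1 / 2

theorem slack_pos {ε : ℝ} (hε : 0 < ε) : 0 < slack ε := by
  unfold slack
  positivity

theorem slack_le (ε : ℝ) : slack ε ≤ 1 / 2 := by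
  unfold slack
  have := min_le_right ε 1
  linarith

theorem two_mul_slack_le (ε : ℝ) : 2 * slack ε ≤ ε := by
  unfold slack
  have := min_le_left ε 1
  linarith

theorem inv_slack_le {ε : ℝ} (hε : 0 < ε) : 1 / slack ε ≤ 2 * (1 + 1 / ε) := by
  unfold slack
  rcases min_choice ε 1 with h1 | h1 <;> rw [h1]
  · rw [one_div_div, show 2 / ε = 2 * (1 / ε) by ring]
    linarith
  · norm_num
    simpa using hε.le

/-- The number of classes of scales: by Bernoulli's inequality, it is large enough for the
diameters of the clusters to be negligible (`separated_slack`). -/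
noncomputable def classes (ε : ℝ) : ℕ := ⌊21 / (slack ε * slack ε)⌋₊ + 1

theorem classes_le {ε : ℝ} (hε : 0 < ε) : (classes ε : ℝ) ≤ 85 * (1 + 1 / ε) ^ 2 := by
  have h := inv_slack_le hε
  have h0 := slack_pos hε
  have h1 : 0 < 1 / ε := by positivity
  have h3 : 21 / (slack ε * slack ε) ≤ 84 * (1 + 1 / ε) ^ 2 := by
    rw [show 21 / (slack ε * slack ε) = 21 * (1 / slack ε) ^ 2 by field_simp]
    calc 21 * (1 / slack ε) ^ 2 ≤ 21 * (2 * (1 + 1 / ε)) ^ 2 := by gcongr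
      _ = _ := by ring
  have h4 := Nat.floor_le (show 0 ≤ 21 / (slack ε * slack ε) by positivity)
  unfold classes
  push_cast
  nlinarith

theorem separated_slack {ε : ℝ} (hε : 0 < ε) :
    4 * (slack ε / 3) + 4 * (1 + slack ε) ≤ slack ε / 3 * (1 + slack ε) ^ classes ε := by
  have h0 := slack_pos hε
  have h1 := slack_le ε
  have h2 : 21 / (slack ε * slack ε) ≤ classes ε := by
    unfold classes
    push_cast
    exact (Nat.lt_floor_add_one _).le
  rw [div_le_iff₀ (by positivity)] at h2
  have h3 := one_add_mul_le_pow (a := slack ε) (by linarith) (classes ε)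
  calc 4 * (slack ε / 3) + 4 * (1 + slack ε) ≤ slack ε / 3 * (1 + classes ε * slack ε) := by
        nlinarith
    _ ≤ _ := by gcongr

section

variable {n m : ℕ} {G : WeightedGraph n}

/-- The weight of the edge `i`. -/
noncomputable def edgeWeight (L : EdgeList G m) (i : ℕ) : ℝ :=
  if h : i < m then G.weight s(L.src ⟨i, h⟩, L.tgt ⟨i, h⟩) else 1

/-- The starting vertex of a half-edge. -/
def endpoint (L : EdgeList G m) (p : ℕ) : ℕ :=
  if h : p / 2 < m then (if p % 2 = 0 then L.src ⟨p / 2, h⟩ else L.tgt ⟨p / 2, h⟩) else 0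

theorem edgeWeight_pos (L : EdgeList G m) (i : ℕ) : 0 < edgeWeight L i := by
  unfold edgeWeight
  split_ifs with h
  · exact G.weight_pos _ (L.bijOn.mapsTo (Set.mem_univ (⟨i, h⟩ : Fin m)))
  · exact one_pos

theorem endpoint_lt (L : EdgeList G m) {p : ℕ} (h : p / 2 < m) : endpoint L p < n := by
  unfold endpoint
  rw [dif_pos h]
  split_ifs
  · exact (L.src _).2
  · exact (L.tgt _).2

/-- The data of a run on a given input. -/
noncomputable def setup (L : EdgeList G m) {k : ℕ} (hk : 1 ≤ k) {ε : ℝ} (hε : 0 < ε) : Setup where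
  n := n
  m := m
  k := k
  g := classes ε
  ep := endpoint L
  w := edgeWeight L
  sc i := ⌊Real.log (edgeWeight L i) / Real.log (1 + slack ε)⌋
  b := 1 + slack ε
  δ := slack ε / 3
  τ := Real.exp (Real.log (2 * classes ε * n + 1) / k)
  σ := 1 + 2 * slack ε
  one_le_k := hk
  one_le_b := by linarith [slack_pos hε]
  δ_pos := by linarith [slack_pos hε]
  δ_le_one := by linarith [slack_le ε]
  le_σ := by linarith
  le_w i _ := (zpow_floor_log (by linarith [slack_pos hε]) (edgeWeight_pos L i)).1
  w_le i _ := (zpow_floor_log (by linarith [slack_pos hε]) (edgeWeight_pos L i)).2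
  separated := separated_slack hε
  one_le_τ := by
    rw [Real.one_le_exp_iff]
    have : (0 : ℝ) ≤ 2 * classes ε * n := by positivity
    exact div_nonneg (Real.log_nonneg (by linarith)) (Nat.cast_nonneg k)
  lt_τ_pow := by
    have : (k : ℝ) ≠ 0 := by positivity
    rw [← Real.exp_nat_mul, mul_div_cancel₀ _ this, Real.exp_log (by positivity)]
    linarith

theorem wp_param (L : EdgeList G m) {k : ℕ} (hk : 1 ≤ k) {ε : ℝ} (hε : 0 < ε) {W : ℕ}
    (hg : 2 * classes ε ≤ W) (hW : 2 * classes ε * n + 21 ≤ W) :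
    Wp W paramProg (L.initialState k ε) fun r =>
      Rep (setup L hk hε) (Real.log (2 * classes ε * n + 3)) 1 r (initial (setup L hk hε) 0 0) ∧
      Input (setup L hk hε) r ∧ r.int 0 11 = 0 := by
  have he := slack_pos hε
  have h0 : Wp W (.branch (.rle (rreg 0) (.ofInt (.lit 1)))
      (.setReal 0 (.lit 7) (.div (rreg 0) (.ofInt (.lit 2))))
      (.setReal 0 (.lit 7) (.div (.ofInt (.lit 1)) (.ofInt (.lit 2))))) (L.initialState k ε)
      fun r => r = (L.initialState k ε).storeReal 0 7 (slack ε) := by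
    simp only [Wp, Test.Ok, Test.Holds, RExpr.Ok, RExpr.eval, IExpr.Ok, IExpr.eval]
    simp only [EdgeList.initialState, if_true, slack]
    refine ⟨by simp; omega, fun h => ?_, fun h => ?_⟩
    · have : ε ≤ 1 := by simpa using h
      refine ⟨by simp; omega, by simp; omega, ?_⟩
      simp [this]
    · have : 1 ≤ ε := by simpa using (not_le.1 h).le
      refine ⟨by simp; omega, by simp; omega, ?_⟩
      simp [this]
  refine Wp.seq h0 ?_
  rintro r rfl
  have hfl : ⌊21 / (slack ε * slack ε)⌋ + 1 = (classes ε : ℤ) := by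
    unfold classes
    push_cast
    rw [Int.natCast_floor_eq_floor (by positivity)]
  have hfl' : |⌊21 / (slack ε * slack ε)⌋| ≤ W := by
    rw [abs_le]
    have : 0 ≤ ⌊21 / (slack ε * slack ε)⌋ := Int.floor_nonneg.2 (by positivity)
    omega
  have h1 : |2 * (classes ε : ℤ) * n + 1| ≤ W := by
    rw [abs_of_nonneg (by positivity)]
    have : 2 * (classes ε : ℤ) * n + 21 ≤ W := by exact_mod_cast hW
    omega
  have h3 : |2 * (classes ε : ℤ) * n + 3| ≤ W := by
    rw [abs_of_nonneg (by positivity)]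
    have : 2 * (classes ε : ℤ) * n + 21 ≤ W := by exact_mod_cast hW
    omega
  have h4 : |(classes ε : ℤ) * n + 1| ≤ W := by
    rw [abs_of_nonneg (by positivity)]
    have h5 : 2 * (classes ε : ℤ) * n + 21 ≤ W := by exact_mod_cast hW
    rw [mul_assoc] at h5
    omega
  have hn : (L.initialState k ε).int 0 0 = n := rfl
  have hk' : (L.initialState k ε).int 0 2 = k := rfl
  have hk0 : k ≠ 0 := by omega
  simp only [Wp, IExpr.Ok, RExpr.Ok, IExpr.eval, RExpr.eval, storeInt_int, storeInt_real,
    storeReal_int, storeReal_real]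
  simp [hfl, hfl', h1, h3, h4, hn, hk', hk0, he.ne']
  have h2 : 2 * (classes ε : ℤ) * n ≤ W := by
    have := (abs_le.1 h1).2
    omega
  have h2' : (classes ε : ℤ) * n ≤ W := by
    have := (abs_le.1 h4).2
    omega
  have h5 : 0 < 2 * (classes ε : ℝ) * n + 1 := by positivity
  have h5' : 0 < 2 * (classes ε : ℝ) * n + 3 := by positivity
  (repeat' apply And.intro) <;> try first | omega | exact h2 | exact h2' | exact h5 | exact h5'
  · linarith
  · constructor <;> simp [EdgeList.initialState, initial, setup, encode, halves]
    all_goals exact fun x => (Finset.sum_eq_zero fun y hy =>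
      absurd (Finset.mem_filter.1 hy).1 (Finset.notMem_empty y)).symm
  · constructor <;> simp [EdgeList.initialState, setup, endpoint, edgeWeight]
    · intro i hi
      simp [hi]
    · intro i hi
      simp [hi, show (2 * i + 1) / 2 = i by omega]
    · intro i hi
      simp [hi]
  · simp [EdgeList.initialState]

end


section

variable {n m : ℕ} {G : WeightedGraph n}

/-! ### The output -/

theorem mk_endpoint (L : EdgeList G m) {p : ℕ} (hp : p / 2 < m)
    (h1 : endpoint L p < n) (h2 : endpoint L (opp p) < n) :
    s((⟨endpoint L p, h1⟩ : Fin n), ⟨endpoint L (opp p), h2⟩) =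
      s(L.src ⟨p / 2, hp⟩, L.tgt ⟨p / 2, hp⟩) := by
  have hp' : opp p / 2 < m := by rwa [opp_div_two]
  have hq : (⟨opp p / 2, hp'⟩ : Fin m) = ⟨p / 2, hp⟩ := by simp [opp_div_two]
  rcases Nat.mod_two_eq_zero_or_one p with h | h
  · have h' : opp p % 2 ≠ 0 := by unfold opp; omega
    congr 2 <;> simp [endpoint, hp, hp', h, h', hq]
  · have h' : opp p % 2 = 0 := by unfold opp; omega
    rw [Sym2.eq_swap]
    congr 2 <;> simp [endpoint, hp, hp', h, h', hq]

theorem edgeWeight_eq (L : EdgeList G m) {i : ℕ} (hi : i < m) :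
    edgeWeight L i = G.weight s(L.src ⟨i, hi⟩, L.tgt ⟨i, hi⟩) := dif_pos hi

/-- Short paths are walks in the output. -/
theorem Near.exists_walk {L : EdgeList G m} {s : State} {O : Finset ℕ}
    (hout : ∀ i : ℕ, s.int 3 i ≠ 0 ↔ i ∈ O) (hO : ∀ i ∈ O, i < m) {u v : ℕ} {r : ℝ}
    (h : Near (endpoint L) (edgeWeight L) O u v r) (hu : u < n) (hv : v < n) :
    ∃ p : (L.outputGraph s).Walk ⟨u, hu⟩ ⟨v, hv⟩, walkWeight G.weight p ≤ r := by
  induction h with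
  | refl u h0 => exact ⟨.nil, by simpa [walkWeight] using h0⟩
  | step h hm _ hr ih =>
    have hlt := hO _ hm
    have hv' : endpoint L (opp h) < n := endpoint_lt L (by rwa [opp_div_two])
    obtain ⟨p, hp⟩ := ih hv' hv
    have heq := mk_endpoint L hlt hu hv'
    have hadj : (L.outputGraph s).Adj ⟨endpoint L h, hu⟩ ⟨endpoint L (opp h), hv'⟩ := by
      have hG : s((⟨endpoint L h, hu⟩ : Fin n), ⟨endpoint L (opp h), hv'⟩) ∈ G.graph.edgeSet :=
        heq ▸ L.bijOn.mapsTo (Set.mem_univ (⟨h / 2, hlt⟩ : Fin m))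
      exact (SimpleGraph.fromEdgeSet_adj _).2 ⟨⟨⟨h / 2, hlt⟩, (hout _).2 hm, heq⟩,
        (G.graph.mem_edgeSet.1 hG).ne⟩
    refine ⟨.cons hadj p, ?_⟩
    rw [edgeWeight_eq L hlt, ← heq] at hr
    simp only [walkWeight, SimpleGraph.Walk.edges_cons, List.map_cons, List.sum_cons] at hp ⊢
    linarith

/-- It is enough to bound the stretch of the edges. -/
theorem near_of_walk {L : EdgeList G m} {O : Finset ℕ} {T : ℝ}
    (h : ∀ i < m, Near (endpoint L) (edgeWeight L) O (endpoint L (2 * i)) (endpoint L (2 * i + 1))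
      (T * edgeWeight L i)) {u v : Fin n} (p : G.graph.Walk u v) :
    Near (endpoint L) (edgeWeight L) O u v (T * walkWeight G.weight p) := by
  induction p with
  | nil => exact .refl _ (by simp [walkWeight])
  | @cons u v x hadj p ih =>
    obtain ⟨⟨i, hi⟩, -, he⟩ := L.bijOn.surjOn (G.graph.mem_edgeSet.2 hadj)
    have hn := h i hi
    have h1 : endpoint L (2 * i) = L.src ⟨i, hi⟩ := by simp [endpoint, hi]
    have h2 : endpoint L (2 * i + 1) = L.tgt ⟨i, hi⟩ := by
      simp [endpoint, hi, show (2 * i + 1) / 2 = i by omega]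
    simp only [walkWeight, SimpleGraph.Walk.edges_cons, List.map_cons, List.sum_cons] at ih ⊢
    rw [h1, h2, edgeWeight_eq L hi] at hn
    dsimp only at he
    rw [he] at hn
    rw [mul_add]
    refine Near.trans ?_ ih
    rcases Sym2.eq_iff.1 he with ⟨rfl, rfl⟩ | ⟨rfl, rfl⟩
    · exact hn
    · exact hn.symm

theorem isSpanner_outputGraph {L : EdgeList G m} {s : State} {O : Finset ℕ} {T : ℝ} (hT : 0 < T)
    (hout : ∀ i : ℕ, s.int 3 i ≠ 0 ↔ i ∈ O) (hO : ∀ i ∈ O, i < m)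
    (h : ∀ i < m, Near (endpoint L) (edgeWeight L) O (endpoint L (2 * i)) (endpoint L (2 * i + 1))
      (T * edgeWeight L i)) :
    IsSpanner G T (L.outputGraph s) := by
  refine ⟨fun u v huv => ?_, fun u v => ?_⟩
  · obtain ⟨⟨i, -, he⟩, -⟩ := (SimpleGraph.fromEdgeSet_adj _).1 huv
    rw [← SimpleGraph.mem_edgeSet, he]
    exact L.bijOn.mapsTo (Set.mem_univ i)
  · unfold pathDist
    rw [ENNReal.mul_iInf_of_ne (by simpa using hT) ENNReal.ofReal_ne_top]
    refine le_iInf fun p => ?_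
    obtain ⟨q, hq⟩ := (near_of_walk h p).exists_walk hout hO u.2 v.2
    refine (iInf_le _ q).trans ?_
    rw [← ENNReal.ofReal_mul hT.le]
    exact ENNReal.ofReal_le_ofReal hq

theorem ncard_edgeSet_outputGraph_le {L : EdgeList G m} {s : State} {O : Finset ℕ}
    (hout : ∀ i : ℕ, s.int 3 i ≠ 0 ↔ i ∈ O) :
    (L.outputGraph s).edgeSet.ncard ≤ O.card := by
  have h : (L.outputGraph s).edgeSet ⊆ (fun i => s(L.src i, L.tgt i)) '' {i | (i : ℕ) ∈ O} := by
    intro e he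
    unfold EdgeList.outputGraph at he
    rw [SimpleGraph.edgeSet_fromEdgeSet] at he
    obtain ⟨⟨i, hi, rfl⟩, -⟩ := he
    exact ⟨i, (hout _).1 hi, rfl⟩
  refine (Set.ncard_le_ncard h (Set.toFinite _)).trans ?_
  refine (Set.ncard_image_le (Set.toFinite _)).trans ?_
  rw [← Set.ncard_coe_finset O]
  exact Set.ncard_le_ncard_of_injOn (fun i : Fin m => (i : ℕ)) (fun i hi => hi)
    (Fin.val_injective.injOn) (Set.toFinite _)

/-! ### The bounds -/

theorem size_bound {n g k : ℕ} (hg : 1 ≤ g) (hk : 1 ≤ k) :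
    2 * (g : ℝ) * n * (1 + Real.exp (Real.log (2 * g * n + 1) / k)) ≤
      8 * (g : ℝ) ^ 2 * (n : ℝ) ^ (1 + 1 / (k : ℝ)) := by
  rcases n.eq_zero_or_pos with rfl | hn
  · have : (1 : ℝ) + 1 / k ≠ 0 := by positivity
    rw [Nat.cast_zero, Real.zero_rpow this]
    simp
  have hn' : (1 : ℝ) ≤ n := by exact_mod_cast hn
  have hg' : (1 : ℝ) ≤ g := by exact_mod_cast hg
  have hk' : (1 : ℝ) ≤ k := by exact_mod_cast hk
  have h1 : Real.exp (Real.log (2 * g * n + 1) / k) ≤ (2 * g + 1) * (n : ℝ) ^ (1 / (k : ℝ)) := by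
    rw [div_eq_mul_one_div, ← Real.rpow_def_of_pos (by positivity)]
    calc (2 * (g : ℝ) * n + 1) ^ (1 / (k : ℝ)) ≤ ((2 * g + 1) * n) ^ (1 / (k : ℝ)) := by
          gcongr
          linarith
      _ = (2 * (g : ℝ) + 1) ^ (1 / (k : ℝ)) * (n : ℝ) ^ (1 / (k : ℝ)) :=
          Real.mul_rpow (by positivity) (by positivity)
      _ ≤ _ := by
          gcongr
          refine Real.rpow_le_self_of_one_le (by linarith) ?_
          rw [div_le_one (by positivity)]
          exact hk'
  have h2 : 1 ≤ (n : ℝ) ^ (1 / (k : ℝ)) := Real.one_le_rpow hn' (by positivity)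
  rw [Real.rpow_one_add' (by positivity) (by positivity)]
  calc 2 * (g : ℝ) * n * (1 + Real.exp (Real.log (2 * g * n + 1) / k))
      ≤ 2 * (g : ℝ) * n * (4 * g * (n : ℝ) ^ (1 / (k : ℝ))) := by
        gcongr
        nlinarith
    _ = _ := by ring

section

variable (L : EdgeList G m) (k : ℕ) {ε : ℝ}

theorem le_magnitude :
    n ≤ L.magnitude k ε ∧ m ≤ L.magnitude k ε ∧ 2 ≤ L.magnitude k ε ∧
      1 / ε + 2 ≤ L.magnitude k ε ∧ ∀ i < m, |Real.log (edgeWeight L i)| ≤ L.magnitude k ε := by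
  unfold EdgeList.magnitude
  have h0 := Nat.le_ceil (1 / ε)
  refine ⟨by omega, by omega, by omega, ?_, fun i hi => ?_⟩
  · push_cast
    have h1 : (0 : ℝ) ≤ n + m + k := by positivity
    linarith
  · have h1 := Finset.le_sup (f := fun i : Fin m =>
      ⌈|Real.log (G.weight s(L.src i, L.tgt i))|⌉₊) (Finset.mem_univ (⟨i, hi⟩ : Fin m))
    rw [edgeWeight_eq L hi]
    refine (Nat.le_ceil _).trans ?_
    exact_mod_cast (by omega)

theorem classes_le_magnitude (hε : 0 < ε) : classes ε ≤ 85 * L.magnitude k ε ^ 2 := by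
  have h1 := classes_le hε
  obtain ⟨-, -, -, h2, -⟩ := le_magnitude L k (ε := ε)
  have h4 : (1 + 1 / ε) ^ 2 ≤ (L.magnitude k ε : ℝ) ^ 2 := by
    gcongr
    linarith
  have h5 : (classes ε : ℝ) ≤ 85 * (L.magnitude k ε : ℝ) ^ 2 := by linarith
  exact_mod_cast h5

theorem abs_scale_le (hε : 0 < ε) {i : ℕ} (hi : i < m) :
    |⌊Real.log (edgeWeight L i) / Real.log (1 + slack ε)⌋| ≤ (3 * L.magnitude k ε ^ 2 : ℕ) := by
  obtain ⟨-, -, h2, h3, h4⟩ := le_magnitude L k (ε := ε)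
  replace h4 := h4 i hi
  have he := slack_pos hε
  have h5 := inv_slack_le hε
  have hS : (2 : ℝ) ≤ L.magnitude k ε := by exact_mod_cast h2
  have hlog : slack ε / (1 + slack ε) ≤ Real.log (1 + slack ε) := by
    refine le_trans (le_of_eq ?_) (Real.one_sub_inv_le_log_of_pos (by positivity))
    field_simp
    ring
  have hlog0 : 0 < Real.log (1 + slack ε) := Real.log_pos (by linarith)
  have h6 : |Real.log (edgeWeight L i) / Real.log (1 + slack ε)| ≤
      2 * (L.magnitude k ε : ℝ) ^ 2 := by
    rw [abs_div, abs_of_pos hlog0]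
    calc |Real.log (edgeWeight L i)| / Real.log (1 + slack ε)
        ≤ L.magnitude k ε / (slack ε / (1 + slack ε)) := by gcongr
      _ = L.magnitude k ε * (1 + 1 / slack ε) := by field_simp; ring
      _ ≤ L.magnitude k ε * (2 * L.magnitude k ε) := by
        gcongr
        linarith
      _ = _ := by ring
  have h7 := Int.floor_le (Real.log (edgeWeight L i) / Real.log (1 + slack ε))
  have h8 := Int.lt_floor_add_one (Real.log (edgeWeight L i) / Real.log (1 + slack ε))
  rw [abs_le] at h6 ⊢
  have h9 : (1 : ℝ) ≤ (L.magnitude k ε : ℝ) ^ 2 := by nlinarith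
  constructor
  · have : -((3 * L.magnitude k ε ^ 2 : ℕ) : ℝ) ≤
      (⌊Real.log (edgeWeight L i) / Real.log (1 + slack ε)⌋ : ℝ) := by
      push_cast
      linarith
    exact_mod_cast this
  · have : (⌊Real.log (edgeWeight L i) / Real.log (1 + slack ε)⌋ : ℝ) ≤
        ((3 * L.magnitude k ε ^ 2 : ℕ) : ℝ) := by
      push_cast
      linarith
    exact_mod_cast this

theorem fits_magnitude (hk : 1 ≤ k) (hε : 0 < ε) :
    Fits (setup L hk hε) (3 * L.magnitude k ε ^ 2) (L.magnitude k ε ^ 12) ∧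
      2 * classes ε ≤ L.magnitude k ε ^ 12 ∧
      2 * classes ε * n + 21 ≤ L.magnitude k ε ^ 12 := by
  obtain ⟨hn, hm, hS, -, -⟩ := le_magnitude L k (ε := ε)
  have hg := classes_le_magnitude L k hε
  unfold Fits
  change 2 * m * (3 * L.magnitude k ε ^ 2) + 4 * m + 2 * classes ε * n +
    3 * L.magnitude k ε ^ 2 + 20 ≤ _ ∧ _
  generalize L.magnitude k ε = S at *
  have h9 : 2 ^ 9 ≤ S ^ 9 := Nat.pow_le_pow_left hS 9
  have h12 : 512 * S ^ 3 ≤ S ^ 12 := by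
    calc 512 * S ^ 3 ≤ S ^ 9 * S ^ 3 := Nat.mul_le_mul_right _ h9
      _ = _ := by ring
  have h3 : 2 * S ^ 2 ≤ S ^ 3 := by
    calc 2 * S ^ 2 ≤ S * S ^ 2 := Nat.mul_le_mul_right _ hS
      _ = _ := by ring
  have h2 : 2 * S ≤ S ^ 2 := by
    calc 2 * S ≤ S * S := Nat.mul_le_mul_right _ hS
      _ = _ := by ring
  have hm2 : m * S ^ 2 ≤ S ^ 3 := by
    calc m * S ^ 2 ≤ S * S ^ 2 := Nat.mul_le_mul_right _ hm
      _ = _ := by ring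
  have hgn : classes ε * n ≤ 85 * S ^ 3 := by
    calc classes ε * n ≤ 85 * S ^ 2 * S := Nat.mul_le_mul hg hn
      _ = _ := by ring
  have e1 : 2 * m * (3 * S ^ 2) = 6 * (m * S ^ 2) := by ring
  have e2 : 2 * classes ε * n = 2 * (classes ε * n) := by ring
  rw [e1, e2]
  refine ⟨?_, ?_, ?_⟩ <;> omega

/-- The program runs in linear time, and its output is as required by `Finished`. -/
theorem exec_spanner : ∃ (P : Prog) (A : ℕ), ∀ (n m : ℕ) (G : WeightedGraph n) (L : EdgeList G m)
    (k : ℕ) (ε : ℝ) (hk : 1 ≤ k) (hε : 0 < ε), ∃ r t,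
      Exec (L.magnitude k ε ^ 12) P (L.initialState k ε) r t ∧ t ≤ A * (m + 1) ∧
      Finished (setup L hk hε) r := by
  refine ⟨.seq paramProg mainProg, maxCost paramProg + (8 + maxCost readProg +
    7 * (5 + maxCost roundProg)), fun n m G L k ε hk hε => ?_⟩
  obtain ⟨hW, hg, hgn⟩ := fits_magnitude L k hk hε
  obtain ⟨r₁, t₁, hx₁, ht₁, hR, hIn, h11⟩ := (wp_param L hk hε hg hgn).exec
  have he := slack_pos hε
  have hpos : (0 : ℝ) ≤ 2 * classes ε * n := by positivity
  obtain ⟨r, t₂, hx₂, ht₂, hfin⟩ := exec_main hR hIn h11 hW (Real.log_pos (by linarith))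
    (by
      rw [Real.exp_log (by linarith)]
      push_cast
      exact le_rfl)
    (Nat.succ_pos _) (fun p hp => endpoint_lt L hp) (fun i _ => edgeWeight_pos L i)
    (lt_add_of_pos_right 1 he) (fun i hi => abs_scale_le L k hε hi) (fun i _ => rfl)
  refine ⟨r, t₁ + t₂, .seq hx₁ hx₂, ?_, hfin⟩
  change t₂ ≤ _ * (m + 1) at ht₂
  rw [add_mul]
  exact Nat.add_le_add (ht₁.trans (Nat.le_mul_of_pos_right _ (Nat.succ_pos m))) ht₂

end

end

end SpannerAlgorithm

theorem theorem5 :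
    ∃ (P : RealRAM.Prog) (c C d : ℕ),
      ∀ (n m : ℕ) (G : WeightedGraph n) (L : EdgeList G m) (k : ℕ) (ε : ℝ), 1 ≤ k → 0 < ε →
        ∃ (r : RealRAM.State) (t : ℕ),
          RealRAM.Exec (L.magnitude k ε ^ c) P (L.initialState k ε) r t ∧
          t ≤ C * (m + 1) ∧
          IsSpanner G ((2 * (k : ℝ) - 1) * (1 + ε)) (L.outputGraph r) ∧
          ((L.outputGraph r).edgeSet.ncard : ℝ) ≤
            C * (1 + 1 / ε) ^ d * ((n : ℝ) ^ (1 + 1 / (k : ℝ)) * (1 + Real.log k)) := by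
  open SpannerAlgorithm in
  obtain ⟨P, A, hP⟩ := exec_spanner
  -- `12` is the exponent in `fits_magnitude`, and `57800 = 8 * 85 ^ 2` comes from `size_bound` and `classes_le`.
  refine ⟨P, 12, A + 57800, 4, fun n m G L k ε hk hε => ?_⟩
  obtain ⟨r, t, hx, ht, O, hout, hO, hspan, hcard⟩ := hP n m G L k ε hk hε
  have hk' : (1 : ℝ) ≤ k := by exact_mod_cast hk
  refine ⟨r, t, hx, ht.trans (Nat.mul_le_mul_right _ (Nat.le_add_right _ _)), ?_, ?_⟩
  · refine isSpanner_outputGraph (by nlinarith) hout hO fun i hi => (hspan i hi).mono subset_rfl ?_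
    change (2 * (k : ℝ) - 1) * (1 + 2 * slack ε) * edgeWeight L i ≤ _
    have h1 := two_mul_slack_le ε
    have h2 := (edgeWeight_pos L i).le
    have h3 : (0 : ℝ) ≤ 2 * k - 1 := by linarith
    gcongr
  · have h1 : ((L.outputGraph r).edgeSet.ncard : ℝ) ≤ O.card := by
      exact_mod_cast ncard_edgeSet_outputGraph_le hout
    have h2 : (O.card : ℝ) ≤ 8 * (classes ε : ℝ) ^ 2 * (n : ℝ) ^ (1 + 1 / (k : ℝ)) :=
      hcard.trans (size_bound (Nat.succ_pos _) hk)
    have h3 : (classes ε : ℝ) ^ 2 ≤ (85 * (1 + 1 / ε) ^ 2) ^ 2 := by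
      have := classes_le hε
      gcongr
    have h4 : 0 ≤ Real.log k := Real.log_nonneg hk'
    calc ((L.outputGraph r).edgeSet.ncard : ℝ)
        ≤ 8 * (classes ε : ℝ) ^ 2 * (n : ℝ) ^ (1 + 1 / (k : ℝ)) := h1.trans h2
      _ ≤ 8 * (85 * (1 + 1 / ε) ^ 2) ^ 2 * (n : ℝ) ^ (1 + 1 / (k : ℝ)) := by gcongr
      _ = 57800 * (1 + 1 / ε) ^ 4 * ((n : ℝ) ^ (1 + 1 / (k : ℝ)) * 1) := by ring
      _ ≤ _ := by
        gcongr
        · exact_mod_cast Nat.le_add_left _ _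
        · linarith
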